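/- Let $c\in\{-1,0,1\}$, $n\ge 1$, and let $\mathbb Q=\mathbb Q^{n+1}_c$ be the space form of curvature $c$: $\mathbb R^{n+1}$ if $c=0$, the unit sphere of $\mathbb R^{n+2}$ if $c=1$, the hyperboloid $\{\langle x,x\rangle=-1,\ x_{n+2}>0\}$ of Minkowski space $\mathbb R^{n+2}_1$ if $c=-1$. Put $(\mathrm{co},\mathrm{si})(s)=(\cos s,\sin s)$, $(1,s)$, $(\cosh s,\sinh s)$ for $c=1,0,-1$ respectively, and $\mathrm{ct}=\mathrm{co}/\mathrm{si}$. Let $I$ be an open interval, $w>0$ a smooth function on $I$, and equip $\mathbb Q\times I$ with the metric $\langle\cdot,\cdot\rangle_w=w(t)^2\langle\cdot,\cdot\rangle-dt^2$. For $t_0\in I$ put $\theta(t)=\int_{t_0}^t ds/w(s)$. A spacelike immersion $f$ of an $n$-dimensional manifold $\mathcal M$ into $\mathbb Q\times_w I$, with mean curvature vector $\vec H$ ($1/n$ times the trace of the second fundamental form), is marginally trapped if $\langle\vec H,\vec H\rangle_w=0$ everywhere; it is marginally trapped along $N$ if $N$ is a continuous, nowhere vanishing, null normal field along $f$ and $\vec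 H$ is everywhere collinear to $N$ (so that $f$ is marginally trapped). (1) Let $t_0\in I$, let $\varphi:\mathcal M\to\mathbb Q$ be an immersed hypersurface of class $C^4$ with Gauss map (continuous unit normal field) $\nu$ and shape operator $A$, $d\nu=-d\varphi\circ A$, and let $\tau\in C^2(\mathcal M)$ have values in $I$. Denote by $\kappa_1,\dots,\kappa_p$ the distinct principal curvatures of $\varphi$ at a point and by $m_1,\dots,m_p$ their multiplicities ($p$ and the $m_i$ may depend on the point). Put $$\bar\varphi=(\mathrm{co}(\theta\circ\tau)\varphi+\mathrm{si}(\theta\circ\tau)\nu,\ \tau),\qquad \bar\nu=(-c\,\mathrm{si}(\theta\circ\tau)\varphi+\mathrm{co}(\theta\circ\tau)\nu,\ w\circ\tau).$$ Then $\bar\varphi$ is a spacelike immersion (of class $C^2$, into $\mathbb Q\times_w I$) that is marginally trapped along $\bar\nu$ if and only if at every point $\mathrm{ct}(\theta\circ\tau)\ne\kappa_i$ for all $i$ and $$n\,w'(\tau)-\sum_{i=1}^p m_i\,\frac{\kappa_i\,\mathrm{ct}(\theta\circ\tau)+c}{\mathrm{ct}(\theta\circ\tau)-\kappa_i}=0,$$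 where, at points with $\mathrm{si}(\theta\circ\tau)=0$ (so that $\mathrm{ct}(\theta\circ\tau)=\infty$), the condition $\mathrm{ct}(\theta\circ\tau)\neq\kappa_i$ holds and the fraction means its limit $\kappa_i$. In this case $\bar\varphi$ is marginally trapped. (2) Conversely, let $f:\mathcal M\to\mathbb Q\times_w I$ be a spacelike immersion of class $C^5$ of an $n$-dimensional manifold. Say that $f$ is locally represented at $x$ if for every $t_1\in I$ and $\varepsilon>0$ there are $t_0\in I$ with $|t_0-t_1|<\varepsilon$, an open neighbourhood $U$ of $x$, a $C^4$ immersed hypersurface $\varphi:U\to\mathbb Q$ with Gauss map $\nu$, and $\tau\in C^2(U)$, such that $f=\bar\varphi$ on $U$ and the conditions of (1) (non-equality and equation) hold on $U$. If $f$ is marginally trapped along some null normal field $N$ on a neighbourhood of $x$, then $f$ is locally represented at $x$. If $f$ is marginally trapped, then the points at which it is locally represented form a dense subset of $\mathcal M$. -/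

import Mathlib

open scoped Manifold ContDiff
open Set

namespace RobertsonWalker

noncomputable section

/-! ### Space forms -/

/-- Dimension of the linear space in which the space form of dimension `n + 1` and curvature `c`
lives: `n + 1` if `c = 0` and `n + 2` if `c = 1` or `c = -1`. -/
def ambDim : SignType → ℕ → ℕ
  | .zero, n => n + 1
  | .pos, n => n + 2
  | .neg, n => n + 2

/-- The linear space in which the space form lives. -/
abbrev Amb (c : SignType) (n : ℕ) : Type := EuclideanSpace ℝ (Fin (ambDim c n))

/-- The flat scalar product of `Amb c n`: the Euclidean one if `c = 0` or `c = 1`, and the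
Lorentzian one, with a minus sign at the last coordinate (the one of index `n + 1`),
if `c = -1`. -/
def form (c : SignType) (n : ℕ) (x y : Amb c n) : ℝ :=
  ∑ i : Fin (ambDim c n), (if c = -1 ∧ (i : ℕ) = n + 1 then -1 else 1) * (x i * y i)

/-- The space form of dimension `n + 1`: Euclidean space, the unit sphere, or the upper sheet of
the hyperboloid. -/
def spaceForm : (c : SignType) → (n : ℕ) → Set (Amb c n)
  | .zero, _ => univ
  | .pos, n => {x | form .pos n x x = 1}
  | .neg, n => {x | form .neg n x x = -1 ∧ 0 < x (Fin.last (n + 1))}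

/-- The function `co`: `cos`, `1` or `cosh`. -/
def co : SignType → ℝ → ℝ
  | .zero, _ => 1
  | .pos, t => Real.cos t
  | .neg, t => Real.cosh t

/-- The function `si`: `sin`, `t` or `sinh`. -/
def si : SignType → ℝ → ℝ
  | .zero, t => t
  | .pos, t => Real.sin t
  | .neg, t => Real.sinh t

/-- The function `ct = co / si`. -/
def ct (c : SignType) (t : ℝ) : ℝ := co c t / si c t

/-! ### Hypersurfaces of a space form -/

section Manifold

variable {n : ℕ} {M : Type*} [TopologicalSpace M] [ChartedSpace (EuclideanSpace ℝ (Fin n)) M]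

/-- The differential at `x` of a map from an `n`-dimensional manifold to a vector space. -/
def dmap {E : Type*} [NormedAddCommGroup E] [NormedSpace ℝ E] (f : M → E) (x : M) :
    EuclideanSpace ℝ (Fin n) →L[ℝ] E :=
  mfderiv (𝓡 n) 𝓘(ℝ, E) f x

/-- The second derivative at `x` of a map from an `n`-dimensional manifold to a vector space, in
the preferred chart at `x`. -/
def ddmap {E : Type*} [NormedAddCommGroup E] [NormedSpace ℝ E] (f : M → E) (x : M)
    (u v : EuclideanSpace ℝ (Fin n)) : E :=
  fderiv ℝ (fderiv ℝ (f ∘ (extChartAt (𝓡 n) x).symm)) (extChartAt (𝓡 n) x x) u v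

/-- On the open set `U`, `φ` is an immersion of class `C^4` into the space form of dimension
`n + 1` and curvature `c`, and `ν` is a Gauss map of `φ`, i.e. a continuous field of unit vectors
tangent to the space form and normal to `φ`. -/
structure IsHypersurface (c : SignType) (U : Set M) (φ ν : M → Amb c n) : Prop where
  mem : ∀ x ∈ U, φ x ∈ spaceForm c n
  contMDiffOn : ContMDiffOn (𝓡 n) 𝓘(ℝ, Amb c n) 4 φ U
  immersion : ∀ x ∈ U, Function.Injective (dmap (n := n) φ x)
  continuousOn : ContinuousOn ν U
  tangent : ∀ x ∈ U, (c : ℝ) * form c n (φ x) (ν x) = 0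
  normal : ∀ x ∈ U, ∀ v : EuclideanSpace ℝ (Fin n), form c n (dmap φ x v) (ν x) = 0
  unit : ∀ x ∈ U, form c n (ν x) (ν x) = 1

/-- The shape operator `A` of `φ` with respect to `ν` at `x`, characterized by
`dν = - dφ ∘ A`. -/
def shapeOperator {c : SignType} (φ ν : M → Amb c n) (x : M) :
    Module.End ℝ (EuclideanSpace ℝ (Fin n)) :=
  Classical.epsilon fun A => ∀ v, dmap ν x v = - dmap φ x (A v)

/-- The multiplicity of the principal curvature `κ` at `x`. -/
def principalMultiplicity {c : SignType} (φ ν : M → Amb c n) (x : M) (κ : ℝ) : ℕ :=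
  Module.finrank ℝ (Module.End.eigenspace (shapeOperator φ ν x) κ)

/-- The quotient `(κ ct(s) + c) / (ct(s) - κ)`. Where `si(s) = 0`, so that `ct(s)` is infinite,
it takes its limit value `κ`. -/
def curvTerm (c : SignType) (κ s : ℝ) : ℝ :=
  if si c s = 0 then κ else (κ * ct c s + c) / (ct c s - κ)

/-! ### Submanifolds of codimension two of the warped product -/

/-- The function `θ`, primitive of `1 / w` that vanishes at `t₀`. -/
def theta (w : ℝ → ℝ) (t₀ t : ℝ) : ℝ := ∫ s in t₀..t, 1 / w s

/-- The map `(co(θ ∘ τ) φ + si(θ ∘ τ) ν, τ)`. -/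
def phiBar {c : SignType} (w : ℝ → ℝ) (t₀ : ℝ) (φ ν : M → Amb c n) (τ : M → ℝ) (x : M) :
    Amb c n × ℝ :=
  (co c (theta w t₀ (τ x)) • φ x + si c (theta w t₀ (τ x)) • ν x, τ x)

/-- The field `(-c si(θ ∘ τ) φ + co(θ ∘ τ) ν, w ∘ τ)` along `phiBar`. -/
def nuBar {c : SignType} (w : ℝ → ℝ) (t₀ : ℝ) (φ ν : M → Amb c n) (τ : M → ℝ) (x : M) :
    Amb c n × ℝ :=
  (-((c : ℝ) * si c (theta w t₀ (τ x))) • φ x + co c (theta w t₀ (τ x)) • ν x, w (τ x))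

/-- At the point `x`, no principal curvature `κ` satisfies `ct(θ ∘ τ) = κ`, and
`n w'(τ) - ∑ m (κ ct(θ ∘ τ) + c) / (ct(θ ∘ τ) - κ) = 0`, where the sum is over the distinct
principal curvatures `κ` and `m` is the multiplicity of `κ`. -/
def MainEquation {c : SignType} (w : ℝ → ℝ) (t₀ : ℝ) (φ ν : M → Amb c n) (τ : M → ℝ) (x : M) :
    Prop :=
  (∀ κ : Module.End.Eigenvalues (shapeOperator φ ν x),
    si c (theta w t₀ (τ x)) = 0 ∨ ct c (theta w t₀ (τ x)) ≠ (κ : ℝ)) ∧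
  n * deriv w (τ x) - ∑ κ : Module.End.Eigenvalues (shapeOperator φ ν x),
    principalMultiplicity φ ν x κ * curvTerm c κ (theta w t₀ (τ x)) = 0

/-- The warped metric `w(t)² ⟨·,·⟩ - dt²` on `Amb c n × I`. The metric of the Robertson-Walker
space is its restriction to the tangent vectors of the product of the space form with `I`. -/
def warpedMetric (c : SignType) (n : ℕ) (w : ℝ → ℝ) (p u v : Amb c n × ℝ) : ℝ :=
  w p.2 ^ 2 * form c n u.1 v.1 - u.2 * v.2

/-- Christoffel symbols of the first kind of a metric `G` on an open subset of a vector space. -/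
def christoffel {F : Type*} [NormedAddCommGroup F] [NormedSpace ℝ F] (G : F → F → F → ℝ)
    (p u v z : F) : ℝ :=
  (fderiv ℝ (fun q => G q v z) p u + fderiv ℝ (fun q => G q u z) p v
    - fderiv ℝ (fun q => G q u v) p z) / 2

/-- On the open set `U`, `f` is a spacelike immersion of class `C^k` into the product of the space
form with `I`: the metric induced by the warped metric is positive definite. -/
structure IsSpacelike (c : SignType) (I : Set ℝ) (w : ℝ → ℝ) (k : ℕ∞) (U : Set M)
    (f : M → Amb c n × ℝ) : Prop where
  mem : ∀ x ∈ U, f x ∈ spaceForm c n ×ˢ I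
  contMDiffOn : ContMDiffOn (𝓡 n) 𝓘(ℝ, Amb c n × ℝ) k f U
  pos : ∀ x ∈ U, ∀ v : EuclideanSpace ℝ (Fin n), v ≠ 0 → 0 < warpedMetric c n w (f x) (dmap f x v) (dmap f x v)

/-- `Z` is tangent at `f x` to the product of the space form with `I`, and normal to `f`. -/
def IsNormalAt {c : SignType} (w : ℝ → ℝ) (f : M → Amb c n × ℝ) (x : M) (Z : Amb c n × ℝ) :
    Prop :=
  (c : ℝ) * form c n (f x).1 Z.1 = 0 ∧ ∀ v : EuclideanSpace ℝ (Fin n), warpedMetric c n w (f x) (dmap f x v) Z = 0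

/-- For `Z` normal to `f` at `x`, the number `⟨h(u, v), Z⟩`, where `h` is the second fundamental
form of `f`. It is `⟨D_u (df v), Z⟩` for the Levi-Civita connection `D` of the warped metric on
`Amb c n × I`; that of the Robertson-Walker space is its orthogonal projection, and `Z` is tangent
to the Robertson-Walker space. -/
def secondForm {c : SignType} (w : ℝ → ℝ) (f : M → Amb c n × ℝ) (x : M) (Z : Amb c n × ℝ)
    (u v : EuclideanSpace ℝ (Fin n)) : ℝ :=
  warpedMetric c n w (f x) (ddmap f x u v) Z
    + christoffel (warpedMetric c n w) (f x) (dmap f x u) (dmap f x v) Z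

/-- The Gram matrix of the metric induced by `f` at `x`. -/
def gram {c : SignType} (w : ℝ → ℝ) (f : M → Amb c n × ℝ) (x : M) : Matrix (Fin n) (Fin n) ℝ :=
  Matrix.of fun i j => warpedMetric c n w (f x)
    (dmap f x (EuclideanSpace.single i 1)) (dmap f x (EuclideanSpace.single j 1))

/-- The mean curvature vector of `f` at `x`: the normal vector `H` such that, for every normal `Z`,
`⟨H, Z⟩` is `1 / n` times the trace of `⟨h, Z⟩` with respect to the induced metric. -/
def meanCurvatureVector {c : SignType} (w : ℝ → ℝ) (f : M → Amb c n × ℝ) (x : M) : Amb c n × ℝ :=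
  Classical.epsilon fun H => IsNormalAt w f x H ∧ ∀ Z, IsNormalAt w f x Z →
    warpedMetric c n w (f x) H Z = 1 / (n : ℝ) * ∑ i, ∑ j, (gram w f x)⁻¹ i j *
      secondForm w f x Z (EuclideanSpace.single i 1) (EuclideanSpace.single j 1)

/-- On `U`, `f` is marginally trapped: its mean curvature vector is null. -/
def IsMarginallyTrapped {c : SignType} (w : ℝ → ℝ) (U : Set M) (f : M → Amb c n × ℝ) : Prop :=
  ∀ x ∈ U, warpedMetric c n w (f x) (meanCurvatureVector w f x) (meanCurvatureVector w f x) = 0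

/-- On `U`, `N` is a continuous, nowhere vanishing, null normal field along `f`, and the mean
curvature vector of `f` is collinear to `N`. -/
structure IsMarginallyTrappedAlong {c : SignType} (w : ℝ → ℝ) (U : Set M) (f N : M → Amb c n × ℝ) :
    Prop where
  continuousOn : ContinuousOn N U
  ne_zero : ∀ x ∈ U, N x ≠ 0
  normal : ∀ x ∈ U, IsNormalAt w f x (N x)
  null : ∀ x ∈ U, warpedMetric c n w (f x) (N x) (N x) = 0
  collinear : ∀ x ∈ U, ∃ a : ℝ, meanCurvatureVector w f x = a • N x

/-- In a neighbourhood of `x`, `f` is of the form `(co(θ ∘ τ) φ + si(θ ∘ τ) ν, τ)` where `φ`, `ν`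
and `τ` satisfy the main equation; the base point `t₀` of `θ` can be chosen arbitrarily close to
any point of `I`. -/
def IsLocallyRepresentedAt {c : SignType} (I : Set ℝ) (w : ℝ → ℝ) (f : M → Amb c n × ℝ) (x : M) :
    Prop :=
  ∀ t₁ ∈ I, ∀ ε > 0, ∃ t₀ ∈ I, |t₀ - t₁| < ε ∧
    ∃ (U : Set M) (φ ν : M → Amb c n) (τ : M → ℝ), IsOpen U ∧ x ∈ U ∧
      IsHypersurface c U φ ν ∧ ContMDiffOn (𝓡 n) 𝓘(ℝ, ℝ) 2 τ U ∧
      (∀ y ∈ U, f y = phiBar w t₀ φ ν τ y) ∧ ∀ y ∈ U, MainEquation w t₀ φ ν τ y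

end Manifold

end

end RobertsonWalker

open RobertsonWalker

namespace RobertsonWalker

noncomputable section

open scoped Topology

/-! ### The functions `co` and `si` -/

/-! Let N be a null normal field along a spacelike f = (f₁, τ). Since the space factor is
Riemannian, N has nonzero time component and can be normalized to (ζ, w ∘ τ), with ζ a unit vector
tangent to the space form. Null geodesics of the warped product project to geodesics of the space
form, with θ as arc length. Following them from f back to the slice t = t₀ gives a map φ with unit
normal ν, and (f₁, ζ) arises from (φ, ν) by a generalized rotation of angle θ ∘ τ (`rot`,
`rotNormal`).

Everything is computed from two maps. The screen map Y = df₁ - w⁻¹ dτ ζ takes values orthogonal to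
ζ, and the induced metric is w²⟨Y, Y⟩. The Weingarten operator D is defined by dζ + c w⁻¹ dτ f₁ = Y
∘ D. Differentiating the normality of N expresses ⟨h, N⟩ through D (`secondForm_null`), and taking
traces gives n⟨H, N⟩ = -(tr D + n w'(τ)). In the Lorentzian normal plane the orthogonal of the null
vector N is its own line, so H is collinear to N exactly when tr D + n w'(τ) = 0 (`collinear_iff`).

For `phiBar`, Y = dφ ∘ S with S = co - si A, and D = -S⁻¹(c si + co A). The condition ct ≠ κ says
that S is invertible, which is equivalent to spacelikeness. As A is self-adjoint for the first
fundamental form, the trace can be computed on its eigenspaces (`trace_eq_sum_eigenvalues`) and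
gives the sum in the equation. This is `mainEquation_iff`.

Conversely, ζ is of class C⁴ by the implicit function theorem (`contMDiffAt_unit_field`), and going
back along the geodesics yields dφ = Y ∘ (co - si D). A base point t₀ arbitrarily close to t₁ makes
this injective (`exists_basePoint`). Then f is the `phiBar` of a hypersurface, and
`mainEquation_iff`, read backwards, gives the equation.

If H is only known to be null, there are locally two null normal fields, and H is pointwise
collinear to one of them. Where ⟨H, N₂⟩ ≠ 0, an open condition because tr D is continuous, H is
collinear to N₁; if ⟨H, N₂⟩ vanishes on an open set, H is collinear to N₂ there. Hence every open
set contains a point at which the previous case applies. -/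

lemma hasDerivAt_co (c : SignType) (t : ℝ) : HasDerivAt (co c) (-((c : ℝ) * si c t)) t := by
  rcases c with _ | _ | _
  · exact (hasDerivAt_const t (1 : ℝ)).congr_deriv (by simp)
  · exact (Real.hasDerivAt_cosh t).congr_deriv (by simp [si])
  · exact (Real.hasDerivAt_cos t).congr_deriv (by simp [si])

lemma hasDerivAt_si (c : SignType) (t : ℝ) : HasDerivAt (si c) (co c t) t := by
  rcases c with _ | _ | _
  · exact hasDerivAt_id t
  · exact Real.hasDerivAt_sinh t
  · exact Real.hasDerivAt_sin t

lemma analyticOnNhd_co (c : SignType) : AnalyticOnNhd ℝ (co c) univ := by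
  intro t _
  rcases c with _ | _ | _
  · exact analyticAt_const
  · exact Real.analyticAt_cosh
  · exact Real.analyticAt_cos

lemma analyticOnNhd_si (c : SignType) : AnalyticOnNhd ℝ (si c) univ := by
  intro t _
  rcases c with _ | _ | _
  · exact analyticAt_id
  · exact Real.analyticAt_sinh
  · exact Real.analyticAt_sin

lemma contDiff_co (c : SignType) {k : ℕ∞} : ContDiff ℝ k (co c) :=
  contDiff_iff_contDiffAt.2 fun t => (analyticOnNhd_co c t trivial).contDiffAt

lemma contDiff_si (c : SignType) {k : ℕ∞} : ContDiff ℝ k (si c) :=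
  contDiff_iff_contDiffAt.2 fun t => (analyticOnNhd_si c t trivial).contDiffAt

lemma co_sq_add_si_sq (c : SignType) (t : ℝ) : co c t ^ 2 + c * si c t ^ 2 = 1 := by
  rcases c with _ | _ | _
  · simp [co, si]
  · simp [co, si, Real.cosh_sq]
  · simp [co, si]

lemma co_zero (c : SignType) : co c 0 = 1 := by rcases c with _ | _ | _ <;> simp [co]

lemma si_zero (c : SignType) : si c 0 = 0 := by rcases c with _ | _ | _ <;> simp [si]

lemma sign_cube (c : SignType) : (c : ℝ) * c * c = c := by
  rcases c with _ | _ | _ <;> simp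

/-! ### The flat scalar product -/

lemma form_comm (c : SignType) (n : ℕ) (x y : Amb c n) : form c n x y = form c n y x := by
  simp only [form, mul_comm (x _)]

/-- The flat scalar product as a continuous bilinear map. -/
def formL (c : SignType) (n : ℕ) : Amb c n →L[ℝ] Amb c n →L[ℝ] ℝ :=
  (LinearMap.mk₂ ℝ (form c n)
    (fun x y z => by simp [form, add_mul, mul_add, Finset.sum_add_distrib])
    (fun a x y => by
      simp only [form, PiLp.smul_apply, smul_eq_mul, Finset.mul_sum]
      exact Finset.sum_congr rfl fun i _ => by ring)
    (fun x y z => by simp [form, mul_add, Finset.sum_add_distrib])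
    (fun a x y => by
      simp only [form, PiLp.smul_apply, smul_eq_mul, Finset.mul_sum]
      exact Finset.sum_congr rfl fun i _ => by ring)).toContinuousBilinearMap

lemma formL_apply (c : SignType) (n : ℕ) (x y : Amb c n) : formL c n x y = form c n x y := rfl

section
variable {c : SignType} {n : ℕ} (x y z : Amb c n) (a : ℝ)

lemma form_add_left : form c n (x + y) z = form c n x z + form c n y z := by
  simp [← formL_apply]
lemma form_add_right : form c n x (y + z) = form c n x y + form c n x z := by
  simp [← formL_apply]
lemma form_sub_left : form c n (x - y) z = form c n x z - form c n y z := by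
  simp [← formL_apply]
lemma form_sub_right : form c n x (y - z) = form c n x y - form c n x z := by
  simp [← formL_apply]
lemma form_neg_left : form c n (-x) y = -form c n x y := by simp [← formL_apply]
lemma form_neg_right : form c n x (-y) = -form c n x y := by simp [← formL_apply]
lemma form_smul_left : form c n (a • x) y = a * form c n x y := by simp [← formL_apply]
lemma form_smul_right : form c n x (a • y) = a * form c n x y := by simp [← formL_apply]
lemma form_zero_left : form c n 0 y = 0 := by simp [← formL_apply]
lemma form_zero_right : form c n x 0 = 0 := by simp [← formL_apply]

end

lemma form_neg_last {n : ℕ} (x y : Amb .neg n) : form .neg n x y =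
    ∑ i : Fin (n + 1), x i.castSucc * y i.castSucc - x (Fin.last (n + 1)) * y (Fin.last (n + 1)) := by
  have h : form .neg n x y = ∑ i : Fin (n + 1 + 1),
    (if (SignType.neg = -1) ∧ (i : ℕ) = n + 1 then -1 else 1) * (x i * y i) := rfl
  rw [h, Fin.sum_univ_castSucc]
  have h1 : ∀ i : Fin (n + 1), (i : ℕ) ≠ n + 1 := fun i => i.2.ne
  simp [h1, sub_eq_add_neg]

lemma form_of_ne {c : SignType} {n : ℕ} (hc : c ≠ -1) (x y : Amb c n) :
    form c n x y = ∑ i, x i * y i := by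
  simp [form, hc]

/-- The factor c makes such relations meaningful for c = ±1 and vacuous for c = 0, where the space
form has no position constraint. Together with `sign_cube` it lets one computation serve all three
curvatures. -/
lemma sign_mul_form_self {c : SignType} {n : ℕ} {p : Amb c n} (hp : p ∈ spaceForm c n) :
    (c : ℝ) * form c n p p = c * c := by
  rcases c with _ | _ | _
  · simp
  · have : form .neg n p p = -1 := hp.1
    rw [this]; simp
  · have : form .pos n p p = 1 := hp
    rw [this]; simp

/-- The flat scalar product is positive definite on the tangent spaces of the space form. -/
lemma form_self_pos {c : SignType} {n : ℕ} {p v : Amb c n} (hp : p ∈ spaceForm c n)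
    (hv : (c : ℝ) * form c n p v = 0) (hv0 : v ≠ 0) : 0 < form c n v v := by
  by_cases hc : c = -1
  · subst hc
    change Amb .neg n at p v
    have h1 : form .neg n p p = -1 := hp.1
    have h2 : form .neg n p v = 0 := by simpa using hv
    change 0 < form .neg n v v
    rw [form_neg_last] at h1 h2 ⊢
    set P := p (Fin.last (n + 1))
    set W := v (Fin.last (n + 1))
    have hcs := Finset.sum_mul_sq_le_sq_mul_sq Finset.univ
      (fun i : Fin (n + 1) => p i.castSucc) (fun i => v i.castSucc)
    simp only [← sq] at h1 ⊢
    set S := ∑ i : Fin (n + 1), p i.castSucc ^ 2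
    set T := ∑ i : Fin (n + 1), v i.castSucc ^ 2 with hT
    have hT0 : 0 ≤ T := Finset.sum_nonneg fun i _ => sq_nonneg _
    rw [show (∑ i : Fin (n + 1), p i.castSucc * v i.castSucc) = P * W by linarith,
      show S = P ^ 2 - 1 by linarith] at hcs
    -- With S = P² - 1, Cauchy-Schwarz and T ≤ W² give P²W² ≤ (P² - 1)W², which forces W = 0 and
    -- then T = 0.
    by_contra hcon
    have hTW : T ≤ W ^ 2 := by linarith
    have hS : 0 ≤ P ^ 2 - 1 := by
      have : 0 ≤ S := Finset.sum_nonneg fun i _ => sq_nonneg _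
      linarith
    have hW : W ^ 2 ≤ 0 := by nlinarith
    have hT1 : T = 0 := le_antisymm (by linarith) hT0
    refine hv0 ?_
    have hT2 := (Finset.sum_eq_zero_iff_of_nonneg (fun i _ => sq_nonneg _)).1 (hT ▸ hT1)
    ext i
    refine Fin.lastCases ?_ (fun j => ?_) (i : Fin (n + 1 + 1))
    · exact pow_eq_zero_iff (two_ne_zero) |>.1 (le_antisymm hW (sq_nonneg _))
    · exact pow_eq_zero_iff (two_ne_zero) |>.1 (hT2 j (Finset.mem_univ j))
  · rw [form_of_ne hc]
    refine lt_of_le_of_ne (Finset.sum_nonneg fun i _ => mul_self_nonneg _) fun h => hv0 ?_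
    have h2 := (Finset.sum_eq_zero_iff_of_nonneg (fun i _ => mul_self_nonneg (v i))).1 h.symm
    ext i
    exact mul_self_eq_zero.1 (h2 i (Finset.mem_univ i))

lemma form_self_nonneg {c : SignType} {n : ℕ} {p v : Amb c n} (hp : p ∈ spaceForm c n)
    (hv : (c : ℝ) * form c n p v = 0) : 0 ≤ form c n v v := by
  rcases eq_or_ne v 0 with rfl | h
  · rw [form_zero_left]
  · exact (form_self_pos hp hv h).le

/-- The point reached from `p` in the unit direction `v` lies in the space form. -/
lemma geodesic_mem_spaceForm {c : SignType} {n : ℕ} {p v : Amb c n} (hp : p ∈ spaceForm c n)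
    (hv : (c : ℝ) * form c n p v = 0) (hv1 : form c n v v = 1) (t : ℝ) :
    co c t • p + si c t • v ∈ spaceForm c n := by
  have key : (c : ℝ) * form c n (co c t • p + si c t • v) (co c t • p + si c t • v) = c * c := by
    have h1 := sign_mul_form_self hp
    have h2 := co_sq_add_si_sq c t
    have h3 : (c : ℝ) * form c n v p = 0 := by rw [form_comm]; exact hv
    simp only [form_add_left, form_add_right, form_smul_left, form_smul_right, hv1]
    have h4 := sign_cube c
    linear_combination (co c t) ^ 2 * h1 + co c t * si c t * hv + co c t * si c t * h3 +
      c * c * h2 - (si c t) ^ 2 * h4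
  by_cases hc : c = -1
  · subst hc
    change Amb .neg n at p v
    have hq : form .neg n (co .neg t • p + si .neg t • v) (co .neg t • p + si .neg t • v) = -1 := by
      have : ((-1 : SignType) : ℝ) = -1 := by simp
      rw [this] at key
      have h2 : form (-1) n (co .neg t • p + si .neg t • v) (co .neg t • p + si .neg t • v) = -1 := by
        change -1 * form (-1) n (co .neg t • p + si .neg t • v) (co .neg t • p + si .neg t • v) =
          _ at key
        linarith
      exact h2
    refine ⟨hq, ?_⟩
    have h1 : form .neg n p p = -1 := hp.1
    have h2 : form .neg n p v = 0 := by simpa using hv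
    have hpq : form .neg n p (co .neg t • p + si .neg t • v) = -Real.cosh t := by
      rw [form_add_right, form_smul_right, form_smul_right, h1, h2]; simp [co]
    have hP : 0 < p (Fin.last (n + 1)) := hp.2
    change 0 < (co .neg t • p + si .neg t • v) (Fin.last (n + 1))
    generalize co .neg t • p + si .neg t • v = q at hq hpq
    change Amb .neg n at q
    rw [form_neg_last] at h1 hq hpq
    -- If the last coordinate W were nonpositive, then X = PW - cosh t < PW ≤ 0 and X² > P²W²,
    -- whereas Cauchy-Schwarz bounds X² by (P² - 1)(W² - 1).
    by_contra hcon
    have hcs := Finset.sum_mul_sq_le_sq_mul_sq Finset.univ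
      (fun i : Fin (n + 1) => p i.castSucc) (fun i => q i.castSucc)
    simp only [← sq] at h1 hq
    set P := p (Fin.last (n + 1))
    set W := q (Fin.last (n + 1))
    set S := ∑ i : Fin (n + 1), p i.castSucc ^ 2
    set T := ∑ i : Fin (n + 1), q i.castSucc ^ 2
    set X := ∑ i : Fin (n + 1), p i.castSucc * q i.castSucc
    have hW : W ≤ 0 := not_lt.1 hcon
    have hX : X < P * W := by have := Real.cosh_pos t; linarith
    have hPW : P * W ≤ 0 := mul_nonpos_of_nonneg_of_nonpos hP.le hW
    have hS : S = P ^ 2 - 1 := by linarith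
    have hT : T = W ^ 2 - 1 := by linarith
    have hT0 : 0 ≤ T := Finset.sum_nonneg fun i _ => sq_nonneg _
    have : (P * W) ^ 2 < X ^ 2 := by nlinarith
    rw [hS, hT] at hcs
    nlinarith [sq_nonneg P]
  · rcases c with _ | _ | _
    · trivial
    · exact absurd rfl hc
    · change form .pos n _ _ = 1
      have h : ((SignType.pos : SignType) : ℝ) = 1 := by simp
      rw [h] at key
      linarith

/-- The tangent space of the space form at `p`. -/
def tangentSub {c : SignType} {n : ℕ} (p : Amb c n) : Submodule ℝ (Amb c n) :=
  LinearMap.ker ((c : ℝ) • (formL c n p : Amb c n →ₗ[ℝ] ℝ))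

lemma mem_tangentSub {c : SignType} {n : ℕ} {p v : Amb c n} :
    v ∈ tangentSub p ↔ (c : ℝ) * form c n p v = 0 := by
  simp [tangentSub, formL_apply]

lemma finrank_tangentSub {c : SignType} {n : ℕ} {p : Amb c n} (hp : p ∈ spaceForm c n) :
    Module.finrank ℝ (tangentSub p) = n + 1 := by
  have hr := LinearMap.finrank_range_add_finrank_ker ((c : ℝ) • (formL c n p : Amb c n →ₗ[ℝ] ℝ))
  have hn := finrank_euclideanSpace_fin (𝕜 := ℝ) (n := ambDim c n)
  change _ = Module.finrank ℝ (Amb c n) at hr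
  by_cases hc : c = 0
  · subst hc
    have : (tangentSub p : Submodule ℝ (Amb 0 n)) = ⊤ := by
      ext v; simp [mem_tangentSub]
    rw [this, finrank_top]
    exact hn
  -- For c = ±1 the functional c⟨p, ·⟩ takes the value 1 at p, so its kernel has codimension one.
  · have hs : Function.Surjective ((c : ℝ) • (formL c n p : Amb c n →ₗ[ℝ] ℝ)) := by
      intro a
      have h1 := sign_mul_form_self hp
      have h2 : (c : ℝ) * c = 1 := by rcases c with _ | _ | _ <;> simp at hc ⊢
      refine ⟨a • p, ?_⟩
      have : ((c : ℝ) • (formL c n p : Amb c n →ₗ[ℝ] ℝ)) (a • p) = c * (a * form c n p p) := by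
        simp [formL_apply]; try ring
      rw [this]
      linear_combination a * h1 + a * h2
    rw [LinearMap.range_eq_top.2 hs, finrank_top] at hr
    have hd : ambDim c n = n + 2 := by rcases c with _ | _ | _ <;> first | rfl | exact absurd rfl hc
    change _ + Module.finrank ℝ (tangentSub p) = _ at hr
    rw [hn, Module.finrank_self] at hr
    omega

/-! ### Linear algebra -/

/-- If `g` is a scalar product on `V` for which `A` is self-adjoint, and `K` acts on the eigenspaces
of `A` as the multiplication by `q`, then the trace of `K` is the sum of the values of `q` at the
eigenvalues of `A`, counted with multiplicity. -/
lemma trace_eq_sum_eigenvalues {V : Type*} [AddCommGroup V] [Module ℝ V] [FiniteDimensional ℝ V]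
    (g : V →ₗ[ℝ] V →ₗ[ℝ] ℝ) (hg : ∀ u v, g u v = g v u) (hpos : ∀ v, v ≠ 0 → 0 < g v v)
    (A K : Module.End ℝ V) [Fintype (Module.End.Eigenvalues A)]
    (hA : ∀ u v, g (A u) v = g u (A v)) (q : ℝ → ℝ)
    (hK : ∀ κ : ℝ, ∀ v ∈ Module.End.eigenspace A κ, K v = q κ • v) :
    LinearMap.trace ℝ V K = ∑ κ : Module.End.Eigenvalues A,
      (Module.finrank ℝ (Module.End.eigenspace A (κ : ℝ)) : ℝ) * q κ := by
  classical
  have hnn : ∀ v, 0 ≤ g v v := fun v => by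
    rcases eq_or_ne v 0 with rfl | h
    · simp
    · exact (hpos v h).le
  -- The spectral theorem is applied with g as inner product: a shape operator is self-adjoint for
  -- the first fundamental form, not for the standard scalar product of the model space.
  let core : InnerProductSpace.Core ℝ V :=
    { inner := fun u v => g u v
      conj_inner_symm := fun u v => by simpa using hg v u
      re_inner_nonneg := fun v => by simpa using hnn v
      add_left := fun u v z => by simp
      smul_left := fun u v r => by simp
      definite := fun v hv => by
        by_contra h
        exact (hpos v h).ne' hv }
  let _ : NormedAddCommGroup V := core.toNormedAddCommGroup
  let _ : InnerProductSpace ℝ V := InnerProductSpace.ofCore core.toCore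
  have hsym : LinearMap.IsSymmetric A := fun u v => hA u v
  have hint := hsym.direct_sum_isInternal
  have hmaps : ∀ κ : Module.End.Eigenvalues A,
      MapsTo K (Module.End.eigenspace A (κ : ℝ)) (Module.End.eigenspace A (κ : ℝ)) := by
    intro κ v hv
    rw [SetLike.mem_coe, hK κ v hv]
    exact Submodule.smul_mem _ _ hv
  rw [LinearMap.trace_eq_sum_trace_restrict hint hmaps]
  refine Finset.sum_congr rfl fun κ _ => ?_
  have : K.restrict (hmaps κ) = q κ • LinearMap.id := by
    ext v
    simp only [LinearMap.smul_apply, LinearMap.id_coe, id_eq, Submodule.coe_smul]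
    exact hK κ v v.2
  rw [this, map_smul, LinearMap.trace_id, smul_eq_mul, mul_comm]

/-- The trace of an endomorphism in terms of the Gram matrix of a scalar product. -/
lemma sum_gram_inv_eq_trace {n : ℕ}
    (g : EuclideanSpace ℝ (Fin n) →ₗ[ℝ] EuclideanSpace ℝ (Fin n) →ₗ[ℝ] ℝ)
    (hpos : ∀ v, v ≠ 0 → 0 < g v v) (D : Module.End ℝ (EuclideanSpace ℝ (Fin n))) :
    ∑ i, ∑ j, (Matrix.of fun i j => g (EuclideanSpace.single i 1) (EuclideanSpace.single j 1))⁻¹ i j *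
      g (EuclideanSpace.single j 1) (D (EuclideanSpace.single i 1)) = LinearMap.trace ℝ _ D := by
  set G : Matrix (Fin n) (Fin n) ℝ :=
    Matrix.of fun i j => g (EuclideanSpace.single i 1) (EuclideanSpace.single j 1) with hG
  have hsum : ∀ v : EuclideanSpace ℝ (Fin n), v = ∑ k, v k • EuclideanSpace.single k (1 : ℝ) := by
    intro v
    have := (EuclideanSpace.basisFun (Fin n) ℝ).sum_repr v
    simpa using this.symm
  -- A vector in the kernel of the Gram matrix is g-orthogonal to every basis vector, hence to
  -- itself.
  have hdet : IsUnit G.det := by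
    rw [← Matrix.isUnit_iff_isUnit_det, ← Matrix.mulVec_injective_iff_isUnit]
    have hker : ∀ x, G.mulVec x = 0 → x = 0 := by
      intro x hx
      set v : EuclideanSpace ℝ (Fin n) := WithLp.toLp 2 x
      have hv : v = 0 := by
        by_contra hne
        refine (hpos v hne).ne' ?_
        have h1 : ∀ i, g (EuclideanSpace.single i 1) v = 0 := by
          intro i
          have h2 : G.mulVec x i = 0 := congrFun hx i
          rw [hsum v, map_sum]
          simp only [map_smul, smul_eq_mul]
          rw [← h2, Matrix.mulVec, dotProduct]
          exact Finset.sum_congr rfl fun k _ => by simp [hG, v, mul_comm]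
        calc g v v = g (∑ k, v k • EuclideanSpace.single k (1 : ℝ)) v := by rw [← hsum v]
          _ = 0 := by simp [h1]
      ext i
      exact congrArg (fun u : EuclideanSpace ℝ (Fin n) => u i) hv
    intro x y hxy
    exact sub_eq_zero.1 (hker _ (by rw [Matrix.mulVec_sub, hxy, sub_self]))
  have hinv : G⁻¹ * G = 1 := Matrix.nonsing_inv_mul G hdet
  have htr : LinearMap.trace ℝ _ D = ∑ i, (D (EuclideanSpace.single i 1)) i := by
    rw [LinearMap.trace_eq_matrix_trace ℝ (EuclideanSpace.basisFun (Fin n) ℝ).toBasis]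
    simp [Matrix.trace, LinearMap.toMatrix_apply]
  rw [htr]
  refine Finset.sum_congr rfl fun i _ => ?_
  set u := D (EuclideanSpace.single i 1)
  have h1 : ∀ j, g (EuclideanSpace.single j 1) u = ∑ k, u k * G j k := by
    intro j
    conv_lhs => rw [hsum u, map_sum]
    simp [hG]
  simp only [h1, Finset.mul_sum]
  rw [Finset.sum_comm]
  have h2 : ∀ k, ∑ j, G⁻¹ i j * (u k * G j k) = u k * (1 : Matrix (Fin n) (Fin n) ℝ) i k := by
    intro k
    rw [← hinv, Matrix.mul_apply, Finset.mul_sum]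
    exact Finset.sum_congr rfl fun j _ => by ring
  simp [h2, Matrix.one_apply]

/-- At a point `p` of the space form, `a` is an isomorphism onto the orthogonal complement of the
unit tangent vector `z` in the tangent space of the space form. -/
structure AdaptedFrame {c : SignType} {n : ℕ} (p : Amb c n)
    (a : EuclideanSpace ℝ (Fin n) →L[ℝ] Amb c n) (z : Amb c n) : Prop where
  mem : p ∈ spaceForm c n
  injective : Function.Injective a
  tangent : ∀ v, (c : ℝ) * form c n p (a v) = 0
  normal : ∀ v, form c n (a v) z = 0
  tangent_unit : (c : ℝ) * form c n p z = 0
  unit : form c n z z = 1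

namespace AdaptedFrame

variable {c : SignType} {n : ℕ} {p z : Amb c n} {a : EuclideanSpace ℝ (Fin n) →L[ℝ] Amb c n}

lemma pos (h : AdaptedFrame p a z) {v : EuclideanSpace ℝ (Fin n)} (hv : v ≠ 0) :
    0 < form c n (a v) (a v) :=
  form_self_pos h.mem (h.tangent v) fun h0 => hv (h.injective (by rw [h0, map_zero]))

/-- Dimension count: (v, s) ↦ a v + s z is injective between spaces of dimension n + 1, hence onto
the tangent space, and pairing with z shows s = 0. -/
lemma exists_eq (h : AdaptedFrame p a z) {W : Amb c n} (hW : (c : ℝ) * form c n p W = 0)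
    (hz : form c n W z = 0) : ∃ v, W = a v := by
  let L : EuclideanSpace ℝ (Fin n) × ℝ →ₗ[ℝ] tangentSub p :=
    LinearMap.codRestrict _ ((a : EuclideanSpace ℝ (Fin n) →ₗ[ℝ] Amb c n).coprod
      (LinearMap.toSpanSingleton ℝ _ z)) (by
        rintro ⟨v, s⟩
        rw [mem_tangentSub]
        simp only [LinearMap.coprod_apply, ContinuousLinearMap.coe_coe,
          LinearMap.toSpanSingleton_apply, form_add_right, form_smul_right]
        linear_combination h.tangent v + s * h.tangent_unit)
  have hL : ∀ v s, (L (v, s) : Amb c n) = a v + s • z := fun v s => rfl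
  have hinj : Function.Injective L := by
    rw [← LinearMap.ker_eq_bot, LinearMap.ker_eq_bot']
    rintro ⟨v, s⟩ hvs
    have h1 : a v + s • z = 0 := by rw [← hL, hvs]; rfl
    have h2 : s = 0 := by
      have := congrArg (fun W => form c n W z) h1
      simpa [form_add_left, form_smul_left, h.normal, h.unit, form_zero_left] using this
    subst h2
    have h3 : v = 0 := h.injective (by simpa using h1)
    simp [h3]
  have hfr : Module.finrank ℝ (EuclideanSpace ℝ (Fin n) × ℝ) = Module.finrank ℝ (tangentSub p) := by
    rw [finrank_tangentSub h.mem]; simp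
  obtain ⟨⟨v, s⟩, hv⟩ := (LinearMap.injective_iff_surjective_of_finrank_eq_finrank hfr).1 hinj
    ⟨W, mem_tangentSub.2 hW⟩
  have hv' : a v + s • z = W := by rw [← hL, hv]
  have hs : s = 0 := by
    have := congrArg (fun W => form c n W z) hv'
    simpa [form_add_left, form_smul_left, h.normal, h.unit, hz] using this
  exact ⟨v, by rw [← hv', hs]; simp⟩

lemma eq_zero (h : AdaptedFrame p a z) {W : Amb c n} (hW : (c : ℝ) * form c n p W = 0)
    (hz : form c n W z = 0) (ha : ∀ v, form c n (a v) W = 0) : W = 0 := by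
  obtain ⟨v, rfl⟩ := h.exists_eq hW hz
  by_contra hne
  exact (form_self_pos h.mem hW hne).ne' (ha v)

/-- A linear map into the orthogonal complement of `z` in the tangent space factors through the
frame. -/
lemma exists_factor (h : AdaptedFrame p a z) (L : EuclideanSpace ℝ (Fin n) →L[ℝ] Amb c n)
    (hL : ∀ v, (c : ℝ) * form c n p (L v) = 0) (hz : ∀ v, form c n (L v) z = 0) :
    ∃ D : Module.End ℝ (EuclideanSpace ℝ (Fin n)), ∀ v, L v = a (D v) := by
  choose D hD using fun v => h.exists_eq (hL v) (hz v)
  refine ⟨{ toFun := D, map_add' := fun u v => ?_, map_smul' := fun r v => ?_ }, hD⟩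
  · exact h.injective (by rw [← hD, map_add, map_add, hD, hD])
  · exact h.injective (by rw [← hD, map_smul, hD]; simp)

end AdaptedFrame

/-- The bilinear form induced by a linear map into the ambient space. -/
def inducedForm {c : SignType} {n : ℕ} (a : EuclideanSpace ℝ (Fin n) →L[ℝ] Amb c n) :
    EuclideanSpace ℝ (Fin n) →L[ℝ] EuclideanSpace ℝ (Fin n) →L[ℝ] ℝ :=
  (formL c n).bilinearComp a a

lemma inducedForm_apply {c : SignType} {n : ℕ} (a : EuclideanSpace ℝ (Fin n) →L[ℝ] Amb c n)
    (u v : EuclideanSpace ℝ (Fin n)) : inducedForm a u v = form c n (a u) (a v) := rfl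

/-- Positivity makes v ↦ g(v, ·) injective, and V has the dimension of its dual. The bundled inverse
is what later makes tangential projections continuous in the base point. -/
lemma isInvertible_of_pos {V : Type*} [NormedAddCommGroup V] [NormedSpace ℝ V]
    [FiniteDimensional ℝ V] {g : V →L[ℝ] V →L[ℝ] ℝ} (hpos : ∀ v, v ≠ 0 → 0 < g v v) :
    g.IsInvertible := by
  have hinj : Function.Injective (g : V →ₗ[ℝ] V →L[ℝ] ℝ) := by
    rw [← LinearMap.ker_eq_bot, LinearMap.ker_eq_bot']
    intro v hv
    by_contra h
    have : g v v = 0 := by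
      change (g : V →ₗ[ℝ] V →L[ℝ] ℝ) v v = 0
      rw [hv]; rfl
    exact (hpos v h).ne' this
  have hfr : Module.finrank ℝ V = Module.finrank ℝ (V →L[ℝ] ℝ) := by
    rw [← (LinearMap.toContinuousLinearMap (𝕜 := ℝ) (E := V) (F' := ℝ)).finrank_eq,
      Module.finrank_linearMap_self]
  refine ⟨(LinearEquiv.ofInjectiveOfFinrankEq _ hinj hfr).toContinuousLinearEquiv, ?_⟩
  ext v
  rfl

/-! ### Differentiation in charts -/

section Charts

variable {n : ℕ} {M : Type*} [TopologicalSpace M] [ChartedSpace (EuclideanSpace ℝ (Fin n)) M]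
  {F : Type*} [NormedAddCommGroup F] [NormedSpace ℝ F]

lemma dmap_eq_fderiv {f : M → F} {x : M} (hf : MDifferentiableAt (𝓡 n) 𝓘(ℝ, F) f x) :
    dmap f x = fderiv ℝ (f ∘ (extChartAt (𝓡 n) x).symm) (extChartAt (𝓡 n) x x) := by
  refine (MDifferentiableAt.mfderiv hf).trans ?_
  simp only [writtenInExtChartAt, extChartAt_model_space_eq_id, PartialEquiv.refl_coe,
    Function.id_comp, modelWithCornersSelf_coe, range_id]
  exact congrFun fderivWithin_univ _

lemma contDiffAt_chart {f : M → F} {x : M} {k : ℕ∞ω} (hf : ContMDiffAt (𝓡 n) 𝓘(ℝ, F) k f x) :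
    ContDiffAt ℝ k (f ∘ (extChartAt (𝓡 n) x).symm) (extChartAt (𝓡 n) x x) := by
  have h := (contMDiffAt_iff.1 hf).2
  simpa only [extChartAt_model_space_eq_id, PartialEquiv.refl_coe, Function.id_comp,
    modelWithCornersSelf_coe, range_id, contDiffWithinAt_univ] using h

lemma contMDiffAt_of_chart {f : M → F} {x : M} {k : ℕ∞ω} (hc : ContinuousAt f x)
    (hf : ContDiffAt ℝ k (f ∘ (extChartAt (𝓡 n) x).symm) (extChartAt (𝓡 n) x x)) :
    ContMDiffAt (𝓡 n) 𝓘(ℝ, F) k f x := by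
  refine contMDiffAt_iff.2 ⟨hc, ?_⟩
  simpa only [extChartAt_model_space_eq_id, PartialEquiv.refl_coe, Function.id_comp,
    modelWithCornersSelf_coe, range_id, contDiffWithinAt_univ] using hf

lemma tendsto_chart_symm (x : M) :
    Filter.Tendsto (extChartAt (𝓡 n) x).symm (𝓝 (extChartAt (𝓡 n) x x)) (𝓝 x) := by
  have h := continuousAt_extChartAt_symm (I := 𝓡 n) x
  rw [ContinuousAt, extChartAt_to_inv] at h
  exact h

lemma tendsto_chart (x : M) :
    Filter.Tendsto (extChartAt (𝓡 n) x) (𝓝 x) (𝓝 (extChartAt (𝓡 n) x x)) :=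
  continuousAt_extChartAt x

lemma eventually_chart {x : M} {P : M → Prop} :
    (∀ᶠ z in 𝓝 (extChartAt (𝓡 n) x x), P ((extChartAt (𝓡 n) x).symm z)) ↔ ∀ᶠ y in 𝓝 x, P y := by
  refine ⟨fun h => ?_, fun h => tendsto_chart_symm x h⟩
  filter_upwards [tendsto_chart x h, extChartAt_source_mem_nhds (I := 𝓡 n) x] with y hy hs
  have hy' : P ((extChartAt (𝓡 n) x).symm (extChartAt (𝓡 n) x y)) := hy
  rwa [(extChartAt (𝓡 n) x).left_inv hs] at hy'

variable [IsManifold (𝓡 n) ∞ M]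

/-- Near `x`, the derivatives of all maps read in the chart at `x` differ from their derivatives
`dmap` by a linear isomorphism. -/
lemma eventually_fderiv_chart_eq (x : M) : ∀ᶠ z in 𝓝 (extChartAt (𝓡 n) x x),
    ∃ T : EuclideanSpace ℝ (Fin n) ≃L[ℝ] EuclideanSpace ℝ (Fin n),
      ∀ (F : Type) [NormedAddCommGroup F] [NormedSpace ℝ F] (f : M → F),
        MDifferentiableAt (𝓡 n) 𝓘(ℝ, F) f ((extChartAt (𝓡 n) x).symm z) →
        fderiv ℝ (f ∘ (extChartAt (𝓡 n) x).symm) z =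
          (dmap f ((extChartAt (𝓡 n) x).symm z)).comp
            (T : EuclideanSpace ℝ (Fin n) →L[ℝ] EuclideanSpace ℝ (Fin n)) := by
  have : IsManifold (𝓡 n) 1 M := IsManifold.of_le (n := ∞) (by exact_mod_cast le_top)
  filter_upwards [extChartAt_target_mem_nhds (I := 𝓡 n) x] with z hz
  -- T is the derivative of the inverse chart, so it does not depend on the map being
  -- differentiated: one T serves f, ζ and τ simultaneously.
  obtain ⟨T, hT⟩ := isInvertible_mfderivWithin_extChartAt_symm (I := 𝓡 n) hz
  refine ⟨T, fun F _ _ f hf => ?_⟩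
  have hsymm : MDifferentiableAt 𝓘(ℝ, EuclideanSpace ℝ (Fin n)) (𝓡 n)
      (extChartAt (𝓡 n) x).symm z := by
    have := mdifferentiableWithinAt_extChartAt_symm (I := 𝓡 n) hz
    simpa [mdifferentiableWithinAt_univ] using this
  have hcomp := mfderiv_comp z hf hsymm
  rw [mfderiv_eq_fderiv] at hcomp
  rw [modelWithCornersSelf_coe, range_id, mfderivWithin_univ] at hT
  rw [hcomp, ← hT]
  rfl

end Charts

/-! ### Smoothness of implicitly defined fields -/

/-- A continuous solution of a `C^k` equation whose linearization is injective is `C^k`. -/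
lemma contDiffAt_of_implicit {X V K : Type*} [NormedAddCommGroup X] [NormedSpace ℝ X]
    [CompleteSpace X] [NormedAddCommGroup V] [NormedSpace ℝ V] [FiniteDimensional ℝ V]
    [NormedAddCommGroup K] [NormedSpace ℝ K] [FiniteDimensional ℝ K] {k : ℕ∞ω} (hk : k ≠ 0)
    {Φ : X × V → K} {Z : X → V} {x : X} (hΦ : ContDiffAt ℝ k Φ (x, Z x))
    (hZ : ContinuousAt Z x) (h0 : ∀ᶠ y in 𝓝 x, Φ (y, Z y) = 0)
    (hinj : ∀ v, fderiv ℝ Φ (x, Z x) (0, v) = 0 → v = 0) : ContDiffAt ℝ k Z x := by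
  have := FiniteDimensional.complete ℝ V
  set L : V →L[ℝ] K := fderiv ℝ Φ (x, Z x) ∘L ContinuousLinearMap.inr ℝ X V with hL
  have hker : LinearMap.ker (L : V →ₗ[ℝ] K) = ⊥ := by
    rw [LinearMap.ker_eq_bot']
    intro v hv
    exact hinj v hv
  -- The system may be overdetermined. Composing with a left inverse of the partial derivative
  -- yields a square system whose linearization is the identity.
  obtain ⟨Γ, hΓ⟩ := (L : V →ₗ[ℝ] K).exists_leftInverse_of_injective hker
  set Γ' : K →L[ℝ] V := LinearMap.toContinuousLinearMap Γ
  have hΨ : ContDiffAt ℝ k (fun q => Γ' (Φ q)) (x, Z x) := Γ'.contDiff.contDiffAt.comp _ hΦ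
  have hfd : fderiv ℝ (fun q => Γ' (Φ q)) (x, Z x) = Γ' ∘L fderiv ℝ Φ (x, Z x) :=
    (Γ'.hasFDerivAt.comp _ (hΦ.differentiableAt hk).hasFDerivAt).fderiv
  have hinv : (fderiv ℝ (fun q => Γ' (Φ q)) (x, Z x) ∘L
      ContinuousLinearMap.inr ℝ X V).IsInvertible := by
    refine ⟨ContinuousLinearEquiv.refl ℝ V, ?_⟩
    rw [hfd]
    ext v
    exact (LinearMap.congr_fun hΓ v).symm
  have hx0 : Φ (x, Z x) = 0 := h0.self_of_nhds
  have hev := hΨ.eventually_apply_eq_iff_implicitFunction hk hinv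
  have hcont : Filter.Tendsto (fun y => (y, Z y)) (𝓝 x) (𝓝 (x, Z x)) :=
    Filter.Tendsto.prodMk_nhds Filter.tendsto_id hZ
  -- Continuity of Z keeps (y, Z y) in the region where the implicit function is the only solution,
  -- so the two agree near x.
  refine (hΨ.contDiffAt_implicitFunction hk hinv).congr_of_eventuallyEq ?_
  filter_upwards [hcont.eventually hev, h0] with y hy hy0
  exact (hy.1 (by rw [hy0, hx0])).symm

/-- A continuous field of unit vectors with prescribed `C^k` scalar products with a `C^k` frame
is `C^k`. -/
lemma contDiffAt_unit_field {c : SignType} {n : ℕ} {X : Type*} [NormedAddCommGroup X]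
    [NormedSpace ℝ X] [CompleteSpace X] {k : ℕ∞ω} (hk : k ≠ 0)
    {a : X → EuclideanSpace ℝ (Fin n) →L[ℝ] Amb c n} {β : X → EuclideanSpace ℝ (Fin n) →L[ℝ] ℝ}
    {p Z : X → Amb c n} {x : X} (ha : ContDiffAt ℝ k a x) (hβ : ContDiffAt ℝ k β x)
    (hp : ContDiffAt ℝ k p x) (hZ : ContinuousAt Z x)
    (h1 : ∀ᶠ y in 𝓝 x, ∀ v, form c n (a y v) (Z y) = β y v)
    (h2 : ∀ᶠ y in 𝓝 x, (c : ℝ) * form c n (p y) (Z y) = 0)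
    (h3 : ∀ᶠ y in 𝓝 x, form c n (Z y) (Z y) = 1)
    (hinj : ∀ W, (∀ v, form c n (a x v) W = 0) → (c : ℝ) * form c n (p x) W = 0 →
      form c n (Z x) W = 0 → W = 0) : ContDiffAt ℝ k Z x := by
  set Φ : X × Amb c n → (EuclideanSpace ℝ (Fin n) →L[ℝ] ℝ) × ℝ × ℝ := fun q =>
    (((formL c n).flip q.2).comp (a q.1) - β q.1, (c : ℝ) * formL c n (p q.1) q.2,
      formL c n q.2 q.2 - 1) with hΦdef
  -- Only the derivative in the vector variable Y enters the injectivity condition, so it is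
  -- computed with the frame, the functional and the point frozen.
  have hpart : ∀ (A : EuclideanSpace ℝ (Fin n) →L[ℝ] Amb c n) (b : EuclideanSpace ℝ (Fin n) →L[ℝ] ℝ)
      (P Y : Amb c n), HasFDerivAt (fun Y : Amb c n =>
        ((((formL c n).flip Y).comp A - b, (c : ℝ) * formL c n P Y, formL c n Y Y - 1) :
          (EuclideanSpace ℝ (Fin n) →L[ℝ] ℝ) × ℝ × ℝ))
      (((((ContinuousLinearMap.compL ℝ (EuclideanSpace ℝ (Fin n)) (Amb c n) ℝ).flip A).comp
        (formL c n).flip)).prod (((c : ℝ) • formL c n P).prod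
          (formL c n Y + (formL c n).flip Y))) Y := by
    intro A b P Y
    refine HasFDerivAt.prodMk ?_ (HasFDerivAt.prodMk ?_ ?_)
    · exact (((ContinuousLinearMap.compL ℝ (EuclideanSpace ℝ (Fin n)) (Amb c n) ℝ).flip A).comp
        (formL c n).flip).hasFDerivAt.sub_const b
    · exact ((c : ℝ) • formL c n P).hasFDerivAt
    · refine HasFDerivAt.sub_const (1 : ℝ) ?_
      exact ((formL c n).hasFDerivAt_of_bilinear (hasFDerivAt_id Y) (hasFDerivAt_id Y)).congr_fderiv
        (by ext W; simp [formL_apply])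
  have hΦ : ContDiffAt ℝ k Φ (x, Z x) := by
    have e1 : ContDiffAt ℝ k (fun q : X × Amb c n => a q.1) (x, Z x) :=
      ContDiffAt.comp (x, Z x) (g := a) ha contDiffAt_fst
    have e2 : ContDiffAt ℝ k (fun q : X × Amb c n => β q.1) (x, Z x) :=
      ContDiffAt.comp (x, Z x) (g := β) hβ contDiffAt_fst
    have e3 : ContDiffAt ℝ k (fun q : X × Amb c n => p q.1) (x, Z x) :=
      ContDiffAt.comp (x, Z x) (g := p) hp contDiffAt_fst
    have e4 : ContDiffAt ℝ k (fun q : X × Amb c n => q.2) (x, Z x) := contDiffAt_snd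
    have e5 : ContDiffAt ℝ k (fun q : X × Amb c n => (formL c n).flip q.2) (x, Z x) :=
      (formL c n).flip.contDiff.contDiffAt.comp _ e4
    have e6 : ContDiffAt ℝ k (fun q : X × Amb c n => formL c n (p q.1)) (x, Z x) :=
      (formL c n).contDiff.contDiffAt.comp _ e3
    have e7 : ContDiffAt ℝ k (fun q : X × Amb c n => formL c n q.2) (x, Z x) :=
      (formL c n).contDiff.contDiffAt.comp _ e4
    exact ((e5.clm_comp e1).sub e2).prodMk
      ((contDiffAt_const.mul (e6.clm_apply e4)).prodMk ((e7.clm_apply e4).sub contDiffAt_const))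
  refine contDiffAt_of_implicit hk hΦ hZ ?_ ?_
  · filter_upwards [h1, h2, h3] with y g1 g2 g3
    simp only [hΦdef, Prod.mk_eq_zero, formL_apply]
    refine ⟨?_, g2, by rw [g3, sub_self]⟩
    ext v
    simp [formL_apply, g1 v]
  · intro W hW
    have hc : HasFDerivAt (fun Y => Φ (x, Y)) (fderiv ℝ Φ (x, Z x) ∘L
        ContinuousLinearMap.inr ℝ X (Amb c n)) (Z x) :=
      (hΦ.differentiableAt hk).hasFDerivAt.comp (Z x) (hasFDerivAt_prodMk_right x (Z x))
    have heq := hc.unique (hpart (a x) (β x) (p x) (Z x))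
    have hW' := DFunLike.congr_fun heq W
    change fderiv ℝ Φ (x, Z x) (0, W) = _ at hW'
    rw [hW] at hW'
    have q1 := congrArg Prod.fst hW'
    have q2 := congrArg (fun q => q.2.1) hW'
    have q3 := congrArg (fun q => q.2.2) hW'
    refine hinj W (fun v => ?_) ?_ ?_
    · exact (DFunLike.congr_fun q1 v).symm
    · exact q2.symm
    · have : 0 = form c n (Z x) W + form c n W (Z x) := q3
      rw [form_comm c n W] at this
      linarith

section Manifold

variable {n : ℕ} {M : Type*} [TopologicalSpace M] [ChartedSpace (EuclideanSpace ℝ (Fin n)) M]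
  [IsManifold (𝓡 n) ∞ M] {c : SignType}

/-- A continuous field of unit vectors `Z` along `g`, tangent to the space form and with
`⟨dg, Z⟩ = h dτ`, is as smooth as `dg`, `h` and `dτ`. -/
lemma contMDiffAt_unit_field {k m : ℕ∞ω} (hk : k ≠ 0) (hkm : k + 1 ≤ m) {g Z : M → Amb c n}
    {h τ : M → ℝ} {x : M} (hg : ∀ᶠ y in 𝓝 x, ContMDiffAt (𝓡 n) 𝓘(ℝ, Amb c n) m g y)
    (hτ : ∀ᶠ y in 𝓝 x, ContMDiffAt (𝓡 n) 𝓘(ℝ, ℝ) m τ y)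
    (hh : ContMDiffAt (𝓡 n) 𝓘(ℝ, ℝ) k h x) (hZ : ContinuousAt Z x)
    (h1 : ∀ᶠ y in 𝓝 x, ∀ v : EuclideanSpace ℝ (Fin n), form c n (dmap g y v) (Z y) = h y * dmap τ y v)
    (h2 : ∀ᶠ y in 𝓝 x, (c : ℝ) * form c n (g y) (Z y) = 0)
    (h3 : ∀ᶠ y in 𝓝 x, form c n (Z y) (Z y) = 1)
    (hinj : ∀ W, (∀ v : EuclideanSpace ℝ (Fin n), form c n (dmap g x v) W = 0) → (c : ℝ) * form c n (g x) W = 0 →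
      form c n (Z x) W = 0 → W = 0) : ContMDiffAt (𝓡 n) 𝓘(ℝ, Amb c n) k Z x := by
  have hm : m ≠ 0 := by
    rintro rfl
    simp at hkm
  have hkm' : k ≤ m := le_trans le_self_add hkm
  refine contMDiffAt_of_chart hZ ?_
  have hgx := contDiffAt_chart hg.self_of_nhds
  have hτx := contDiffAt_chart hτ.self_of_nhds
  refine contDiffAt_unit_field hk
    (a := fun z => fderiv ℝ (g ∘ (extChartAt (𝓡 n) x).symm) z)
    (β := fun z => (h ∘ (extChartAt (𝓡 n) x).symm) z •
      fderiv ℝ (τ ∘ (extChartAt (𝓡 n) x).symm) z) (p := g ∘ (extChartAt (𝓡 n) x).symm)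
    (hgx.fderiv_right hkm) ((contDiffAt_chart hh).smul (hτx.fderiv_right hkm))
    (hgx.of_le hkm') ?_ ?_ (eventually_chart.2 h2) (eventually_chart.2 h3) ?_
  · exact ContinuousAt.comp (by simpa using hZ) (continuousAt_extChartAt_symm x)
  · filter_upwards [eventually_fderiv_chart_eq x, eventually_chart.2 h1, eventually_chart.2 hg,
      eventually_chart.2 hτ] with z ⟨T, hT⟩ hz hgz hτz v
    rw [hT _ g (hgz.mdifferentiableAt hm), hT _ τ (hτz.mdifferentiableAt hm)]
    exact hz (T v)
  · rw [← dmap_eq_fderiv (hg.self_of_nhds.mdifferentiableAt hm)]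
    simpa using hinj

end Manifold

section Manifold

variable {n : ℕ} {M : Type*} [TopologicalSpace M] [ChartedSpace (EuclideanSpace ℝ (Fin n)) M]
  {c : SignType}

/-! ### Derivatives of products -/

lemma differentiableAt_chart {F : Type*} [NormedAddCommGroup F] [NormedSpace ℝ F] {f : M → F}
    {x : M} (hf : MDifferentiableAt (𝓡 n) 𝓘(ℝ, F) f x) :
    DifferentiableAt ℝ (f ∘ (extChartAt (𝓡 n) x).symm) (extChartAt (𝓡 n) x x) := by
  have := (mdifferentiableAt_iff _ _).1 hf
  simpa only [writtenInExtChartAt, extChartAt_model_space_eq_id, PartialEquiv.refl_coe,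
    Function.id_comp, modelWithCornersSelf_coe, range_id, differentiableWithinAt_univ] using this.2

lemma hasFDerivAt_chart {F : Type*} [NormedAddCommGroup F] [NormedSpace ℝ F] {f : M → F}
    {x : M} (hf : MDifferentiableAt (𝓡 n) 𝓘(ℝ, F) f x) :
    HasFDerivAt (f ∘ (extChartAt (𝓡 n) x).symm) (dmap f x) (extChartAt (𝓡 n) x x) := by
  rw [dmap_eq_fderiv hf]
  exact (differentiableAt_chart hf).hasFDerivAt

lemma mdifferentiableAt_of_chart {F : Type*} [NormedAddCommGroup F] [NormedSpace ℝ F] {f : M → F}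
    {x : M} (hc : ContinuousAt f x) (hf : DifferentiableAt ℝ (f ∘ (extChartAt (𝓡 n) x).symm)
      (extChartAt (𝓡 n) x x)) : MDifferentiableAt (𝓡 n) 𝓘(ℝ, F) f x := by
  refine (mdifferentiableAt_iff _ _).2 ⟨hc, ?_⟩
  simpa only [writtenInExtChartAt, extChartAt_model_space_eq_id, PartialEquiv.refl_coe,
    Function.id_comp, modelWithCornersSelf_coe, range_id, differentiableWithinAt_univ] using hf

lemma dmap_eq_of_hasFDerivAt {F : Type*} [NormedAddCommGroup F] [NormedSpace ℝ F] {f : M → F}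
    {x : M} {L : EuclideanSpace ℝ (Fin n) →L[ℝ] F} (hc : ContinuousAt f x)
    (hf : HasFDerivAt (f ∘ (extChartAt (𝓡 n) x).symm) L (extChartAt (𝓡 n) x x)) : dmap f x = L := by
  rw [dmap_eq_fderiv (mdifferentiableAt_of_chart hc hf.differentiableAt), hf.fderiv]

lemma mdifferentiableAt_clm {F G : Type*} [NormedAddCommGroup F] [NormedSpace ℝ F]
    [NormedAddCommGroup G] [NormedSpace ℝ G] (L : F →L[ℝ] G) {f : M → F} {x : M}
    (hf : MDifferentiableAt (𝓡 n) 𝓘(ℝ, F) f x) :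
    MDifferentiableAt (𝓡 n) 𝓘(ℝ, G) (fun y => L (f y)) x :=
  mdifferentiableAt_of_chart (L.continuous.continuousAt.comp hf.continuousAt)
    (L.differentiableAt.comp _ (differentiableAt_chart hf))

lemma dmap_clm {F G : Type*} [NormedAddCommGroup F] [NormedSpace ℝ F]
    [NormedAddCommGroup G] [NormedSpace ℝ G] (L : F →L[ℝ] G) {f : M → F} {x : M}
    (hf : MDifferentiableAt (𝓡 n) 𝓘(ℝ, F) f x) (v : EuclideanSpace ℝ (Fin n)) :
    dmap (fun y => L (f y)) x v = L (dmap f x v) := by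
  rw [dmap_eq_of_hasFDerivAt (mdifferentiableAt_clm L hf).continuousAt
    (L.hasFDerivAt.comp _ (hasFDerivAt_chart hf))]
  rfl

lemma dmap_fst {f : M → Amb c n × ℝ} {x : M} (hf : MDifferentiableAt (𝓡 n) 𝓘(ℝ, Amb c n × ℝ) f x)
    (v : EuclideanSpace ℝ (Fin n)) : dmap (fun y => (f y).1) x v = (dmap f x v).1 :=
  dmap_clm (ContinuousLinearMap.fst ℝ (Amb c n) ℝ) hf v

lemma dmap_snd {f : M → Amb c n × ℝ} {x : M} (hf : MDifferentiableAt (𝓡 n) 𝓘(ℝ, Amb c n × ℝ) f x)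
    (v : EuclideanSpace ℝ (Fin n)) : dmap (fun y => (f y).2) x v = (dmap f x v).2 :=
  dmap_clm (ContinuousLinearMap.snd ℝ (Amb c n) ℝ) hf v

/-- The product rule for a constant pairing. The scalar s is c for tangency relations and 1 for
unit-length relations. -/
lemma form_dmap {g h : M → Amb c n} {x : M} {s K : ℝ}
    (hg : MDifferentiableAt (𝓡 n) 𝓘(ℝ, Amb c n) g x)
    (hh : MDifferentiableAt (𝓡 n) 𝓘(ℝ, Amb c n) h x)
    (hgh : ∀ᶠ y in 𝓝 x, s * form c n (g y) (h y) = K) (v : EuclideanSpace ℝ (Fin n)) :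
    s * (form c n (dmap g x v) (h x) + form c n (g x) (dmap h x v)) = 0 := by
  have h1 := ((formL c n).hasFDerivAt_of_bilinear (hasFDerivAt_chart hg)
    (hasFDerivAt_chart hh)).const_mul s
  have h2 := h1.congr_of_eventuallyEq (f₁ := fun _ => K) (by
    filter_upwards [eventually_chart.2 hgh] with z hz
    exact hz.symm)
  have h3 := DFunLike.congr_fun (h2.unique (hasFDerivAt_const K _)) v
  simp only [Function.comp_apply, extChartAt_to_inv] at h3
  have h4 : s * (form c n (g x) (dmap h x v) + form c n (dmap g x v) (h x)) = 0 := h3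
  linarith

lemma tangent_dmap {g : M → Amb c n} {x : M} (hg : MDifferentiableAt (𝓡 n) 𝓘(ℝ, Amb c n) g x)
    (hmem : ∀ᶠ y in 𝓝 x, g y ∈ spaceForm c n) (v : EuclideanSpace ℝ (Fin n)) :
    (c : ℝ) * form c n (g x) (dmap g x v) = 0 := by
  have h := form_dmap hg hg (hmem.mono fun y hy => sign_mul_form_self hy) v
  rw [form_comm c n (dmap g x v)] at h
  linarith

/-! ### The warped metric -/

section Warped
variable {w : ℝ → ℝ} (p u v z : Amb c n × ℝ) (a : ℝ)

lemma warpedMetric_comm : warpedMetric c n w p u v = warpedMetric c n w p v u := by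
  simp only [warpedMetric, form_comm c n u.1, mul_comm u.2]
lemma warpedMetric_add_right :
    warpedMetric c n w p u (v + z) = warpedMetric c n w p u v + warpedMetric c n w p u z := by
  simp only [warpedMetric, Prod.fst_add, Prod.snd_add, form_add_right]; ring
lemma warpedMetric_sub_right :
    warpedMetric c n w p u (v - z) = warpedMetric c n w p u v - warpedMetric c n w p u z := by
  simp only [warpedMetric, Prod.fst_sub, Prod.snd_sub, form_sub_right]; ring
lemma warpedMetric_smul_right :
    warpedMetric c n w p u (a • v) = a * warpedMetric c n w p u v := by
  simp only [warpedMetric, Prod.smul_fst, Prod.smul_snd, form_smul_right, smul_eq_mul]; ring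
lemma warpedMetric_add_left :
    warpedMetric c n w p (u + v) z = warpedMetric c n w p u z + warpedMetric c n w p v z := by
  simp only [warpedMetric, Prod.fst_add, Prod.snd_add, form_add_left]; ring
lemma warpedMetric_sub_left :
    warpedMetric c n w p (u - v) z = warpedMetric c n w p u z - warpedMetric c n w p v z := by
  simp only [warpedMetric, Prod.fst_sub, Prod.snd_sub, form_sub_left]; ring
lemma warpedMetric_smul_left :
    warpedMetric c n w p (a • u) v = a * warpedMetric c n w p u v := by
  simp only [warpedMetric, Prod.smul_fst, Prod.smul_snd, form_smul_left, smul_eq_mul]; ring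

variable {p} in
-- The flat form is constant in linear coordinates, so the metric depends on the position only
-- through w(t)².
lemma christoffel_warpedMetric (hw : DifferentiableAt ℝ w p.2) :
    christoffel (warpedMetric c n w) p u v z = w p.2 * deriv w p.2 *
      (u.2 * form c n v.1 z.1 + v.2 * form c n u.1 z.1 - z.2 * form c n u.1 v.1) := by
  have key : ∀ a b d : Amb c n × ℝ, fderiv ℝ (fun q => warpedMetric c n w q a b) p d =
      2 * w p.2 * deriv w p.2 * d.2 * form c n a.1 b.1 := by
    intro a b d
    have h1 : HasFDerivAt (fun q : Amb c n × ℝ => w q.2)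
        (deriv w p.2 • ContinuousLinearMap.snd ℝ (Amb c n) ℝ) p :=
      hw.hasDerivAt.comp_hasFDerivAt p hasFDerivAt_snd
    have h2 : HasFDerivAt (fun q => warpedMetric c n w q a b) _ p :=
      ((h1.pow 2).mul_const (form c n a.1 b.1)).sub_const (a.2 * b.2)
    rw [h2.fderiv]
    simp
    ring
  rw [christoffel, key, key, key]
  ring

end Warped

/-! ### The screen map -/

/-- The part of the differential of `f` orthogonal to the unit vector `z`, for a null normal vector
`(z, w)`. -/
def screenMap (w : ℝ → ℝ) (f : M → Amb c n × ℝ) (x : M) (z : Amb c n) :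
    EuclideanSpace ℝ (Fin n) →L[ℝ] Amb c n :=
  (ContinuousLinearMap.fst ℝ (Amb c n) ℝ).comp (dmap f x) -
    (w (f x).2)⁻¹ • ((ContinuousLinearMap.snd ℝ (Amb c n) ℝ).comp (dmap f x)).smulRight z

lemma screenMap_apply (w : ℝ → ℝ) (f : M → Amb c n × ℝ) (x : M) (z : Amb c n)
    (v : EuclideanSpace ℝ (Fin n)) :
    screenMap w f x z v = (dmap f x v).1 - ((w (f x).2)⁻¹ * (dmap f x v).2) • z := by
  simp [screenMap, smul_smul]

/-- Normality of (z, w) means w⟨df₁ v, z⟩ = dτ(v), so the screen map removes exactly the z-component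
of df₁. A vector v in its kernel would have df(v) proportional to the null vector (z, w), against
spacelikeness. -/
lemma adaptedFrame_screenMap {w : ℝ → ℝ} {f : M → Amb c n × ℝ} {x : M} {z : Amb c n}
    (hmem : (f x).1 ∈ spaceForm c n)
    (htan : ∀ v : EuclideanSpace ℝ (Fin n), (c : ℝ) * form c n (f x).1 (dmap f x v).1 = 0)
    (hw : 0 < w (f x).2)
    (hpos : ∀ v : EuclideanSpace ℝ (Fin n), v ≠ 0 →
      0 < warpedMetric c n w (f x) (dmap f x v) (dmap f x v))
    (hN : IsNormalAt w f x (z, w (f x).2)) (hz : form c n z z = 1) :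
    AdaptedFrame (f x).1 (screenMap w f x z) z := by
  have hn : ∀ v : EuclideanSpace ℝ (Fin n),
      form c n (dmap f x v).1 z = (w (f x).2)⁻¹ * (dmap f x v).2 := by
    intro v
    have h := hN.2 v
    simp only [warpedMetric] at h
    field_simp
    have h3 : w (f x).2 * (w (f x).2 * form c n (dmap f x v).1 z - (dmap f x v).2) = 0 := by
      linear_combination h
    linarith [(mul_eq_zero.1 h3).resolve_left hw.ne']
  refine ⟨hmem, ?_, fun v => ?_, fun v => ?_, hN.1, hz⟩
  · rw [injective_iff_map_eq_zero]
    intro v hv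
    by_contra hne
    have h := hpos v hne
    rw [screenMap_apply, sub_eq_zero] at hv
    simp only [warpedMetric, hv, form_smul_left, form_smul_right, hz] at h
    have h4 : w (f x).2 * (w (f x).2)⁻¹ = 1 := mul_inv_cancel₀ hw.ne'
    have : w (f x).2 ^ 2 * ((w (f x).2)⁻¹ * (dmap f x v).2 * ((w (f x).2)⁻¹ * (dmap f x v).2 * 1)) -
        (dmap f x v).2 * (dmap f x v).2 = 0 := by
      linear_combination (dmap f x v).2 ^ 2 * (w (f x).2 * (w (f x).2)⁻¹ + 1) * h4
    linarith
  · rw [screenMap_apply, form_sub_right, form_smul_right]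
    linear_combination htan v - (w (f x).2)⁻¹ * (dmap f x v).2 * hN.1
  · rw [screenMap_apply, form_sub_left, form_smul_left, hz, hn]; ring

section Frame

variable {w : ℝ → ℝ} {f : M → Amb c n × ℝ} {x : M} {z : Amb c n}

lemma form_fst_of_frame (h : AdaptedFrame (f x).1 (screenMap w f x z) z)
    (v : EuclideanSpace ℝ (Fin n)) :
    form c n (dmap f x v).1 z = (w (f x).2)⁻¹ * (dmap f x v).2 := by
  have := h.normal v
  rw [screenMap_apply, form_sub_left, form_smul_left, h.unit] at this
  linarith

lemma tangent_of_frame (h : AdaptedFrame (f x).1 (screenMap w f x z) z)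
    (v : EuclideanSpace ℝ (Fin n)) : (c : ℝ) * form c n (f x).1 (dmap f x v).1 = 0 := by
  have := h.tangent v
  rw [screenMap_apply, form_sub_right, form_smul_right] at this
  linear_combination this + (w (f x).2)⁻¹ * (dmap f x v).2 * h.tangent_unit

lemma isNormalAt_of_frame (h : AdaptedFrame (f x).1 (screenMap w f x z) z) :
    IsNormalAt w f x (z, w (f x).2) := by
  refine ⟨h.tangent_unit, fun v => ?_⟩
  simp only [warpedMetric, form_fst_of_frame h]
  field_simp
  ring

lemma warpedMetric_null (t : ℝ) (p : Amb c n × ℝ) (hz : form c n z z = 1) (hp : w p.2 = t) :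
    warpedMetric c n w p (z, t) (z, t) = 0 := by
  simp only [warpedMetric, hz, hp]; ring

/-- One has df(v) = (Y v, 0) + w⁻¹ dτ(v) (z, w), where (z, w) is null and orthogonal to (Y v, 0);
only the screen part contributes to the induced metric. -/
lemma warpedMetric_dmap (hw : 0 < w (f x).2) (h : AdaptedFrame (f x).1 (screenMap w f x z) z)
    (u v : EuclideanSpace ℝ (Fin n)) : warpedMetric c n w (f x) (dmap f x u) (dmap f x v) =
      w (f x).2 ^ 2 * form c n (screenMap w f x z u) (screenMap w f x z v) := by
  have h1 := form_fst_of_frame h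
  have h2 : ∀ v : EuclideanSpace ℝ (Fin n),
      form c n z (dmap f x v).1 = (w (f x).2)⁻¹ * (dmap f x v).2 :=
    fun v => by rw [form_comm]; exact h1 v
  simp only [warpedMetric, screenMap_apply, form_sub_left, form_sub_right, form_smul_left,
    form_smul_right, h1, h2, h.unit]
  field_simp
  ring

lemma warpedMetric_dmap_pos (hw : 0 < w (f x).2)
    (h : AdaptedFrame (f x).1 (screenMap w f x z) z) {v : EuclideanSpace ℝ (Fin n)} (hv : v ≠ 0) :
    0 < warpedMetric c n w (f x) (dmap f x v) (dmap f x v) := by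
  rw [warpedMetric_dmap hw h]
  exact mul_pos (pow_pos hw 2) (h.pos hv)

/-- A normal vector orthogonal to a null normal vector is a multiple of it. -/
lemma eq_smul_null (hw : 0 < w (f x).2) (h : AdaptedFrame (f x).1 (screenMap w f x z) z)
    {H : Amb c n × ℝ} (hH : IsNormalAt w f x H)
    (hHz : warpedMetric c n w (f x) H (z, w (f x).2) = 0) :
    H = (H.2 * (w (f x).2)⁻¹) • (z, w (f x).2) := by
  have hne := hw.ne'
  set b := H.2 * (w (f x).2)⁻¹ with hb
  have hbw : b * w (f x).2 = H.2 := by rw [hb]; field_simp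
  -- H - b(z, w) has zero time component. Its space component is tangent to the space form and
  -- orthogonal to z and to the screen, and the frame leaves no room for such a vector.
  have h1 : H.1 - b • z = 0 := by
    have hz : form c n (H.1 - b • z) z = 0 := by
      rw [form_sub_left, form_smul_left, h.unit]
      simp only [warpedMetric] at hHz
      have : w (f x).2 ^ 2 * (form c n H.1 z - b * 1) = 0 := by
        linear_combination hHz - w (f x).2 * hbw
      exact (mul_eq_zero.1 this).resolve_left (pow_ne_zero 2 hne)
    refine h.eq_zero ?_ hz fun v => ?_
    · rw [form_sub_right, form_smul_right]
      linear_combination hH.1 - b * h.tangent_unit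
    · rw [screenMap_apply, form_sub_left, form_smul_left, form_comm c n z, hz, form_sub_right,
        form_smul_right, form_fst_of_frame h]
      have h2 := hH.2 v
      simp only [warpedMetric] at h2
      have h4 : w (f x).2 * (w (f x).2)⁻¹ = 1 := mul_inv_cancel₀ hne
      have : w (f x).2 ^ 2 * (form c n (dmap f x v).1 H.1 -
          b * ((w (f x).2)⁻¹ * (dmap f x v).2)) = 0 := by
        linear_combination h2 - (dmap f x v).2 * w (f x).2 * b * h4 - (dmap f x v).2 * hbw
      have := (mul_eq_zero.1 this).resolve_left (pow_ne_zero 2 hne)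
      linarith
  refine Prod.ext ?_ ?_
  · exact sub_eq_zero.1 h1
  · exact hbw.symm

end Frame

/-! ### The mean curvature vector -/

/-- A functional is represented on the normal space of a spacelike immersion by a normal vector. -/
lemma exists_normal_represents {w : ℝ → ℝ} {f : M → Amb c n × ℝ} {x : M}
    (hmem : (f x).1 ∈ spaceForm c n) (hw : 0 < w (f x).2)
    (htan : ∀ v : EuclideanSpace ℝ (Fin n), (c : ℝ) * form c n (f x).1 (dmap f x v).1 = 0)
    (hpos : ∀ v : EuclideanSpace ℝ (Fin n), v ≠ 0 →
      0 < warpedMetric c n w (f x) (dmap f x v) (dmap f x v))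
    (ℓ : Amb c n × ℝ →ₗ[ℝ] ℝ) :
    ∃ H, IsNormalAt w f x H ∧ ∀ Z, IsNormalAt w f x Z → warpedMetric c n w (f x) H Z = ℓ Z := by
  let G : (Amb c n × ℝ) →ₗ[ℝ] (Amb c n × ℝ) →ₗ[ℝ] ℝ := LinearMap.mk₂ ℝ (warpedMetric c n w (f x))
    (fun u v z => warpedMetric_add_left _ _ _ _) (fun a u v => warpedMetric_smul_left _ _ _ _)
    (fun u v z => warpedMetric_add_right _ _ _ _) (fun a u v => warpedMetric_smul_right _ _ _ _)
  have hG : ∀ u v, G u v = warpedMetric c n w (f x) u v := fun u v => rfl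
  let 𝒩 : Submodule ℝ (Amb c n × ℝ) :=
    { carrier := {Z | IsNormalAt w f x Z}
      add_mem' := fun {Y Z} hY hZ => ⟨by
          rw [Prod.fst_add, form_add_right]; linear_combination hY.1 + hZ.1, fun v => by
          rw [warpedMetric_add_right, hY.2, hZ.2, add_zero]⟩
      zero_mem' := ⟨by simp [form_zero_right], fun v => by simp [warpedMetric, form_zero_right]⟩
      smul_mem' := fun a Z hZ => ⟨by
          rw [Prod.smul_fst, form_smul_right]; linear_combination a * hZ.1, fun v => by
          rw [warpedMetric_smul_right, hZ.2, mul_zero]⟩ }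
  have h𝒩 : ∀ Z, Z ∈ 𝒩 ↔ IsNormalAt w f x Z := fun Z => Iff.rfl
  have hnd : ∀ Z ∈ 𝒩, (∀ Z' ∈ 𝒩, G Z Z' = 0) → Z = 0 := by
    intro Z hZ h0
    let g : EuclideanSpace ℝ (Fin n) →L[ℝ] EuclideanSpace ℝ (Fin n) →L[ℝ] ℝ :=
      G.toContinuousBilinearMap.bilinearComp (dmap f x) (dmap f x)
    obtain ⟨g', hg'⟩ := isInvertible_of_pos (g := g) hpos
    -- Reversing time turns ⟨Z, Y⟩ into the positive definite expression w²⟨Z₁, Z₁⟩ + Z₂². Removing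
    -- the tangential part df(v) of Y makes it a legitimate normal test vector without changing the
    -- pairing with Z.
    set Y : Amb c n × ℝ := (Z.1, -Z.2) with hYdef
    set v := g'.symm ((G.toContinuousBilinearMap Y).comp (dmap f x)) with hv
    have hgv : ∀ u : EuclideanSpace ℝ (Fin n), G (dmap f x v) (dmap f x u) = G Y (dmap f x u) := by
      intro u
      have h1 : g v = (G.toContinuousBilinearMap Y).comp (dmap f x) := by
        rw [← hg', hv]; simp
      exact DFunLike.congr_fun h1 u
    have hYn : Y - dmap f x v ∈ 𝒩 := by
      refine ⟨?_, fun u => ?_⟩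
      · rw [Prod.fst_sub, form_sub_right]
        linear_combination hZ.1 - htan v
      · rw [warpedMetric_comm, warpedMetric_sub_left, ← hG, ← hG, hgv, sub_self]
    have h2 := h0 _ hYn
    rw [map_sub, hG, hG, warpedMetric_comm _ Z (dmap f x v), hZ.2 v, sub_zero] at h2
    simp only [warpedMetric, hYdef] at h2
    have h3 := form_self_nonneg hmem hZ.1
    have h5 : Z.1 = 0 := by
      by_contra hne
      have := mul_pos (pow_pos hw 2) (form_self_pos hmem hZ.1 hne)
      nlinarith [mul_self_nonneg Z.2]
    rw [h5, form_zero_left] at h2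
    exact Prod.ext h5 (mul_self_eq_zero.1 (by linarith))
  let B : 𝒩 →ₗ[ℝ] Module.Dual ℝ 𝒩 := G.domRestrict₁₂ 𝒩 𝒩
  have hB : Function.Injective B := by
    rw [← LinearMap.ker_eq_bot, LinearMap.ker_eq_bot']
    intro Z hZ
    refine Subtype.ext (hnd Z Z.2 fun Z' hZ' => ?_)
    exact LinearMap.congr_fun hZ ⟨Z', hZ'⟩
  obtain ⟨H, hH⟩ := (LinearMap.injective_iff_surjective_of_finrank_eq_finrank
    (Subspace.dual_finrank_eq (K := ℝ) (V := 𝒩)).symm).1 hB (ℓ.domRestrict 𝒩)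
  exact ⟨H, H.2, fun Z hZ => LinearMap.congr_fun hH ⟨Z, hZ⟩⟩

/-- The trace of ⟨h, Z⟩ is linear in Z, so `exists_normal_represents` supplies the vector that
justifies the choice operator in the definition. -/
lemma meanCurvatureVector_spec {w : ℝ → ℝ} {f : M → Amb c n × ℝ} {x : M}
    (hmem : (f x).1 ∈ spaceForm c n) (hw : 0 < w (f x).2) (hwd : DifferentiableAt ℝ w (f x).2)
    (htan : ∀ v : EuclideanSpace ℝ (Fin n), (c : ℝ) * form c n (f x).1 (dmap f x v).1 = 0)
    (hpos : ∀ v : EuclideanSpace ℝ (Fin n), v ≠ 0 →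
      0 < warpedMetric c n w (f x) (dmap f x v) (dmap f x v)) :
    IsNormalAt w f x (meanCurvatureVector w f x) ∧ ∀ Z, IsNormalAt w f x Z →
      warpedMetric c n w (f x) (meanCurvatureVector w f x) Z =
        1 / (n : ℝ) * ∑ i, ∑ j, (gram w f x)⁻¹ i j *
          secondForm w f x Z (EuclideanSpace.single i 1) (EuclideanSpace.single j 1) := by
  have hsec : ∀ u v : EuclideanSpace ℝ (Fin n),
      IsLinearMap ℝ (fun Z => secondForm w f x Z u v) := by
    intro u v
    constructor
    · intro Y Z
      simp only [secondForm, christoffel_warpedMetric _ _ _ hwd, warpedMetric_add_right,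
        Prod.fst_add, Prod.snd_add, form_add_right]
      ring
    · intro a Z
      simp only [secondForm, christoffel_warpedMetric _ _ _ hwd, warpedMetric_smul_right,
        Prod.smul_fst, Prod.smul_snd, form_smul_right, smul_eq_mul]
      ring
  have := exists_normal_represents hmem hw htan hpos ((1 / (n : ℝ)) • ∑ i, ∑ j,
    (gram w f x)⁻¹ i j • (hsec (EuclideanSpace.single i 1) (EuclideanSpace.single j 1)).mk')
  refine Classical.epsilon_spec (p := fun H => IsNormalAt w f x H ∧ ∀ Z, IsNormalAt w f x Z →
    warpedMetric c n w (f x) H Z = 1 / (n : ℝ) * ∑ i, ∑ j, (gram w f x)⁻¹ i j *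
      secondForm w f x Z (EuclideanSpace.single i 1) (EuclideanSpace.single j 1)) ?_
  obtain ⟨H, h1, h2⟩ := this
  refine ⟨H, h1, fun Z hZ => ?_⟩
  rw [h2 Z hZ]
  simp

end Manifold

/-! ### The Weingarten operator of a null normal field and its trace -/

section Manifold

variable {n : ℕ} {M : Type*} [TopologicalSpace M] [ChartedSpace (EuclideanSpace ℝ (Fin n)) M]
  {c : SignType} {w : ℝ → ℝ} {f : M → Amb c n × ℝ} {ζ : M → Amb c n} {x : M}

/-- The Weingarten operator `D` of the null normal field `(ζ, w ∘ τ)` is well defined. -/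
lemma exists_weingarten (hf : MDifferentiableAt (𝓡 n) 𝓘(ℝ, Amb c n × ℝ) f x)
    (hζ : MDifferentiableAt (𝓡 n) 𝓘(ℝ, Amb c n) ζ x)
    (h : AdaptedFrame (f x).1 (screenMap w f x (ζ x)) (ζ x))
    (htan : ∀ᶠ y in 𝓝 x, (c : ℝ) * form c n (f y).1 (ζ y) = 0)
    (hunit : ∀ᶠ y in 𝓝 x, form c n (ζ y) (ζ y) = 1) :
    ∃ D : Module.End ℝ (EuclideanSpace ℝ (Fin n)), ∀ v : EuclideanSpace ℝ (Fin n),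
      dmap ζ x v + ((c : ℝ) * ((w (f x).2)⁻¹ * (dmap f x v).2)) • (f x).1 =
        screenMap w f x (ζ x) (D v) := by
  have hf1 := mdifferentiableAt_clm (ContinuousLinearMap.fst ℝ (Amb c n) ℝ) hf
  -- Differentiating the tangency of ζ gives c⟨f₁, dζ(v)⟩ = -c w⁻¹ dτ(v). The multiple of f₁ added
  -- here cancels it, and unit length gives orthogonality to ζ.
  let L : EuclideanSpace ℝ (Fin n) →L[ℝ] Amb c n := dmap ζ x + ((c : ℝ) * (w (f x).2)⁻¹) •
    ((ContinuousLinearMap.snd ℝ (Amb c n) ℝ).comp (dmap f x)).smulRight (f x).1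
  have hL : ∀ v : EuclideanSpace ℝ (Fin n),
      L v = dmap ζ x v + ((c : ℝ) * ((w (f x).2)⁻¹ * (dmap f x v).2)) • (f x).1 := by
    intro v
    simp [L, smul_smul, mul_assoc]
  suffices hs : (∀ v, (c : ℝ) * form c n (f x).1 (L v) = 0) ∧ ∀ v, form c n (L v) (ζ x) = 0 by
    obtain ⟨D, hD⟩ := h.exists_factor L hs.1 hs.2
    exact ⟨D, fun v => by rw [← hL, hD]⟩
  refine ⟨fun v => ?_, fun v => ?_⟩
  · have h1 := form_dmap hf1 hζ htan v
    simp only [ContinuousLinearMap.coe_fst', dmap_fst hf] at h1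
    have h2 := form_fst_of_frame h v
    have h3 := sign_mul_form_self h.mem
    have h4 := sign_cube c
    rw [hL, form_add_right, form_smul_right]
    rw [h2] at h1
    linear_combination h1 + c * ((w (f x).2)⁻¹ * (dmap f x v).2) * h3 +
      ((w (f x).2)⁻¹ * (dmap f x v).2) * h4
  · have h1 := form_dmap (s := 1) hζ hζ (hunit.mono fun y hy => by rw [hy, one_mul]) v
    rw [form_comm c n (ζ x)] at h1
    rw [hL, form_add_left, form_smul_left]
    linear_combination (1 / 2) * h1 + ((w (f x).2)⁻¹ * (dmap f x v).2) * h.tangent_unit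

variable [IsManifold (𝓡 n) ∞ M]

/-- The second fundamental form in the direction of the null normal field `(ζ, w ∘ τ)` in terms
of its Weingarten operator `D`. -/
lemma secondForm_null (hf : ContMDiffAt (𝓡 n) 𝓘(ℝ, Amb c n × ℝ) 2 f x)
    (hfd : ∀ᶠ y in 𝓝 x, MDifferentiableAt (𝓡 n) 𝓘(ℝ, Amb c n × ℝ) f y)
    (hζ : MDifferentiableAt (𝓡 n) 𝓘(ℝ, Amb c n) ζ x)
    (hw : 0 < w (f x).2) (hwd : DifferentiableAt ℝ w (f x).2)
    (h : AdaptedFrame (f x).1 (screenMap w f x (ζ x)) (ζ x))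
    (hrel : ∀ᶠ y in 𝓝 x, ∀ v : EuclideanSpace ℝ (Fin n),
      w (f y).2 * form c n (dmap f y v).1 (ζ y) = (dmap f y v).2)
    {D : Module.End ℝ (EuclideanSpace ℝ (Fin n))} (hD : ∀ v : EuclideanSpace ℝ (Fin n),
      dmap ζ x v + ((c : ℝ) * ((w (f x).2)⁻¹ * (dmap f x v).2)) • (f x).1 =
        screenMap w f x (ζ x) (D v)) (u v : EuclideanSpace ℝ (Fin n)) :
    secondForm w f x (ζ x, w (f x).2) u v = -(w (f x).2 ^ 2 *
      (form c n (screenMap w f x (ζ x) v) (screenMap w f x (ζ x) (D u)) +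
        deriv w (f x).2 * form c n (screenMap w f x (ζ x) v) (screenMap w f x (ζ x) u))) := by
  set χ := extChartAt (𝓡 n) x with hχ
  have hfx := hasFDerivAt_chart hfd.self_of_nhds
  have hζx := hasFDerivAt_chart hζ
  rw [← hχ] at hfx hζx
  have hF2 : DifferentiableAt ℝ (fderiv ℝ (f ∘ χ.symm)) (χ x) :=
    ((contDiffAt_chart hf).fderiv_right (m := 1) (by norm_num)).differentiableAt one_ne_zero
  have hFv : HasFDerivAt (fun q => fderiv ℝ (f ∘ χ.symm) q v)
      ((fderiv ℝ (fderiv ℝ (f ∘ χ.symm)) (χ x)).flip v) (χ x) :=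
    (hF2.hasFDerivAt.clm_apply (hasFDerivAt_const v (χ x))).congr_fderiv (by
      rw [ContinuousLinearMap.comp_zero, zero_add])
  have hxx : χ.symm (χ x) = x := extChartAt_to_inv x
  have hwF : HasFDerivAt (fun q => w ((f ∘ χ.symm) q).2) _ (χ x) :=
    HasDerivAt.comp_hasFDerivAt (h₂ := w) (f := fun q => ((f ∘ χ.symm) q).2) (χ x) (by
      simp only [Function.comp_apply, hxx]
      exact hwd.hasDerivAt) hfx.snd
  have hlhs := hwF.mul ((formL c n).hasFDerivAt_of_bilinear hFv.fst hζx)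
  -- This is the normality of the null field, read in one fixed chart with v constant. Its
  -- derivative in the direction u produces the second derivatives of f, while ζ is differentiated
  -- only once.
  have heq : (fun q => (fderiv ℝ (f ∘ χ.symm) q v).2) =ᶠ[𝓝 (χ x)] fun q =>
      w ((f ∘ χ.symm) q).2 * formL c n (fderiv ℝ (f ∘ χ.symm) q v).1 ((ζ ∘ χ.symm) q) := by
    filter_upwards [eventually_fderiv_chart_eq x, eventually_chart.2 hfd, eventually_chart.2 hrel]
      with q ⟨T, hT⟩ hfq hq
    rw [hT _ f hfq]
    exact (hq (T v)).symm
  have hkey := DFunLike.congr_fun ((hlhs.congr_of_eventuallyEq heq).unique hFv.snd) u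
  have hdf : fderiv ℝ (f ∘ χ.symm) (χ x) = dmap f x := (dmap_eq_fderiv hfd.self_of_nhds).symm
  simp only [Function.comp_apply, hxx, hdf] at hkey
  have hkey' : w (f x).2 * (form c n (dmap f x v).1 (dmap ζ x u) +
      form c n (ddmap f x u v).1 (ζ x)) +
      form c n (dmap f x v).1 (ζ x) * (deriv w (f x).2 * (dmap f x u).2) =
      (ddmap f x u v).2 := hkey
  have h1 := form_fst_of_frame h
  -- Up to a multiple of f₁, dζ(u) lies in the screen; df₁(v) pairs to zero with c f₁, and its
  -- ζ-component is orthogonal to the screen.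
  have h2 : form c n (dmap f x v).1 (dmap ζ x u) =
      form c n (screenMap w f x (ζ x) v) (screenMap w f x (ζ x) (D u)) := by
    have e1 : dmap ζ x u = screenMap w f x (ζ x) (D u) -
        ((c : ℝ) * ((w (f x).2)⁻¹ * (dmap f x u).2)) • (f x).1 := by rw [← hD]; abel
    have e2 : (dmap f x v).1 = screenMap w f x (ζ x) v + ((w (f x).2)⁻¹ * (dmap f x v).2) • ζ x := by
      rw [screenMap_apply]; abel
    rw [e1, form_sub_right, form_smul_right]
    have e3 : form c n (dmap f x v).1 (screenMap w f x (ζ x) (D u)) =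
        form c n (screenMap w f x (ζ x) v) (screenMap w f x (ζ x) (D u)) := by
      rw [e2, form_add_left, form_smul_left, form_comm c n (ζ x), h.normal]; ring
    rw [e3, form_comm c n (dmap f x v).1]
    linear_combination (-((w (f x).2)⁻¹ * (dmap f x u).2)) * tangent_of_frame h v
  have h3 := warpedMetric_dmap hw h v u
  rw [warpedMetric] at h3
  rw [secondForm, christoffel_warpedMetric _ _ _ hwd, form_comm c n (dmap f x u).1 (dmap f x v).1]
  simp only [warpedMetric, h1] at hkey' ⊢
  rw [h2] at hkey'
  have h4 : w (f x).2 * (w (f x).2)⁻¹ = 1 := mul_inv_cancel₀ hw.ne'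
  linear_combination w (f x).2 * hkey' - deriv w (f x).2 * h3 +
    deriv w (f x).2 * (dmap f x u).2 * (dmap f x v).2 * h4

/-- The scalar product of the mean curvature vector with the null normal field `(ζ, w ∘ τ)` in
terms of its Weingarten operator `D`. -/
lemma mul_warpedMetric_meanCurvatureVector (hn : 1 ≤ n)
    (hf : ContMDiffAt (𝓡 n) 𝓘(ℝ, Amb c n × ℝ) 2 f x)
    (hfd : ∀ᶠ y in 𝓝 x, MDifferentiableAt (𝓡 n) 𝓘(ℝ, Amb c n × ℝ) f y)
    (hζ : MDifferentiableAt (𝓡 n) 𝓘(ℝ, Amb c n) ζ x)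
    (hw : 0 < w (f x).2) (hwd : DifferentiableAt ℝ w (f x).2)
    (h : AdaptedFrame (f x).1 (screenMap w f x (ζ x)) (ζ x))
    (hrel : ∀ᶠ y in 𝓝 x, ∀ v : EuclideanSpace ℝ (Fin n),
      w (f y).2 * form c n (dmap f y v).1 (ζ y) = (dmap f y v).2)
    {D : Module.End ℝ (EuclideanSpace ℝ (Fin n))} (hD : ∀ v : EuclideanSpace ℝ (Fin n),
      dmap ζ x v + ((c : ℝ) * ((w (f x).2)⁻¹ * (dmap f x v).2)) • (f x).1 =
        screenMap w f x (ζ x) (D v)) :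
    n * warpedMetric c n w (f x) (meanCurvatureVector w f x) (ζ x, w (f x).2) =
      -(LinearMap.trace ℝ _ D + n * deriv w (f x).2) := by
  have hspec := (meanCurvatureVector_spec h.mem hw hwd (tangent_of_frame h)
    (fun v hv => warpedMetric_dmap_pos hw h hv)).2 _ (isNormalAt_of_frame h)
  set Y := screenMap w f x (ζ x) with hY
  let g : EuclideanSpace ℝ (Fin n) →ₗ[ℝ] EuclideanSpace ℝ (Fin n) →ₗ[ℝ] ℝ :=
    LinearMap.mk₂ ℝ (fun u v => w (f x).2 ^ 2 * form c n (Y u) (Y v))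
      (fun u v z => by rw [map_add, form_add_left]; ring)
      (fun a u v => by rw [map_smul, form_smul_left, smul_eq_mul]; ring)
      (fun u v z => by rw [map_add, form_add_right]; ring)
      (fun a u v => by rw [map_smul, form_smul_right, smul_eq_mul]; ring)
  have hg : ∀ u v, g u v = w (f x).2 ^ 2 * form c n (Y u) (Y v) := fun u v => rfl
  -- Relative to the induced metric, ⟨h, N⟩ is represented by -(D + w' id).
  have htr := sum_gram_inv_eq_trace g (fun v hv => mul_pos (pow_pos hw 2) (h.pos hv))
    (D + deriv w (f x).2 • LinearMap.id)
  rw [map_add, map_smul, LinearMap.trace_id, finrank_euclideanSpace_fin, smul_eq_mul] at htr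
  have hgram : gram w f x =
      Matrix.of fun i j => g (EuclideanSpace.single i 1) (EuclideanSpace.single j 1) := by
    ext i j
    simp only [gram, Matrix.of_apply, warpedMetric_dmap hw h, hg, hY]
  have hsum : (∑ i, ∑ j, (gram w f x)⁻¹ i j * secondForm w f x (ζ x, w (f x).2)
      (EuclideanSpace.single i 1) (EuclideanSpace.single j 1)) =
      -(LinearMap.trace ℝ _ D + deriv w (f x).2 * n) := by
    rw [← htr, hgram, ← Finset.sum_neg_distrib]
    refine Finset.sum_congr rfl fun i _ => ?_
    rw [← Finset.sum_neg_distrib]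
    refine Finset.sum_congr rfl fun j _ => ?_
    rw [secondForm_null hf hfd hζ hw hwd h hrel hD, hg, ← hY]
    simp only [LinearMap.add_apply, LinearMap.smul_apply, LinearMap.id_apply, map_add, map_smul,
      form_add_right, form_smul_right]
    ring
  have hn0 : (n : ℝ) ≠ 0 := by exact_mod_cast (by omega : n ≠ 0)
  rw [hspec, hsum]
  field_simp

/-- The mean curvature vector is collinear to the null normal field `(ζ, w ∘ τ)` if and only if
the trace of the Weingarten operator is `-n w'(τ)`. -/
lemma collinear_iff (hn : 1 ≤ n)
    (hf : ContMDiffAt (𝓡 n) 𝓘(ℝ, Amb c n × ℝ) 2 f x)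
    (hfd : ∀ᶠ y in 𝓝 x, MDifferentiableAt (𝓡 n) 𝓘(ℝ, Amb c n × ℝ) f y)
    (hζ : MDifferentiableAt (𝓡 n) 𝓘(ℝ, Amb c n) ζ x)
    (hw : 0 < w (f x).2) (hwd : DifferentiableAt ℝ w (f x).2)
    (h : AdaptedFrame (f x).1 (screenMap w f x (ζ x)) (ζ x))
    (hrel : ∀ᶠ y in 𝓝 x, ∀ v : EuclideanSpace ℝ (Fin n),
      w (f y).2 * form c n (dmap f y v).1 (ζ y) = (dmap f y v).2)
    {D : Module.End ℝ (EuclideanSpace ℝ (Fin n))} (hD : ∀ v : EuclideanSpace ℝ (Fin n),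
      dmap ζ x v + ((c : ℝ) * ((w (f x).2)⁻¹ * (dmap f x v).2)) • (f x).1 =
        screenMap w f x (ζ x) (D v)) :
    (∃ a : ℝ, meanCurvatureVector w f x = a • (ζ x, w (f x).2)) ↔
      LinearMap.trace ℝ _ D + n * deriv w (f x).2 = 0 := by
  have hspec := (meanCurvatureVector_spec h.mem hw hwd (tangent_of_frame h)
    (fun v hv => warpedMetric_dmap_pos hw h hv)).1
  have hH := mul_warpedMetric_meanCurvatureVector hn hf hfd hζ hw hwd h hrel hD
  have hn0 : (n : ℝ) ≠ 0 := by exact_mod_cast (by omega : n ≠ 0)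
  constructor
  · rintro ⟨a, ha⟩
    rw [ha, warpedMetric_smul_left, warpedMetric_null _ _ h.unit rfl] at hH
    linarith
  · intro h0
    rw [h0, neg_zero] at hH
    -- Here n ≥ 1 is used: ⟨H, N⟩ itself vanishes, and a normal vector orthogonal to the null normal
    -- N lies on its line.
    exact ⟨_, eq_smul_null hw h hspec ((mul_eq_zero.1 hH).resolve_left hn0)⟩

end Manifold

/-! ### The function `θ` -/

section Theta

variable {I : Set ℝ} {w : ℝ → ℝ} {t₀ t : ℝ}

lemma intervalIntegrable_inv (hI' : I.OrdConnected) (hw : ContDiffOn ℝ ∞ w I)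
    (hw' : ∀ t ∈ I, 0 < w t) (h₀ : t₀ ∈ I) (ht : t ∈ I) :
    IntervalIntegrable (fun s => 1 / w s) MeasureTheory.volume t₀ t := by
  refine ContinuousOn.intervalIntegrable fun s hs => ?_
  have hsI : s ∈ I := hI'.uIcc_subset h₀ ht hs
  exact (continuousWithinAt_const.div ((hw.continuousOn s hsI).mono (hI'.uIcc_subset h₀ ht))
    (hw' s hsI).ne')

lemma contDiffOn_inv (hw : ContDiffOn ℝ ∞ w I) (hw' : ∀ t ∈ I, 0 < w t) :
    ContDiffOn ℝ ∞ (fun s => 1 / w s) I :=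
  contDiffOn_const.div hw fun s hs => (hw' s hs).ne'

lemma hasDerivAt_theta (hI : IsOpen I) (hI' : I.OrdConnected) (hw : ContDiffOn ℝ ∞ w I)
    (hw' : ∀ t ∈ I, 0 < w t) (h₀ : t₀ ∈ I) (ht : t ∈ I) :
    HasDerivAt (theta w t₀) (w t)⁻¹ t := by
  have hc := (contDiffOn_inv hw hw').continuousOn
  have := intervalIntegral.integral_hasDerivAt_right (intervalIntegrable_inv hI' hw hw' h₀ ht)
    (hc.stronglyMeasurableAtFilter hI t ht) (hc.continuousAt (hI.mem_nhds ht))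
  rwa [one_div] at this

/-- The angle θ(t) at a fixed t moves with nonzero speed when the base point moves; this is what
allows a focal angle to be avoided. -/
lemma hasDerivAt_theta_left (hI : IsOpen I) (hI' : I.OrdConnected) (hw : ContDiffOn ℝ ∞ w I)
    (hw' : ∀ t ∈ I, 0 < w t) (h₀ : t₀ ∈ I) (ht : t ∈ I) :
    HasDerivAt (fun s => theta w s t) (-(w t₀)⁻¹) t₀ := by
  have hc := (contDiffOn_inv hw hw').continuousOn
  have := intervalIntegral.integral_hasDerivAt_left (intervalIntegrable_inv hI' hw hw' h₀ ht)
    (hc.stronglyMeasurableAtFilter hI t₀ h₀) (hc.continuousAt (hI.mem_nhds h₀))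
  rwa [one_div] at this

lemma contDiffOn_theta (hI : IsOpen I) (hI' : I.OrdConnected) (hw : ContDiffOn ℝ ∞ w I)
    (hw' : ∀ t ∈ I, 0 < w t) (h₀ : t₀ ∈ I) : ContDiffOn ℝ ∞ (theta w t₀) I := by
  rw [contDiffOn_infty_iff_deriv_of_isOpen hI]
  refine ⟨fun t ht =>
    (hasDerivAt_theta hI hI' hw hw' h₀ ht).differentiableAt.differentiableWithinAt, ?_⟩
  refine (contDiffOn_inv hw hw').congr fun t ht => ?_
  rw [(hasDerivAt_theta hI hI' hw hw' h₀ ht).deriv, one_div]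

end Theta

/-! ### Rotations -/

/-- The vector at angle `s` from `p` in the plane of `p` and `z`. -/
def rot (c : SignType) {n : ℕ} (s : ℝ) (p z : Amb c n) : Amb c n := co c s • p + si c s • z

/-- The derivative of `rot` with respect to the angle. -/
def rotNormal (c : SignType) {n : ℕ} (s : ℝ) (p z : Amb c n) : Amb c n :=
  -((c : ℝ) * si c s) • p + co c s • z

section Rotation

variable {c : SignType} {n : ℕ} {p z : Amb c n}

lemma co_neg (c : SignType) (s : ℝ) : co c (-s) = co c s := by
  rcases c with _ | _ | _ <;> simp [co]

lemma si_neg (c : SignType) (s : ℝ) : si c (-s) = -si c s := by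
  rcases c with _ | _ | _ <;> simp [si]

/-- The pair (`rot`, `rotNormal`) acts on (p, z) by the matrix with rows (co, si) and (-c si, co).
The matrices of s and -s are inverse to each other because co² + c si² = 1, with no condition on p
and z. -/
lemma rot_neg_rot (s : ℝ) (p z : Amb c n) :
    rot c s (rot c (-s) p z) (rotNormal c (-s) p z) = p := by
  simp only [rot, rotNormal, co_neg, si_neg, smul_add, smul_smul]
  have h : co c s * co c s + si c s * (c * si c s) = 1 := by
    linear_combination co_sq_add_si_sq c s
  calc _ = (co c s * co c s + si c s * (c * si c s)) • p +
        (co c s * -si c s + si c s * co c s) • z := by module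
    _ = p := by rw [h]; module

lemma rotNormal_neg_rot (s : ℝ) (p z : Amb c n) :
    rotNormal c s (rot c (-s) p z) (rotNormal c (-s) p z) = z := by
  simp only [rot, rotNormal, co_neg, si_neg, smul_add, smul_smul]
  have h : co c s * co c s + c * si c s * si c s = 1 := by
    linear_combination co_sq_add_si_sq c s
  calc _ = (co c s * co c s + c * si c s * si c s) • z := by module
    _ = z := by rw [h, one_smul]

lemma rot_mem (hp : p ∈ spaceForm c n) (hz : (c : ℝ) * form c n p z = 0) (h1 : form c n z z = 1)
    (s : ℝ) : rot c s p z ∈ spaceForm c n := geodesic_mem_spaceForm hp hz h1 s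

lemma form_rot_rotNormal (hp : p ∈ spaceForm c n) (hz : (c : ℝ) * form c n p z = 0)
    (h1 : form c n z z = 1) (s : ℝ) : (c : ℝ) * form c n (rot c s p z) (rotNormal c s p z) = 0 := by
  simp only [rot, rotNormal, form_add_left, form_add_right, form_smul_left, form_smul_right, h1,
    form_comm c n z p]
  linear_combination (-(co c s * si c s * c)) * sign_mul_form_self hp -
    (co c s * si c s) * sign_cube c + (co c s ^ 2 - c * si c s ^ 2) * hz

lemma form_rotNormal_self (hp : p ∈ spaceForm c n) (hz : (c : ℝ) * form c n p z = 0)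
    (h1 : form c n z z = 1) (s : ℝ) : form c n (rotNormal c s p z) (rotNormal c s p z) = 1 := by
  simp only [rotNormal, form_add_left, form_add_right, form_smul_left, form_smul_right, h1,
    form_comm c n z p]
  linear_combination co_sq_add_si_sq c s + (si c s ^ 2 * c) * sign_mul_form_self hp +
    si c s ^ 2 * sign_cube c - 2 * si c s * co c s * hz

end Rotation

/-! ### Regularity and derivatives of rotated fields -/

section Manifold

variable {n : ℕ} {M : Type*} [TopologicalSpace M] [ChartedSpace (EuclideanSpace ℝ (Fin n)) M]
  {c : SignType}

lemma hasFDerivAt_rot {X : Type*} [NormedAddCommGroup X] [NormedSpace ℝ X] {s : X → ℝ}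
    {g h : X → Amb c n} {x : X} {s' : X →L[ℝ] ℝ} {g' h' : X →L[ℝ] Amb c n}
    (hs : HasFDerivAt s s' x) (hg : HasFDerivAt g g' x) (hh : HasFDerivAt h h' x) :
    HasFDerivAt (fun y => rot c (s y) (g y) (h y))
      (co c (s x) • g' + si c (s x) • h' + s'.smulRight (rotNormal c (s x) (g x) (h x))) x := by
  have h1 : HasFDerivAt (fun y => co c (s y)) _ x :=
    (hasDerivAt_co c (s x)).comp_hasFDerivAt x hs
  have h2 : HasFDerivAt (fun y => si c (s y)) _ x :=
    (hasDerivAt_si c (s x)).comp_hasFDerivAt x hs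
  refine ((h1.smul hg).add (h2.smul hh)).congr_fderiv ?_
  refine ContinuousLinearMap.ext fun v => ?_
  simp only [rotNormal, add_apply, smul_apply, ContinuousLinearMap.smulRight_apply, smul_eq_mul]
  module

lemma hasFDerivAt_rotNormal {X : Type*} [NormedAddCommGroup X] [NormedSpace ℝ X] {s : X → ℝ}
    {g h : X → Amb c n} {x : X} {s' : X →L[ℝ] ℝ} {g' h' : X →L[ℝ] Amb c n}
    (hs : HasFDerivAt s s' x) (hg : HasFDerivAt g g' x) (hh : HasFDerivAt h h' x) :
    HasFDerivAt (fun y => rotNormal c (s y) (g y) (h y))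
      (-((c : ℝ) * si c (s x)) • g' + co c (s x) • h' -
        ((c : ℝ) • s').smulRight (rot c (s x) (g x) (h x))) x := by
  have h1 : HasFDerivAt (fun y => co c (s y)) _ x :=
    (hasDerivAt_co c (s x)).comp_hasFDerivAt x hs
  have h2 : HasFDerivAt (fun y => -((c : ℝ) * si c (s y))) _ x :=
    (((hasDerivAt_si c (s x)).comp_hasFDerivAt x hs).const_mul (c : ℝ)).neg
  refine ((h2.smul hg).add (h1.smul hh)).congr_fderiv ?_
  refine ContinuousLinearMap.ext fun v => ?_
  simp only [rot, add_apply, sub_apply, neg_apply, smul_apply, ContinuousLinearMap.smulRight_apply,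
    smul_eq_mul]
  module

variable {x : M} {s : M → ℝ} {g h : M → Amb c n}

lemma contMDiffAt_comp_of_contDiff {F G : Type*} [NormedAddCommGroup F] [NormedSpace ℝ F]
    [NormedAddCommGroup G] [NormedSpace ℝ G] {k : ℕ∞ω} {θ : F → G} {s : M → F}
    (hs : ContMDiffAt (𝓡 n) 𝓘(ℝ, F) k s x) (hθ : ContDiffAt ℝ k θ (s x)) :
    ContMDiffAt (𝓡 n) 𝓘(ℝ, G) k (fun y => θ (s y)) x :=
  ContMDiffAt.comp (I' := 𝓘(ℝ, F)) x hθ.contMDiffAt hs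

lemma contMDiffAt_rot {k : ℕ∞} (hs : ContMDiffAt (𝓡 n) 𝓘(ℝ, ℝ) k s x)
    (hg : ContMDiffAt (𝓡 n) 𝓘(ℝ, Amb c n) k g x) (hh : ContMDiffAt (𝓡 n) 𝓘(ℝ, Amb c n) k h x) :
    ContMDiffAt (𝓡 n) 𝓘(ℝ, Amb c n) k (fun y => rot c (s y) (g y) (h y)) x :=
  ((contMDiffAt_comp_of_contDiff hs (contDiff_co c).contDiffAt).smul hg).add
    ((contMDiffAt_comp_of_contDiff hs (contDiff_si c).contDiffAt).smul hh)

lemma contMDiffAt_rotNormal {k : ℕ∞} (hs : ContMDiffAt (𝓡 n) 𝓘(ℝ, ℝ) k s x)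
    (hg : ContMDiffAt (𝓡 n) 𝓘(ℝ, Amb c n) k g x) (hh : ContMDiffAt (𝓡 n) 𝓘(ℝ, Amb c n) k h x) :
    ContMDiffAt (𝓡 n) 𝓘(ℝ, Amb c n) k (fun y => rotNormal c (s y) (g y) (h y)) x :=
  ((contMDiffAt_comp_of_contDiff hs
    (contDiff_const.mul (contDiff_si c)).neg.contDiffAt).smul hg).add
    ((contMDiffAt_comp_of_contDiff hs (contDiff_co c).contDiffAt).smul hh)

lemma mdifferentiableAt_rot (hs : MDifferentiableAt (𝓡 n) 𝓘(ℝ, ℝ) s x)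
    (hg : MDifferentiableAt (𝓡 n) 𝓘(ℝ, Amb c n) g x)
    (hh : MDifferentiableAt (𝓡 n) 𝓘(ℝ, Amb c n) h x) :
    MDifferentiableAt (𝓡 n) 𝓘(ℝ, Amb c n) (fun y => rot c (s y) (g y) (h y)) x := by
  refine mdifferentiableAt_of_chart ?_ (hasFDerivAt_rot (hasFDerivAt_chart hs)
    (hasFDerivAt_chart hg) (hasFDerivAt_chart hh)).differentiableAt
  exact ((((contDiff_co c (k := 1)).continuous.continuousAt).comp hs.continuousAt).smul
    hg.continuousAt).add ((((contDiff_si c (k := 1)).continuous.continuousAt).comp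
      hs.continuousAt).smul hh.continuousAt)

lemma mdifferentiableAt_rotNormal (hs : MDifferentiableAt (𝓡 n) 𝓘(ℝ, ℝ) s x)
    (hg : MDifferentiableAt (𝓡 n) 𝓘(ℝ, Amb c n) g x)
    (hh : MDifferentiableAt (𝓡 n) 𝓘(ℝ, Amb c n) h x) :
    MDifferentiableAt (𝓡 n) 𝓘(ℝ, Amb c n) (fun y => rotNormal c (s y) (g y) (h y)) x := by
  refine mdifferentiableAt_of_chart ?_ (hasFDerivAt_rotNormal (hasFDerivAt_chart hs)
    (hasFDerivAt_chart hg) (hasFDerivAt_chart hh)).differentiableAt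
  exact ((continuousAt_const.mul (((contDiff_si c (k := 1)).continuous.continuousAt).comp
    hs.continuousAt)).neg.smul hg.continuousAt).add
      ((((contDiff_co c (k := 1)).continuous.continuousAt).comp hs.continuousAt).smul
        hh.continuousAt)

lemma dmap_rot (hs : MDifferentiableAt (𝓡 n) 𝓘(ℝ, ℝ) s x)
    (hg : MDifferentiableAt (𝓡 n) 𝓘(ℝ, Amb c n) g x)
    (hh : MDifferentiableAt (𝓡 n) 𝓘(ℝ, Amb c n) h x) (v : EuclideanSpace ℝ (Fin n)) :
    dmap (fun y => rot c (s y) (g y) (h y)) x v = co c (s x) • dmap g x v + si c (s x) • dmap h x v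
      + dmap s x v • rotNormal c (s x) (g x) (h x) := by
  rw [dmap_eq_of_hasFDerivAt (mdifferentiableAt_rot hs hg hh).continuousAt (hasFDerivAt_rot
    (hasFDerivAt_chart hs) (hasFDerivAt_chart hg) (hasFDerivAt_chart hh))]
  simp

lemma dmap_rotNormal (hs : MDifferentiableAt (𝓡 n) 𝓘(ℝ, ℝ) s x)
    (hg : MDifferentiableAt (𝓡 n) 𝓘(ℝ, Amb c n) g x)
    (hh : MDifferentiableAt (𝓡 n) 𝓘(ℝ, Amb c n) h x) (v : EuclideanSpace ℝ (Fin n)) :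
    dmap (fun y => rotNormal c (s y) (g y) (h y)) x v =
      -((c : ℝ) * si c (s x)) • dmap g x v + co c (s x) • dmap h x v
      - ((c : ℝ) * dmap s x v) • rot c (s x) (g x) (h x) := by
  rw [dmap_eq_of_hasFDerivAt (mdifferentiableAt_rotNormal hs hg hh).continuousAt
    (hasFDerivAt_rotNormal (hasFDerivAt_chart hs) (hasFDerivAt_chart hg) (hasFDerivAt_chart hh))]
  simp

lemma mdifferentiableAt_comp_deriv {θ : ℝ → ℝ} {θ' : ℝ} {τ : M → ℝ}
    (hτ : MDifferentiableAt (𝓡 n) 𝓘(ℝ, ℝ) τ x) (hθ : HasDerivAt θ θ' (τ x)) :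
    MDifferentiableAt (𝓡 n) 𝓘(ℝ, ℝ) (fun y => θ (τ y)) x ∧
      ∀ v : EuclideanSpace ℝ (Fin n), dmap (fun y => θ (τ y)) x v = θ' * dmap τ x v := by
  have hc : ContinuousAt (fun y => θ (τ y)) x := hθ.continuousAt.comp hτ.continuousAt
  have hd : HasFDerivAt ((fun y => θ (τ y)) ∘ (extChartAt (𝓡 n) x).symm)
      (θ' • dmap (n := n) τ x) (extChartAt (𝓡 n) x x) :=
    HasDerivAt.comp_hasFDerivAt (h₂ := θ) (f := τ ∘ (extChartAt (𝓡 n) x).symm) _ (by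
      simpa using hθ) (hasFDerivAt_chart hτ)
  refine ⟨mdifferentiableAt_of_chart hc hd.differentiableAt, fun v => ?_⟩
  rw [dmap_eq_of_hasFDerivAt hc hd]
  rfl

end Manifold

section Manifold

variable {n : ℕ} {M : Type*} [TopologicalSpace M] [ChartedSpace (EuclideanSpace ℝ (Fin n)) M]
  {c : SignType} {U : Set M} {φ ν : M → Amb c n} {x : M}

namespace IsHypersurface

/-! ### Hypersurfaces -/

lemma contMDiffAt (h : IsHypersurface c U φ ν) (hU : IsOpen U) (hx : x ∈ U) :
    ContMDiffAt (𝓡 n) 𝓘(ℝ, Amb c n) 4 φ x :=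
  h.contMDiffOn.contMDiffAt (hU.mem_nhds hx)

lemma mdifferentiableAt (h : IsHypersurface c U φ ν) (hU : IsOpen U) (hx : x ∈ U) :
    MDifferentiableAt (𝓡 n) 𝓘(ℝ, Amb c n) φ x :=
  (h.contMDiffAt hU hx).mdifferentiableAt (by norm_num)

lemma adaptedFrame (h : IsHypersurface c U φ ν) (hU : IsOpen U) (hx : x ∈ U) :
    AdaptedFrame (φ x) (dmap φ x) (ν x) :=
  ⟨h.mem x hx, h.immersion x hx,
    tangent_dmap (h.mdifferentiableAt hU hx)
      (Filter.eventually_of_mem (hU.mem_nhds hx) fun y hy => h.mem y hy),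
    h.normal x hx, h.tangent x hx, h.unit x hx⟩

variable [IsManifold (𝓡 n) ∞ M]

/-- A Gauss map is only assumed continuous. The equations of orthogonality, tangency and unit length
determine it up to sign, so it is as smooth as dφ. -/
lemma contMDiffAt_normal (h : IsHypersurface c U φ ν) (hU : IsOpen U) (hx : x ∈ U) :
    ContMDiffAt (𝓡 n) 𝓘(ℝ, Amb c n) 3 ν x := by
  have hev : ∀ᶠ y in 𝓝 x, y ∈ U := hU.mem_nhds hx
  refine contMDiffAt_unit_field (m := 4) (g := φ) (h := fun _ => 0) (τ := fun _ => 0) (by norm_num)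
    (by norm_num) (hev.mono fun y hy => h.contMDiffAt hU hy)
    (Filter.Eventually.of_forall fun y => contMDiffAt_const) contMDiffAt_const
    (h.continuousOn.continuousAt (hU.mem_nhds hx)) (hev.mono fun y hy v => ?_)
    (hev.mono fun y hy => h.tangent y hy) (hev.mono fun y hy => h.unit y hy) ?_
  · rw [h.normal y hy, zero_mul]
  · intro W h1 h2 h3
    exact (h.adaptedFrame hU hx).eq_zero h2 (by rw [form_comm]; exact h3) h1

lemma mdifferentiableAt_normal (h : IsHypersurface c U φ ν) (hU : IsOpen U) (hx : x ∈ U) :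
    MDifferentiableAt (𝓡 n) 𝓘(ℝ, Amb c n) ν x :=
  (h.contMDiffAt_normal hU hx).mdifferentiableAt (by norm_num)

lemma dmap_normal (h : IsHypersurface c U φ ν) (hU : IsOpen U) (hx : x ∈ U)
    (v : EuclideanSpace ℝ (Fin n)) : dmap ν x v = -dmap φ x (shapeOperator φ ν x v) := by
  have hev : ∀ᶠ y in 𝓝 x, y ∈ U := hU.mem_nhds hx
  have hF := h.adaptedFrame hU hx
  have hφ := h.mdifferentiableAt hU hx
  have hν := h.mdifferentiableAt_normal hU hx
  have h1 : ∀ v : EuclideanSpace ℝ (Fin n), (c : ℝ) * form c n (φ x) ((-dmap ν x) v) = 0 := by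
    intro v
    have h2 := form_dmap hφ hν (hev.mono fun y hy => h.tangent y hy) v
    rw [neg_apply, form_neg_right]
    linear_combination -h2 + (c : ℝ) * h.normal x hx v
  have h2 : ∀ v : EuclideanSpace ℝ (Fin n), form c n ((-dmap ν x) v) (ν x) = 0 := by
    intro v
    have h2 := form_dmap (s := 1) hν hν (hev.mono fun y hy => by rw [h.unit y hy, one_mul]) v
    rw [form_comm c n (ν x)] at h2
    rw [neg_apply, form_neg_left]
    linear_combination -(1 / 2) * h2
  obtain ⟨A, hA⟩ := hF.exists_factor (-dmap ν x) h1 h2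
  -- The differential of ν is tangent to the space form and orthogonal to ν, hence factors through
  -- dφ; this existence gives the chosen shape operator its defining property.
  have hex : ∃ A : Module.End ℝ (EuclideanSpace ℝ (Fin n)), ∀ v, dmap ν x v = -dmap φ x (A v) :=
    ⟨A, fun v => by rw [← hA, neg_apply, neg_neg]⟩
  exact Classical.epsilon_spec hex v

lemma shapeOperator_symm (h : IsHypersurface c U φ ν) (hU : IsOpen U) (hx : x ∈ U)
    (u v : EuclideanSpace ℝ (Fin n)) :
    form c n (dmap φ x (shapeOperator φ ν x u)) (dmap φ x v) =
      form c n (dmap φ x u) (dmap φ x (shapeOperator φ ν x v)) := by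
  set χ := extChartAt (𝓡 n) x with hχ
  have hφ := h.mdifferentiableAt hU hx
  have hev : ∀ᶠ y in 𝓝 x, y ∈ U := hU.mem_nhds hx
  have hνx := hasFDerivAt_chart (h.mdifferentiableAt_normal hU hx)
  rw [← hχ] at hνx
  have hxx : χ.symm (χ x) = x := extChartAt_to_inv x
  have hC := contDiffAt_chart (h.contMDiffAt hU hx)
  rw [← hχ] at hC
  have hF2 : DifferentiableAt ℝ (fderiv ℝ (φ ∘ χ.symm)) (χ x) :=
    (hC.fderiv_right (m := 1) (by norm_num)).differentiableAt one_ne_zero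
  have hFv : ∀ v, HasFDerivAt (fun q => fderiv ℝ (φ ∘ χ.symm) q v)
      ((fderiv ℝ (fderiv ℝ (φ ∘ χ.symm)) (χ x)).flip v) (χ x) := fun v =>
    (hF2.hasFDerivAt.clm_apply (hasFDerivAt_const v (χ x))).congr_fderiv (by
      rw [ContinuousLinearMap.comp_zero, zero_add])
  have hdφ : fderiv ℝ (φ ∘ χ.symm) (χ x) = dmap φ x := (dmap_eq_fderiv hφ).symm
  -- Differentiating ⟨dφ(v), ν⟩ = 0 along u. Self-adjointness of A thereby reduces to the symmetry
  -- of the second derivative of φ.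
  have key : ∀ u v : EuclideanSpace ℝ (Fin n), form c n (dmap φ x v) (dmap ν x u) =
      -form c n (fderiv ℝ (fderiv ℝ (φ ∘ χ.symm)) (χ x) u v) (ν x) := by
    intro u v
    have h1 := (formL c n).hasFDerivAt_of_bilinear (hFv v) hνx
    have h2 : (fun _ => (0 : ℝ)) =ᶠ[𝓝 (χ x)] fun q =>
        formL c n (fderiv ℝ (φ ∘ χ.symm) q v) ((ν ∘ χ.symm) q) := by
      filter_upwards [eventually_fderiv_chart_eq x, eventually_chart.2 hev] with q ⟨T, hT⟩ hq
      rw [hT _ φ (h.mdifferentiableAt hU hq)]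
      exact (h.normal _ hq (T v)).symm
    have h3 := DFunLike.congr_fun ((h1.congr_of_eventuallyEq h2).unique (hasFDerivAt_const 0 _)) u
    simp only [Function.comp_apply, hxx, hdφ] at h3
    have h4 : form c n (dmap φ x v) (dmap ν x u) +
      form c n (fderiv ℝ (fderiv ℝ (φ ∘ χ.symm)) (χ x) u v) (ν x) = 0 := h3
    linarith
  have hsymm := (hC.isSymmSndFDerivAt (by simp; norm_num)) u v
  have e1 := key u v
  have e2 := key v u
  rw [← hsymm, ← e1, h.dmap_normal hU hx, h.dmap_normal hU hx, form_neg_right, form_neg_right] at e2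
  rw [form_comm c n (dmap φ x (shapeOperator φ ν x u))]
  linarith

end IsHypersurface

/-! ### The parallel-type hypersurfaces of the warped product -/

section PhiBar

variable [IsManifold (𝓡 n) ∞ M] {I : Set ℝ} {w : ℝ → ℝ} {t₀ : ℝ} {τ : M → ℝ}

lemma phiBar_fst (w : ℝ → ℝ) (t₀ : ℝ) (φ ν : M → Amb c n) (τ : M → ℝ) (y : M) :
    (phiBar w t₀ φ ν τ y).1 = rot c (theta w t₀ (τ y)) (φ y) (ν y) := rfl

lemma phiBar_snd (w : ℝ → ℝ) (t₀ : ℝ) (φ ν : M → Amb c n) (τ : M → ℝ) (y : M) :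
    (phiBar w t₀ φ ν τ y).2 = τ y := rfl

lemma nuBar_eq (w : ℝ → ℝ) (t₀ : ℝ) (φ ν : M → Amb c n) (τ : M → ℝ) (y : M) :
    nuBar w t₀ φ ν τ y = (rotNormal c (theta w t₀ (τ y)) (φ y) (ν y), w (τ y)) := rfl

/-- The endomorphism `co(θ ∘ τ) - si(θ ∘ τ) A`. -/
def focalOperator (w : ℝ → ℝ) (t₀ : ℝ) (φ ν : M → Amb c n) (τ : M → ℝ) (x : M) :
    Module.End ℝ (EuclideanSpace ℝ (Fin n)) :=
  co c (theta w t₀ (τ x)) • LinearMap.id - si c (theta w t₀ (τ x)) • shapeOperator φ ν x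

lemma focalOperator_apply (v : EuclideanSpace ℝ (Fin n)) : focalOperator w t₀ φ ν τ x v =
    co c (theta w t₀ (τ x)) • v - si c (theta w t₀ (τ x)) • shapeOperator φ ν x v := rfl

/-- The operator `co(θ ∘ τ) - si(θ ∘ τ) A` is injective if and only if no principal curvature is
equal to `ct(θ ∘ τ)`. -/
lemma injective_focalOperator_iff : (∀ v, focalOperator w t₀ φ ν τ x v = 0 → v = 0) ↔
    ∀ κ : Module.End.Eigenvalues (shapeOperator φ ν x),
      si c (theta w t₀ (τ x)) = 0 ∨ ct c (theta w t₀ (τ x)) ≠ (κ : ℝ) := by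
  set θ := theta w t₀ (τ x) with hθ
  constructor
  · intro hS κ
    by_contra! hκ
    obtain ⟨hsi, hct⟩ := hκ
    have hE : Module.End.HasEigenvalue (shapeOperator φ ν x) (κ : ℝ) := κ.2
    obtain ⟨v, hv⟩ := hE.exists_hasEigenvector
    refine hv.2 (hS v ?_)
    rw [focalOperator_apply, hv.apply_eq_smul, ← hθ, ← sub_eq_zero]
    change co c θ • v - si c θ • (κ : ℝ) • v - 0 = 0
    rw [← hct, ct, smul_smul, mul_div_cancel₀ _ hsi]
    simp
  · intro h v hv
    rw [focalOperator_apply, ← hθ] at hv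
    by_contra hne
    -- If si = 0 then co² = 1, so the operator is ± the identity. Otherwise a kernel vector is an
    -- eigenvector of A for the eigenvalue co / si.
    by_cases hsi : si c θ = 0
    · have h1 := co_sq_add_si_sq c θ
      rw [hsi, zero_smul, sub_zero, smul_eq_zero] at hv
      have h2 := hv.resolve_right hne
      rw [hsi, h2] at h1
      simp at h1
    · have hA : shapeOperator φ ν x v = ct c θ • v := by
        rw [ct, div_eq_inv_mul, mul_smul, sub_eq_zero.1 hv, smul_smul, inv_mul_cancel₀ hsi, one_smul]
      have hE : Module.End.HasEigenvalue (shapeOperator φ ν x) (ct c θ) :=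
        Module.End.hasEigenvalue_of_hasEigenvector ⟨Module.End.mem_eigenspace_iff.2 hA, hne⟩
      rcases h ⟨_, hE⟩ with h1 | h1
      · exact hsi h1
      · exact h1 rfl

/-- The trace of the inverse of `co(θ ∘ τ) - si(θ ∘ τ) A` composed with
`c si(θ ∘ τ) + co(θ ∘ τ) A` is the sum that appears in the main equation. -/
lemma trace_eq_sum_curvTerm (h : IsHypersurface c U φ ν) (hU : IsOpen U) (hx : x ∈ U)
    (hS : ∀ v, focalOperator w t₀ φ ν τ x v = 0 → v = 0)
    {K : Module.End ℝ (EuclideanSpace ℝ (Fin n))}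
    (hK : ∀ v, focalOperator w t₀ φ ν τ x (K v) =
      ((c : ℝ) * si c (theta w t₀ (τ x))) • v + co c (theta w t₀ (τ x)) • shapeOperator φ ν x v) :
    LinearMap.trace ℝ _ K = ∑ κ : Module.End.Eigenvalues (shapeOperator φ ν x),
      principalMultiplicity φ ν x κ * curvTerm c κ (theta w t₀ (τ x)) := by
  set θ := theta w t₀ (τ x) with hθ
  let g : EuclideanSpace ℝ (Fin n) →ₗ[ℝ] EuclideanSpace ℝ (Fin n) →ₗ[ℝ] ℝ :=
    LinearMap.mk₂ ℝ (fun u v => form c n (dmap φ x u) (dmap φ x v))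
      (fun u v z => by rw [map_add, form_add_left])
      (fun a u v => by rw [map_smul, form_smul_left, smul_eq_mul])
      (fun u v z => by rw [map_add, form_add_right])
      (fun a u v => by rw [map_smul, form_smul_right, smul_eq_mul])
  have hF := h.adaptedFrame hU hx
  refine trace_eq_sum_eigenvalues g (fun u v => form_comm c n _ _) (fun v hv => hF.pos hv)
    (shapeOperator φ ν x) K (h.shapeOperator_symm hU hx) (fun κ => curvTerm c κ θ) ?_
  intro κ v hv
  rcases eq_or_ne v 0 with rfl | hne
  · simp
  have hA : shapeOperator φ ν x v = κ • v := Module.End.mem_eigenspace_iff.1 hv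
  have hne' : co c θ - si c θ * κ ≠ 0 := by
    intro h0
    refine hne (hS v ?_)
    rw [focalOperator_apply, hA, ← hθ, smul_smul, ← sub_smul, h0, zero_smul]
  -- On the κ-eigenspace K multiplies by (c si + co κ) / (co - si κ). Dividing by si gives the
  -- quotient in ct; for si = 0 it reduces to κ, matching the convention.
  have hct : curvTerm c κ θ * (co c θ - si c θ * κ) = c * si c θ + co c θ * κ := by
    by_cases hsi : si c θ = 0
    · simp [curvTerm, hsi, mul_comm]
    · have h1 : co c θ / si c θ - κ ≠ 0 := by
        intro h0
        apply hne'
        field_simp at h0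
        linear_combination h0
      rw [curvTerm, if_neg hsi, ct, div_mul_eq_mul_div, div_eq_iff h1]
      field_simp
      ring
  rw [← sub_eq_zero]
  apply hS
  rw [map_sub, map_smul, hK, focalOperator_apply, hA, ← hθ]
  calc _ = ((c * si c θ + co c θ * κ) - curvTerm c κ θ * (co c θ - si c θ * κ)) • v := by module
    _ = 0 := by rw [hct, sub_self, zero_smul]

variable (hI : IsOpen I) (hI' : I.OrdConnected) (hw : ContDiffOn ℝ ∞ w I)
  (hw' : ∀ t ∈ I, 0 < w t) (h₀ : t₀ ∈ I) (hU : IsOpen U) (h : IsHypersurface c U φ ν)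
  (hτ : ContMDiffOn (𝓡 n) 𝓘(ℝ, ℝ) 2 τ U) (hτI : ∀ y ∈ U, τ y ∈ I)

include hI hI' hw hw' h₀ hU h hτ hτI

lemma contMDiffAt_theta (hx : x ∈ U) :
    ContMDiffAt (𝓡 n) 𝓘(ℝ, ℝ) 2 (fun y => theta w t₀ (τ y)) x :=
  contMDiffAt_comp_of_contDiff (hτ.contMDiffAt (hU.mem_nhds hx))
    (((contDiffOn_theta hI hI' hw hw' h₀).contDiffAt (hI.mem_nhds (hτI x hx))).of_le
      (show ((2 : ℕ∞) : ℕ∞ω) ≤ ((⊤ : ℕ∞) : ℕ∞ω) by exact_mod_cast le_top))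

lemma contMDiffAt_phiBar (hx : x ∈ U) :
    ContMDiffAt (𝓡 n) 𝓘(ℝ, Amb c n × ℝ) 2 (phiBar w t₀ φ ν τ) x := by
  have h1 := contMDiffAt_theta hI hI' hw hw' h₀ hU h hτ hτI hx
  have h2 : ContMDiffAt (𝓡 n) 𝓘(ℝ, Amb c n) 2 φ x :=
    (h.contMDiffAt hU hx).of_le (by norm_num)
  have h3 : ContMDiffAt (𝓡 n) 𝓘(ℝ, Amb c n) 2 ν x :=
    (h.contMDiffAt_normal hU hx).of_le (by norm_num)
  exact (contMDiffAt_rot (k := 2) h1 h2 h3).prodMk_space (hτ.contMDiffAt (hU.mem_nhds hx))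

lemma dmap_theta (hx : x ∈ U) : MDifferentiableAt (𝓡 n) 𝓘(ℝ, ℝ) (fun y => theta w t₀ (τ y)) x ∧
    ∀ v : EuclideanSpace ℝ (Fin n),
      dmap (fun y => theta w t₀ (τ y)) x v = (w (τ x))⁻¹ * dmap τ x v :=
  mdifferentiableAt_comp_deriv
    ((hτ.contMDiffAt (hU.mem_nhds hx)).mdifferentiableAt (by norm_num))
    (hasDerivAt_theta hI hI' hw hw' h₀ (hτI x hx))

/-- Substituting dν = -dφ ∘ A turns co dφ + si dν into dφ ∘ (co - si A). The variation of the angle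
contributes θ' dτ = w⁻¹ dτ along the rotated normal. -/
lemma dmap_phiBar (hx : x ∈ U) (v : EuclideanSpace ℝ (Fin n)) :
    dmap (phiBar w t₀ φ ν τ) x v = (dmap φ x (focalOperator w t₀ φ ν τ x v) +
      ((w (τ x))⁻¹ * dmap τ x v) • rotNormal c (theta w t₀ (τ x)) (φ x) (ν x), dmap τ x v) := by
  have hd := (contMDiffAt_phiBar hI hI' hw hw' h₀ hU h hτ hτI hx).mdifferentiableAt (by norm_num)
  obtain ⟨h1, h2⟩ := dmap_theta hI hI' hw hw' h₀ hU h hτ hτI hx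
  refine Prod.ext ?_ (dmap_snd hd v).symm
  have h3 := dmap_rot h1 (h.mdifferentiableAt hU hx) (h.mdifferentiableAt_normal hU hx) v
  rw [h2, h.dmap_normal hU hx] at h3
  rw [← dmap_fst hd]
  refine h3.trans ?_
  rw [focalOperator_apply, map_sub, map_smul, map_smul]
  module

lemma phiBar_mem (hx : x ∈ U) : phiBar w t₀ φ ν τ x ∈ spaceForm c n ×ˢ I :=
  ⟨rot_mem (h.mem x hx) (h.tangent x hx) (h.unit x hx) _, hτI x hx⟩

lemma form_dmap_phiBar (hx : x ∈ U) (v : EuclideanSpace ℝ (Fin n)) :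
    w (τ x) * form c n (dmap (phiBar w t₀ φ ν τ) x v).1
      (rotNormal c (theta w t₀ (τ x)) (φ x) (ν x)) = (dmap (phiBar w t₀ φ ν τ) x v).2 := by
  have hF := h.adaptedFrame hU hx
  have h1 := form_rotNormal_self hF.mem hF.tangent_unit hF.unit (theta w t₀ (τ x))
  have h2 : form c n (dmap φ x (focalOperator w t₀ φ ν τ x v))
      (rotNormal c (theta w t₀ (τ x)) (φ x) (ν x)) = 0 := by
    rw [rotNormal, form_add_right, form_smul_right, form_smul_right, hF.normal, form_comm]
    linear_combination (-si c (theta w t₀ (τ x))) * hF.tangent (focalOperator w t₀ φ ν τ x v)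
  rw [dmap_phiBar hI hI' hw hw' h₀ hU h hτ hτI hx]
  simp only [form_add_left, form_smul_left, h1, h2]
  have := (hw' _ (hτI x hx)).ne'
  field_simp
  ring

lemma isNormalAt_nuBar (hx : x ∈ U) :
    IsNormalAt w (phiBar w t₀ φ ν τ) x (nuBar w t₀ φ ν τ x) := by
  have hF := h.adaptedFrame hU hx
  refine ⟨form_rot_rotNormal hF.mem hF.tangent_unit hF.unit _, fun v => ?_⟩
  have h1 := form_dmap_phiBar hI hI' hw hw' h₀ hU h hτ hτI hx v
  rw [nuBar_eq, warpedMetric, phiBar_snd]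
  linear_combination w (τ x) * h1

/-- The dτ-term of the differential points along the rotated normal and is exactly what the screen
map discards. What remains is the differential of the parallel hypersurface at the fixed distance
θ(τ(x)). -/
lemma screenMap_phiBar (hx : x ∈ U) (v : EuclideanSpace ℝ (Fin n)) :
    screenMap w (phiBar w t₀ φ ν τ) x (rotNormal c (theta w t₀ (τ x)) (φ x) (ν x)) v =
      dmap φ x (focalOperator w t₀ φ ν τ x v) := by
  rw [screenMap_apply, dmap_phiBar hI hI' hw hw' h₀ hU h hτ hτI hx, phiBar_snd]
  exact add_sub_cancel_right _ _

/-- `phiBar` is spacelike at `x` if and only if `co(θ ∘ τ) - si(θ ∘ τ) A` is injective; then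
`nuBar` is a null normal vector. -/
lemma phiBar_pos_iff (hx : x ∈ U) :
    ((∀ v : EuclideanSpace ℝ (Fin n), v ≠ 0 → 0 < warpedMetric c n w (phiBar w t₀ φ ν τ x)
      (dmap (phiBar w t₀ φ ν τ) x v) (dmap (phiBar w t₀ φ ν τ) x v)) ↔
      ∀ v, focalOperator w t₀ φ ν τ x v = 0 → v = 0) ∧
    ((∀ v, focalOperator w t₀ φ ν τ x v = 0 → v = 0) →
      AdaptedFrame (phiBar w t₀ φ ν τ x).1 (screenMap w (phiBar w t₀ φ ν τ) x
        (rotNormal c (theta w t₀ (τ x)) (φ x) (ν x)))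
        (rotNormal c (theta w t₀ (τ x)) (φ x) (ν x))) := by
  have hwx : 0 < w (phiBar w t₀ φ ν τ x).2 := hw' _ (hτI x hx)
  have hF := h.adaptedFrame hU hx
  have hd := (contMDiffAt_phiBar hI hI' hw hw' h₀ hU h hτ hτI hx).mdifferentiableAt (by norm_num)
  have hmem := phiBar_mem hI hI' hw hw' h₀ hU h hτ hτI hx
  have htan : ∀ v : EuclideanSpace ℝ (Fin n), (c : ℝ) * form c n (phiBar w t₀ φ ν τ x).1
      (dmap (phiBar w t₀ φ ν τ) x v).1 = 0 := by
    intro v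
    rw [← dmap_fst hd]
    exact tangent_dmap (mdifferentiableAt_clm (ContinuousLinearMap.fst ℝ (Amb c n) ℝ) hd)
      (Filter.eventually_of_mem (hU.mem_nhds hx) fun y hy =>
        (phiBar_mem hI hI' hw hw' h₀ hU h hτ hτI hy).1) v
  have hunit := form_rotNormal_self hF.mem hF.tangent_unit hF.unit (theta w t₀ (τ x))
  have hscr := screenMap_phiBar hI hI' hw hw' h₀ hU h hτ hτI hx
  have hNx := isNormalAt_nuBar hI hI' hw hw' h₀ hU h hτ hτI hx
  rw [nuBar_eq] at hNx
  have hperp : ∀ v : EuclideanSpace ℝ (Fin n), form c n (dmap φ x v) (rotNormal c (theta w t₀ (τ x)) (φ x) (ν x)) = 0 := by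
    intro v
    rw [rotNormal, form_add_right, form_smul_right, form_smul_right, hF.normal, form_comm]
    linear_combination (-si c (theta w t₀ (τ x))) * hF.tangent v
  generalize rotNormal c (theta w t₀ (τ x)) (φ x) (ν x) = z at *
  have hFr : (∀ v, focalOperator w t₀ φ ν τ x v = 0 → v = 0) →
      AdaptedFrame (phiBar w t₀ φ ν τ x).1 (screenMap w (phiBar w t₀ φ ν τ) x z) z := by
    intro hS
    refine ⟨hmem.1, ?_, fun v => ?_, fun v => ?_, hNx.1, hunit⟩
    · rw [injective_iff_map_eq_zero]
      intro v hv
      rw [hscr] at hv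
      exact hS v (hF.injective (by rw [hv, map_zero]))
    · rw [screenMap_apply, form_sub_right, form_smul_right]
      linear_combination htan v - (w (phiBar w t₀ φ ν τ x).2)⁻¹ *
        (dmap (phiBar w t₀ φ ν τ) x v).2 * hNx.1
    · rw [hscr, hperp]
  refine ⟨⟨fun hp v hv => ?_, fun hS v hv => warpedMetric_dmap_pos hwx (hFr hS) hv⟩, hFr⟩
  -- Spacelikeness makes the screen map injective, and the screen map factors as dφ after the focal
  -- operator.
  apply (adaptedFrame_screenMap hmem.1 htan hwx hp hNx hunit).injective
  rw [map_zero, hscr, hv, map_zero]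

/-- The derivative of the rotated normal is -dφ(c si + co A) up to the term -c dθ `rot`, which the
correction in the definition of the Weingarten operator cancels. As the screen map is dφ after the
focal operator, the Weingarten operator is -K. -/
lemma weingarten_phiBar (hx : x ∈ U) {K : Module.End ℝ (EuclideanSpace ℝ (Fin n))}
    (hK : ∀ v, focalOperator w t₀ φ ν τ x (K v) =
      ((c : ℝ) * si c (theta w t₀ (τ x))) • v + co c (theta w t₀ (τ x)) • shapeOperator φ ν x v)
    (v : EuclideanSpace ℝ (Fin n)) :
    dmap (fun y => rotNormal c (theta w t₀ (τ y)) (φ y) (ν y)) x v +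
      ((c : ℝ) * ((w (phiBar w t₀ φ ν τ x).2)⁻¹ * (dmap (phiBar w t₀ φ ν τ) x v).2)) •
        (phiBar w t₀ φ ν τ x).1 =
      screenMap w (phiBar w t₀ φ ν τ) x (rotNormal c (theta w t₀ (τ x)) (φ x) (ν x))
        ((-K) v) := by
  obtain ⟨hθ, hθ'⟩ := dmap_theta hI hI' hw hw' h₀ hU h hτ hτI hx
  rw [screenMap_phiBar hI hI' hw hw' h₀ hU h hτ hτI hx,
    dmap_rotNormal hθ (h.mdifferentiableAt hU hx) (h.mdifferentiableAt_normal hU hx), hθ',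
    dmap_phiBar hI hI' hw hw' h₀ hU h hτ hτI hx, phiBar_snd, phiBar_fst, LinearMap.neg_apply,
    map_neg, hK, h.dmap_normal hU hx, map_neg, map_add, map_smul, map_smul]
  module

/-- The main equation holds at `x` if and only if `phiBar` is spacelike at `x` with mean curvature
vector collinear to `nuBar`. -/
theorem mainEquation_iff (hn : 1 ≤ n) (hx : x ∈ U) : MainEquation w t₀ φ ν τ x ↔
    (∀ v : EuclideanSpace ℝ (Fin n), v ≠ 0 → 0 < warpedMetric c n w (phiBar w t₀ φ ν τ x)
      (dmap (phiBar w t₀ φ ν τ) x v) (dmap (phiBar w t₀ φ ν τ) x v)) ∧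
    ∃ a : ℝ, meanCurvatureVector w (phiBar w t₀ φ ν τ) x = a • nuBar w t₀ φ ν τ x := by
  have hev : ∀ᶠ y in 𝓝 x, y ∈ U := hU.mem_nhds hx
  obtain ⟨hpos, hFr⟩ := phiBar_pos_iff hI hI' hw hw' h₀ hU h hτ hτI hx
  rw [MainEquation, ← injective_focalOperator_iff, hpos]
  refine and_congr_right fun hS => ?_
  -- Under the non-focal condition, K = S⁻¹(c si + co A) with S the focal operator.
  let e := LinearEquiv.ofInjectiveEndo (focalOperator w t₀ φ ν τ x)
    ((injective_iff_map_eq_zero _).2 hS)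
  let K : Module.End ℝ (EuclideanSpace ℝ (Fin n)) := e.symm.toLinearMap ∘ₗ
    (((c : ℝ) * si c (theta w t₀ (τ x))) • LinearMap.id +
      co c (theta w t₀ (τ x)) • shapeOperator φ ν x)
  have hK : ∀ v, focalOperator w t₀ φ ν τ x (K v) =
      ((c : ℝ) * si c (theta w t₀ (τ x))) • v +
        co c (theta w t₀ (τ x)) • shapeOperator φ ν x v := fun v =>
    e.apply_symm_apply _
  have hcol : (∃ a : ℝ, meanCurvatureVector w (phiBar w t₀ φ ν τ) x = a • nuBar w t₀ φ ν τ x) ↔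
      LinearMap.trace ℝ _ (-K) + n * deriv w (phiBar w t₀ φ ν τ x).2 = 0 := by
    have hCx := contMDiffAt_phiBar hI hI' hw hw' h₀ hU h hτ hτI hx
    have hfd : ∀ᶠ y in 𝓝 x, MDifferentiableAt (𝓡 n) 𝓘(ℝ, Amb c n × ℝ) (phiBar w t₀ φ ν τ) y :=
      hev.mono fun y hy =>
        (contMDiffAt_phiBar hI hI' hw hw' h₀ hU h hτ hτI hy).mdifferentiableAt (by norm_num)
    have hζ := mdifferentiableAt_rotNormal (dmap_theta hI hI' hw hw' h₀ hU h hτ hτI hx).1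
      (h.mdifferentiableAt hU hx) (h.mdifferentiableAt_normal hU hx)
    have hwx : 0 < w (phiBar w t₀ φ ν τ x).2 := hw' _ (hτI x hx)
    have hwd : DifferentiableAt ℝ w (phiBar w t₀ φ ν τ x).2 :=
      (hw.contDiffAt (hI.mem_nhds (hτI x hx))).differentiableAt (by simp)
    have hrel : ∀ᶠ y in 𝓝 x, ∀ v : EuclideanSpace ℝ (Fin n), w (phiBar w t₀ φ ν τ y).2 *
        form c n (dmap (phiBar w t₀ φ ν τ) y v).1
          (rotNormal c (theta w t₀ (τ y)) (φ y) (ν y)) = (dmap (phiBar w t₀ φ ν τ) y v).2 := by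
      filter_upwards [hev] with y hy v
      have := form_dmap_phiBar hI hI' hw hw' h₀ hU h hτ hτI hy v
      exact this
    have hwg := weingarten_phiBar hI hI' hw hw' h₀ hU h hτ hτI hx hK
    exact collinear_iff (f := phiBar w t₀ φ ν τ)
      (ζ := fun y => rotNormal c (theta w t₀ (τ y)) (φ y) (ν y)) hn hCx hfd hζ hwx hwd (hFr hS)
      hrel hwg
  have htr := trace_eq_sum_curvTerm h hU hx hS hK
  rw [map_neg, htr, phiBar_snd] at hcol
  rw [hcol]
  constructor <;> intro h1 <;> linear_combination h1

end PhiBar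

end Manifold

/-! ### The direct equivalence, normalized null fields, and the choice of base point -/

section Manifold

variable {n : ℕ} {M : Type*} [TopologicalSpace M] [ChartedSpace (EuclideanSpace ℝ (Fin n)) M]
  {c : SignType} {I : Set ℝ} {w : ℝ → ℝ}

/-- The map `phiBar` is a marginally trapped spacelike immersion along `nuBar` if and only if the
main equation holds. -/
theorem isMarginallyTrappedAlong_phiBar_iff [IsManifold (𝓡 n) ∞ M] (hn : 1 ≤ n) (hI : IsOpen I)
    (hI' : I.OrdConnected) (hw : ContDiffOn ℝ ∞ w I) (hw' : ∀ t ∈ I, 0 < w t) {t₀ : ℝ} (h₀ : t₀ ∈ I)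
    {φ ν : M → Amb c n} {τ : M → ℝ} (h : IsHypersurface c univ φ ν)
    (hτ : ContMDiff (𝓡 n) 𝓘(ℝ, ℝ) 2 τ) (hτI : ∀ x, τ x ∈ I) :
    (IsSpacelike c I w 2 univ (phiBar w t₀ φ ν τ) ∧
      IsMarginallyTrappedAlong w univ (phiBar w t₀ φ ν τ) (nuBar w t₀ φ ν τ)) ↔
        ∀ x, MainEquation w t₀ φ ν τ x := by
  have hτ' := hτ.contMDiffOn (s := univ)
  have hτI' : ∀ x ∈ (univ : Set M), τ x ∈ I := fun x _ => hτI x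
  constructor
  · rintro ⟨h1, h2⟩ x
    exact (mainEquation_iff hI hI' hw hw' h₀ isOpen_univ h hτ' hτI' hn (mem_univ x)).2
      ⟨h1.pos x (mem_univ x), h2.collinear x (mem_univ x)⟩
  · intro hM
    have hM' := fun x =>
      (mainEquation_iff hI hI' hw hw' h₀ isOpen_univ h hτ' hτI' hn (mem_univ x)).1 (hM x)
    refine ⟨⟨fun x hx => phiBar_mem hI hI' hw hw' h₀ isOpen_univ h hτ' hτI' hx,
      fun x hx => (contMDiffAt_phiBar hI hI' hw hw' h₀ isOpen_univ h hτ' hτI' hx).contMDiffWithinAt,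
      fun x _ => (hM' x).1⟩, ?_, fun x _ h0 => ?_,
      fun x hx => isNormalAt_nuBar hI hI' hw hw' h₀ isOpen_univ h hτ' hτI' hx, fun x hx => ?_,
      fun x _ => (hM' x).2⟩
    · intro x hx
      have hθ := (dmap_theta hI hI' hw hw' h₀ isOpen_univ h hτ' hτI' hx).1
      have hwc : ContinuousAt (fun y => w (τ y)) x :=
        ((hw.contDiffAt (hI.mem_nhds (hτI x))).continuousAt).comp (f := τ) hτ.continuous.continuousAt
      exact ((mdifferentiableAt_rotNormal hθ (h.mdifferentiableAt isOpen_univ hx)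
        (h.mdifferentiableAt_normal isOpen_univ hx)).continuousAt.prodMk hwc).continuousWithinAt
    · exact (hw' _ (hτI x)).ne' (congrArg Prod.snd h0)
    · exact warpedMetric_null _ _ (form_rotNormal_self (h.mem x hx) (h.tangent x hx)
        (h.unit x hx) _) rfl

lemma IsMarginallyTrappedAlong.isMarginallyTrapped {U : Set M} {f N : M → Amb c n × ℝ}
    (h : IsMarginallyTrappedAlong w U f N) : IsMarginallyTrapped w U f := by
  intro x hx
  obtain ⟨a, ha⟩ := h.collinear x hx
  rw [ha, warpedMetric_smul_left, warpedMetric_smul_right, h.null x hx, mul_zero, mul_zero]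

/-- `(ζ, w ∘ τ)` is a continuous null normal field along the spacelike immersion `f = (f₁, τ)`. -/
structure IsNullField (w : ℝ → ℝ) (V : Set M) (f : M → Amb c n × ℝ) (ζ : M → Amb c n) : Prop where
  continuousOn : ContinuousOn ζ V
  frame : ∀ y ∈ V, AdaptedFrame (f y).1 (screenMap w f y (ζ y)) (ζ y)

lemma IsSpacelike.tangent_fst {k : ℕ∞} (hk : k ≠ 0) {f : M → Amb c n × ℝ}
    (hf : IsSpacelike c I w k univ f) (y : M) (v : EuclideanSpace ℝ (Fin n)) :
    (c : ℝ) * form c n (f y).1 (dmap f y v).1 = 0 := by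
  have hd : MDifferentiableAt (𝓡 n) 𝓘(ℝ, Amb c n × ℝ) f y :=
    (hf.contMDiffOn.contMDiffAt Filter.univ_mem).mdifferentiableAt (by exact_mod_cast hk)
  rw [← dmap_fst hd]
  exact tangent_dmap (mdifferentiableAt_clm (ContinuousLinearMap.fst ℝ (Amb c n) ℝ) hd)
    (Filter.Eventually.of_forall fun z => (hf.mem z (mem_univ z)).1) v

/-- The normalization of a null normal field. -/
lemma IsMarginallyTrappedAlong.exists_isNullField (hI : IsOpen I) (hw : ContDiffOn ℝ ∞ w I)
    (hw' : ∀ t ∈ I, 0 < w t) {k : ℕ∞} (hk : k ≠ 0) {f N : M → Amb c n × ℝ}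
    (hf : IsSpacelike c I w k univ f) {V : Set M} (hN : IsMarginallyTrappedAlong w V f N) :
    ∃ ζ : M → Amb c n, IsNullField w V f ζ ∧
      ∀ y ∈ V, ∃ a : ℝ, meanCurvatureVector w f y = a • (ζ y, w (f y).2) := by
  -- A null vector with zero time component has a null space component, which vanishes because the
  -- space form is Riemannian. Hence N can be rescaled to have time component w.
  have hN2 : ∀ y ∈ V, (N y).2 ≠ 0 := by
    intro y hy h0
    have hwy := hw' _ (hf.mem y (mem_univ y)).2
    have h1 := hN.null y hy
    rw [warpedMetric, h0, mul_zero, sub_zero] at h1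
    have h2 : (N y).1 = 0 := by
      by_contra hne
      have := form_self_pos (hf.mem y (mem_univ y)).1 (hN.normal y hy).1 hne
      rcases mul_eq_zero.1 h1 with h3 | h3
      · exact hwy.ne' (pow_eq_zero_iff two_ne_zero |>.1 h3)
      · exact this.ne' h3
    exact hN.ne_zero y hy (Prod.ext h2 h0)
  have hsm : ∀ y ∈ V, (((w (f y).2 / (N y).2) • (N y).1, w (f y).2) : Amb c n × ℝ) =
      (w (f y).2 / (N y).2) • N y := by
    intro y hy
    refine Prod.ext rfl ?_
    rw [Prod.smul_snd, smul_eq_mul, div_mul_cancel₀ _ (hN2 y hy)]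
  refine ⟨fun y => (w (f y).2 / (N y).2) • (N y).1, ⟨fun y hy => ?_, fun y hy => ?_⟩,
    fun y hy => ?_⟩
  · have hwc : ContinuousAt (fun y => w (f y).2) y :=
      ContinuousAt.comp (g := w) (f := fun y => (f y).2)
        (hw.contDiffAt (hI.mem_nhds (hf.mem y (mem_univ y)).2)).continuousAt
        (hf.contMDiffOn.contMDiffAt Filter.univ_mem).continuousAt.snd
    exact (hwc.continuousWithinAt.div (hN.continuousOn y hy).snd (hN2 y hy)).smul
      (hN.continuousOn y hy).fst
  · have hwy := hw' _ (hf.mem y (mem_univ y)).2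
    refine adaptedFrame_screenMap (hf.mem y (mem_univ y)).1 (hf.tangent_fst hk y) hwy
      (hf.pos y (mem_univ y)) ?_ ?_
    · rw [hsm y hy]
      refine ⟨?_, fun v => ?_⟩
      · rw [Prod.smul_fst, form_smul_right]
        linear_combination (w (f y).2 / (N y).2) * (hN.normal y hy).1
      · rw [warpedMetric_smul_right, (hN.normal y hy).2, mul_zero]
    · have h1 := hN.null y hy
      rw [warpedMetric] at h1
      rw [form_smul_left, form_smul_right]
      have h3 := hN2 y hy
      field_simp
      linear_combination h1
  · obtain ⟨a, ha⟩ := hN.collinear y hy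
    refine ⟨a * ((N y).2 / w (f y).2), ?_⟩
    have hwy := (hw' _ (hf.mem y (mem_univ y)).2).ne'
    rw [hsm y hy, ha, smul_smul]
    congr 1
    have h3 := hN2 y hy
    field_simp

/-- Arbitrarily close to `t₁` there is a base point for which `co(θ(t)) - si(θ(t)) D` is
injective. -/
lemma exists_basePoint (hI : IsOpen I) (hI' : I.OrdConnected) (hw : ContDiffOn ℝ ∞ w I)
    (hw' : ∀ t ∈ I, 0 < w t) (c : SignType) (D : Module.End ℝ (EuclideanSpace ℝ (Fin n)))
    {t t₁ : ℝ} (ht : t ∈ I) (h₁ : t₁ ∈ I) {ε : ℝ} (hε : 0 < ε) :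
    ∃ t₀ ∈ I, |t₀ - t₁| < ε ∧ ∀ v, co c (theta w t₀ t) • v - si c (theta w t₀ t) • D v = 0 → v = 0 := by
  classical
  -- Away from the zeros of P the operator co - si D is injective. P is analytic with P(0) = 1, so
  -- its zeros are isolated.
  let P : ℝ → ℝ := fun s => ∏ κ : Module.End.Eigenvalues D, (co c s - si c s * (κ : ℝ))
  have hP : AnalyticOnNhd ℝ P univ := fun s hs =>
    Finset.analyticAt_fun_prod _ fun κ _ =>
      (analyticOnNhd_co c s hs).sub ((analyticOnNhd_si c s hs).mul analyticAt_const)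
  have hP0 : P 0 = 1 := by simp [P, co_zero, si_zero]
  have hinj : ∀ s, P s ≠ 0 → ∀ v, co c s • v - si c s • D v = 0 → v = 0 := by
    intro s hs v hv
    by_contra hne
    by_cases hsi : si c s = 0
    · have h1 := co_sq_add_si_sq c s
      rw [hsi, zero_smul, sub_zero, smul_eq_zero] at hv
      rw [hsi, hv.resolve_right hne] at h1
      simp at h1
    · have hA : D v = (co c s / si c s) • v := by
        rw [div_eq_inv_mul, mul_smul, sub_eq_zero.1 hv, smul_smul, inv_mul_cancel₀ hsi, one_smul]
      have hE : Module.End.HasEigenvalue D (co c s / si c s) :=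
        Module.End.hasEigenvalue_of_hasEigenvector ⟨Module.End.mem_eigenspace_iff.2 hA, hne⟩
      let κ : Module.End.Eigenvalues D := ⟨_, hE⟩
      refine hs (Finset.prod_eq_zero (Finset.mem_univ κ) ?_)
      change co c s - si c s * (co c s / si c s) = 0
      field_simp
      ring
  -- Since the derivative is nonzero, base points close to but different from t₁ give angles close
  -- to but different from θ(t) with base t₁, where P does not vanish.
  have htend := (hasDerivAt_theta_left hI hI' hw hw' h₁ ht).tendsto_nhdsNE
    (neg_ne_zero.2 (inv_ne_zero (hw' t₁ h₁).ne'))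
  have hne : ∀ᶠ s in 𝓝[≠] (theta w t₁ t), P s ≠ 0 := by
    rcases (hP (theta w t₁ t) trivial).eventually_eq_zero_or_eventually_ne_zero with h | h
    · have := hP.eqOn_zero_of_preconnected_of_eventuallyEq_zero isPreconnected_univ trivial h
        (mem_univ 0)
      rw [hP0] at this
      exact absurd this one_ne_zero
    · exact h
  have hev : ∀ᶠ s in 𝓝[≠] t₁, s ∈ I ∧ |s - t₁| < ε := by
    refine nhdsWithin_le_nhds ?_
    filter_upwards [hI.mem_nhds h₁, Metric.ball_mem_nhds t₁ hε] with s h1 h2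
    exact ⟨h1, by rwa [Metric.mem_ball, Real.dist_eq] at h2⟩
  obtain ⟨t₀, ⟨h1, h2⟩, h3⟩ := (hev.and (htend.eventually hne)).exists
  exact ⟨t₀, h1, h2, hinj _ h3⟩

end Manifold

/-! ### Following the null geodesics back to a hypersurface -/

section Manifold

variable {n : ℕ} {M : Type*} [TopologicalSpace M] [ChartedSpace (EuclideanSpace ℝ (Fin n)) M]
  {c : SignType} {I : Set ℝ} {w : ℝ → ℝ} {f : M → Amb c n × ℝ} {V : Set M} {ζ : M → Amb c n}

namespace IsNullField

lemma form_dmap (hN : IsNullField w V f ζ) {y : M} (hy : y ∈ V) (hw : 0 < w (f y).2)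
    (v : EuclideanSpace ℝ (Fin n)) :
    w (f y).2 * form c n (dmap f y v).1 (ζ y) = (dmap f y v).2 := by
  rw [form_fst_of_frame (hN.frame y hy), mul_inv_cancel_left₀ hw.ne']

lemma mono (hN : IsNullField w V f ζ) {V' : Set M} (h : V' ⊆ V) : IsNullField w V' f ζ :=
  ⟨hN.continuousOn.mono h, fun y hy => hN.frame y (h hy)⟩

variable [IsManifold (𝓡 n) ∞ M]

/-- The field is cut out by ⟨df₁, ζ⟩ = w⁻¹ dτ, tangency and unit length, so only one derivative of
the C⁵ map f is lost. This is where the class C⁴ of φ comes from. -/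
lemma contMDiffAt (hI : IsOpen I) (hw : ContDiffOn ℝ ∞ w I) (hw' : ∀ t ∈ I, 0 < w t)
    (hf : IsSpacelike c I w 5 univ f) (hV : IsOpen V) (hN : IsNullField w V f ζ) {x : M}
    (hx : x ∈ V) : ContMDiffAt (𝓡 n) 𝓘(ℝ, Amb c n) 4 ζ x := by
  have hfy : ∀ y, ContMDiffAt (𝓡 n) 𝓘(ℝ, Amb c n × ℝ) 5 f y := fun y =>
    hf.contMDiffOn.contMDiffAt Filter.univ_mem
  have hfd := fun y => (hfy y).mdifferentiableAt (by norm_num)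
  have hev : ∀ᶠ y in 𝓝 x, y ∈ V := hV.mem_nhds hx
  have hF := hN.frame x hx
  have hτ : ∀ y, ContMDiffAt (𝓡 n) 𝓘(ℝ, ℝ) 5 (fun y => (f y).2) y := fun y =>
    contMDiffAt_comp_of_contDiff (hfy y) contDiff_snd.contDiffAt
  refine contMDiffAt_unit_field (m := 5) (g := fun y => (f y).1)
    (h := fun y => (w (f y).2)⁻¹) (τ := fun y => (f y).2) (by norm_num) (by norm_num)
    (Filter.Eventually.of_forall fun y =>
      contMDiffAt_comp_of_contDiff (hfy y) contDiff_fst.contDiffAt)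
    (Filter.Eventually.of_forall hτ) ?_
    (hN.continuousOn.continuousAt (hV.mem_nhds hx)) (hev.mono fun y hy v => ?_)
    (hev.mono fun y hy => (hN.frame y hy).tangent_unit)
    (hev.mono fun y hy => (hN.frame y hy).unit) ?_
  · have hτx := (hf.mem x (mem_univ x)).2
    have h1 : ContDiffAt ℝ ((4 : ℕ∞) : ℕ∞ω) (fun s => (w s)⁻¹) (f x).2 :=
      ((hw.contDiffAt (hI.mem_nhds hτx)).inv (hw' _ hτx).ne').of_le (by exact_mod_cast le_top)
    exact contMDiffAt_comp_of_contDiff (k := 4) (θ := fun s => (w s)⁻¹)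
      ((hτ x).of_le (by norm_num)) h1
  · rw [dmap_fst (hfd y), dmap_snd (hfd y)]
    exact form_fst_of_frame (hN.frame y hy) v
  · intro W h1 h2 h3
    refine hF.eq_zero h2 (by rw [form_comm]; exact h3) fun v => ?_
    have h4 := h1 v
    rw [dmap_fst (hfd x)] at h4
    rw [screenMap_apply, form_sub_left, form_smul_left, h3, h4]
    ring

lemma exists_weingarten (hI : IsOpen I) (hw : ContDiffOn ℝ ∞ w I) (hw' : ∀ t ∈ I, 0 < w t)
    (hf : IsSpacelike c I w 5 univ f) (hV : IsOpen V) (hN : IsNullField w V f ζ) {x : M}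
    (hx : x ∈ V) : ∃ D : Module.End ℝ (EuclideanSpace ℝ (Fin n)), ∀ v : EuclideanSpace ℝ (Fin n),
      dmap ζ x v + ((c : ℝ) * ((w (f x).2)⁻¹ * (dmap f x v).2)) • (f x).1 =
        screenMap w f x (ζ x) (D v) := by
  have hev : ∀ᶠ y in 𝓝 x, y ∈ V := hV.mem_nhds hx
  exact RobertsonWalker.exists_weingarten
    ((hf.contMDiffOn.contMDiffAt Filter.univ_mem).mdifferentiableAt (by norm_num))
    ((hN.contMDiffAt hI hw hw' hf hV hx).mdifferentiableAt (by norm_num)) (hN.frame x hx)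
    (hev.mono fun y hy => (hN.frame y hy).tangent_unit)
    (hev.mono fun y hy => (hN.frame y hy).unit)

/-- The differential of the map obtained by following back the null geodesics. -/
lemma dmap_rot_neg (hI : IsOpen I) (hI' : I.OrdConnected) (hw : ContDiffOn ℝ ∞ w I)
    (hw' : ∀ t ∈ I, 0 < w t) (hf : IsSpacelike c I w 5 univ f) (hV : IsOpen V)
    (hN : IsNullField w V f ζ) {t₀ : ℝ} (h₀ : t₀ ∈ I) {x : M} (hx : x ∈ V)
    {D : Module.End ℝ (EuclideanSpace ℝ (Fin n))} (hD : ∀ v : EuclideanSpace ℝ (Fin n),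
      dmap ζ x v + ((c : ℝ) * ((w (f x).2)⁻¹ * (dmap f x v).2)) • (f x).1 =
        screenMap w f x (ζ x) (D v)) (v : EuclideanSpace ℝ (Fin n)) :
    dmap (fun y => rot c (-theta w t₀ (f y).2) (f y).1 (ζ y)) x v = screenMap w f x (ζ x)
      (co c (theta w t₀ (f x).2) • v - si c (theta w t₀ (f x).2) • D v) := by
  have hfd : MDifferentiableAt (𝓡 n) 𝓘(ℝ, Amb c n × ℝ) f x :=
    (hf.contMDiffOn.contMDiffAt Filter.univ_mem).mdifferentiableAt (by norm_num)
  have hζ := (hN.contMDiffAt hI hw hw' hf hV hx).mdifferentiableAt (by norm_num)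
  have hτd := mdifferentiableAt_clm (ContinuousLinearMap.snd ℝ (Amb c n) ℝ) hfd
  obtain ⟨hθ, hθ'⟩ := mdifferentiableAt_comp_deriv (θ := fun t => -theta w t₀ t)
    (τ := fun y => (f y).2) hτd
    (hasDerivAt_theta hI hI' hw hw' h₀ (hf.mem x (mem_univ x)).2).neg
  have h1 := dmap_rot hθ (mdifferentiableAt_clm (ContinuousLinearMap.fst ℝ (Amb c n) ℝ) hfd) hζ v
  refine h1.trans ?_
  have e1 : dmap ζ x v = screenMap w f x (ζ x) (D v) -
      ((c : ℝ) * ((w (f x).2)⁻¹ * (dmap f x v).2)) • (f x).1 := by rw [← hD]; abel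
  have e2 : dmap (fun y => ContinuousLinearMap.fst ℝ (Amb c n) ℝ (f y)) x v =
      screenMap w f x (ζ x) v + ((w (f x).2)⁻¹ * (dmap f x v).2) • ζ x := by
    rw [dmap_clm _ hfd, screenMap_apply, ContinuousLinearMap.coe_fst']; abel
  -- The terms in ζ and f₁ coming from df₁ and dζ cancel those from the variation of the angle:
  -- moving along a null geodesic does not move its foot point.
  rw [hθ', e1, e2, dmap_snd hfd, co_neg, si_neg, map_sub, map_smul, map_smul]
  simp only [rotNormal, co_neg, si_neg, ContinuousLinearMap.coe_fst']
  module

/-- A spacelike immersion whose mean curvature vector is collinear to a null normal field is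
locally represented. -/
theorem isLocallyRepresentedAt (hn : 1 ≤ n) (hI : IsOpen I) (hI' : I.OrdConnected)
    (hw : ContDiffOn ℝ ∞ w I) (hw' : ∀ t ∈ I, 0 < w t) (hf : IsSpacelike c I w 5 univ f)
    (hV : IsOpen V) (hN : IsNullField w V f ζ)
    (hH : ∀ y ∈ V, ∃ a : ℝ, meanCurvatureVector w f y = a • (ζ y, w (f y).2)) {x : M}
    (hx : x ∈ V) : IsLocallyRepresentedAt I w f x := by
  intro t₁ h₁ ε hε
  have hτI : ∀ y, (f y).2 ∈ I := fun y => (hf.mem y (mem_univ y)).2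
  obtain ⟨D, hD⟩ := hN.exists_weingarten hI hw hw' hf hV hx
  obtain ⟨t₀, h₀, hdist, hinj⟩ := exists_basePoint hI hI' hw hw' c D (hτI x) h₁ hε
  refine ⟨t₀, h₀, hdist, ?_⟩
  have hfy : ∀ y, ContMDiffAt (𝓡 n) 𝓘(ℝ, Amb c n × ℝ) 5 f y := fun y =>
    hf.contMDiffOn.contMDiffAt Filter.univ_mem
  -- The foot point, in the slice t = t₀, of the null geodesic through f(y) in the direction (ζ, w).
  set φ : M → Amb c n := fun y => rot c (-theta w t₀ (f y).2) (f y).1 (ζ y) with hφdef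
  set ν : M → Amb c n := fun y => rotNormal c (-theta w t₀ (f y).2) (f y).1 (ζ y) with hνdef
  have hτ : ∀ y, ContMDiffAt (𝓡 n) 𝓘(ℝ, ℝ) 4 (fun y => (f y).2) y := fun y =>
    contMDiffAt_comp_of_contDiff ((hfy y).of_le (by norm_num)) contDiff_snd.contDiffAt
  have hs : ∀ y, ContMDiffAt (𝓡 n) 𝓘(ℝ, ℝ) 4 (fun y => -theta w t₀ (f y).2) y := fun y =>
    (contMDiffAt_comp_of_contDiff (hτ y)
      (((contDiffOn_theta hI hI' hw hw' h₀).contDiffAt (hI.mem_nhds (hτI y))).of_le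
        (show ((4 : ℕ∞) : ℕ∞ω) ≤ ((⊤ : ℕ∞) : ℕ∞ω) by exact_mod_cast le_top))).neg
  have hf1 : ∀ y, ContMDiffAt (𝓡 n) 𝓘(ℝ, Amb c n) 4 (fun y => (f y).1) y := fun y =>
    contMDiffAt_comp_of_contDiff ((hfy y).of_le (by norm_num)) contDiff_fst.contDiffAt
  have hφ4 : ∀ y ∈ V, ContMDiffAt (𝓡 n) 𝓘(ℝ, Amb c n) 4 φ y := fun y hy =>
    contMDiffAt_rot (k := 4) (hs y) (hf1 y) (hN.contMDiffAt hI hw hw' hf hV hy)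
  have hν4 : ∀ y ∈ V, ContMDiffAt (𝓡 n) 𝓘(ℝ, Amb c n) 4 ν y := fun y hy =>
    contMDiffAt_rotNormal (k := 4) (hs y) (hf1 y) (hN.contMDiffAt hI hw hw' hf hV hy)
  -- The base point was chosen for the operator D at x alone. Injectivity is an open condition on
  -- derivatives read in one chart, so it persists nearby.
  have himm : ∀ᶠ y in 𝓝 x, Function.Injective (dmap (n := n) φ y) := by
    have hx0 : Function.Injective (fderiv ℝ (φ ∘ (extChartAt (𝓡 n) x).symm)
        (extChartAt (𝓡 n) x x)) := by
      rw [← dmap_eq_fderiv ((hφ4 x hx).mdifferentiableAt (by norm_num)),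
        injective_iff_map_eq_zero]
      intro v hv
      rw [hN.dmap_rot_neg hI hI' hw hw' hf hV h₀ hx hD] at hv
      exact hinj v ((hN.frame x hx).injective (by rw [hv, map_zero]))
    have hcont : ContinuousAt (fderiv ℝ (φ ∘ (extChartAt (𝓡 n) x).symm))
        (extChartAt (𝓡 n) x x) :=
      ((contDiffAt_chart (hφ4 x hx)).fderiv_right (m := 3) (by norm_num)).continuousAt
    refine (eventually_chart (n := n)).1 ?_
    filter_upwards [hcont.eventually (ContinuousLinearMap.isOpen_injective.mem_nhds hx0),
      eventually_fderiv_chart_eq x, (eventually_chart (n := n)).2 (hV.mem_nhds hx)] with z hz ⟨T, hT⟩ hzV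
    have hz' : Function.Injective (fderiv ℝ (φ ∘ (extChartAt (𝓡 n) x).symm) z) := hz
    rw [hT _ φ ((hφ4 _ hzV).mdifferentiableAt (by norm_num))] at hz'
    intro u v huv
    have := hz' (a₁ := T.symm u) (a₂ := T.symm v) (by simpa using huv)
    exact T.symm.injective this
  obtain ⟨U, hUsub, hUo, hxU⟩ := mem_nhds_iff.1 (himm.and (hV.mem_nhds hx))
  have hUV : ∀ y ∈ U, y ∈ V := fun y hy => (hUsub hy).2
  have hhyp : IsHypersurface c U φ ν := by
    refine ⟨fun y hy => ?_, fun y hy => (hφ4 y (hUV y hy)).contMDiffWithinAt,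
      fun y hy => (hUsub hy).1, fun y hy =>
        (hν4 y (hUV y hy)).continuousAt.continuousWithinAt, fun y hy => ?_, fun y hy v => ?_,
      fun y hy => ?_⟩ <;> have hF := hN.frame y (hUV y hy)
    · exact rot_mem hF.mem hF.tangent_unit hF.unit _
    · exact form_rot_rotNormal hF.mem hF.tangent_unit hF.unit _
    · obtain ⟨D', hD'⟩ := hN.exists_weingarten hI hw hw' hf hV (hUV y hy)
      rw [hφdef, hN.dmap_rot_neg hI hI' hw hw' hf hV h₀ (hUV y hy) hD', hνdef]
      simp only [rotNormal]
      rw [form_add_right, form_smul_right, form_smul_right, hF.normal, form_comm]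
      linear_combination (-si c (-theta w t₀ (f y).2)) * hF.tangent _
    · exact form_rotNormal_self hF.mem hF.tangent_unit hF.unit _
  have hτ2 : ContMDiffOn (𝓡 n) 𝓘(ℝ, ℝ) 2 (fun y => (f y).2) U := fun y hy =>
    ((hτ y).of_le (by norm_num)).contMDiffWithinAt
  have hrep : ∀ y, f y = phiBar w t₀ φ ν (fun y => (f y).2) y := fun y =>
    Prod.ext (rot_neg_rot _ _ _).symm rfl
  -- Equality holds on all of M, even where φ is not an immersion, so `meanCurvatureVector` of
  -- `phiBar` can be rewritten as that of f.
  have hrep' : phiBar w t₀ φ ν (fun y => (f y).2) = f := (funext hrep).symm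
  have hnu : ∀ y, nuBar w t₀ φ ν (fun y => (f y).2) y = (ζ y, w (f y).2) := fun y =>
    Prod.ext (rotNormal_neg_rot _ _ _) rfl
  refine ⟨U, φ, ν, fun y => (f y).2, hUo, hxU, hhyp, hτ2, fun y _ => hrep y, fun y hy => ?_⟩
  rw [mainEquation_iff hI hI' hw hw' h₀ hUo hhyp hτ2 (fun y _ => hτI y) hn hy, hrep', hnu]
  exact ⟨hf.pos y (mem_univ y), hH y (hUV y hy)⟩

end IsNullField

end Manifold

/-! ### Existence of null normal fields -/

/-- If `g` is a continuous family of scalar products, then the vector that represents a continuous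
family of functionals is continuous. -/
lemma continuousAt_inverse_apply {X V : Type*} [TopologicalSpace X] [NormedAddCommGroup V]
    [NormedSpace ℝ V] [FiniteDimensional ℝ V] {g : X → V →L[ℝ] V →L[ℝ] ℝ} {ℓ : X → V →L[ℝ] ℝ}
    {x : X} (hg : ContinuousAt g x) (hℓ : ContinuousAt ℓ x) (hpos : ∀ v, v ≠ 0 → 0 < g x v v) :
    ContinuousAt (fun y => (g y).inverse (ℓ y)) x := by
  have := FiniteDimensional.complete ℝ V
  obtain ⟨e, he⟩ := isInvertible_of_pos hpos
  have h1 : ContinuousAt ContinuousLinearMap.inverse (g x) := by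
    rw [← he]
    exact (contDiffAt_map_inverse (n := 0) e).continuousAt
  exact (ContinuousAt.comp (g := ContinuousLinearMap.inverse) (f := g) h1 hg).clm_apply hℓ

lemma apply_inverse_of_pos {V : Type*} [NormedAddCommGroup V] [NormedSpace ℝ V]
    [FiniteDimensional ℝ V] {g : V →L[ℝ] V →L[ℝ] ℝ} (hpos : ∀ v, v ≠ 0 → 0 < g v v)
    (ℓ : V →L[ℝ] ℝ) : g (g.inverse ℓ) = ℓ := by
  obtain ⟨e, rfl⟩ := isInvertible_of_pos hpos
  simp

section Fields

variable {c : SignType} {n : ℕ} {X : Type*} [TopologicalSpace X]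
  {a : X → EuclideanSpace ℝ (Fin n) →L[ℝ] Amb c n} {b : X → EuclideanSpace ℝ (Fin n) →L[ℝ] ℝ}
  {p : X → Amb c n} {σ : X → ℝ} {x : X}

lemma continuousAt_inducedForm (ha : ContinuousAt a x) :
    ContinuousAt (fun y => inducedForm (a y)) x := by
  have h1 : ∀ A : EuclideanSpace ℝ (Fin n) →L[ℝ] Amb c n, inducedForm A =
      ((ContinuousLinearMap.compL ℝ (EuclideanSpace ℝ (Fin n)) (Amb c n) ℝ).flip A).comp
        ((formL c n).comp A) := fun A => by
    ext u v
    rfl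
  simp only [h1]
  exact (((ContinuousLinearMap.compL ℝ (EuclideanSpace ℝ (Fin n)) (Amb c n) ℝ).flip.continuous
    |>.continuousAt.comp ha)).clm_comp (continuousAt_const.clm_comp ha)

lemma inducedForm_pos {A : EuclideanSpace ℝ (Fin n) →L[ℝ] Amb c n} {q : Amb c n}
    (hq : q ∈ spaceForm c n) (htan : ∀ v, (c : ℝ) * form c n q (A v) = 0)
    (hinj : ∀ v, A v = 0 → v = 0) (v : EuclideanSpace ℝ (Fin n)) (hv : v ≠ 0) :
    0 < inducedForm A v v :=
  form_self_pos hq (htan v) fun h => hv (hinj v h)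

/-- A hyperplane in the tangent space of the space form has a nonzero normal vector. -/
lemma exists_normal_ne_zero {A : EuclideanSpace ℝ (Fin n) →L[ℝ] Amb c n} {q : Amb c n}
    (hq : q ∈ spaceForm c n) :
    ∃ η : Amb c n, η ≠ 0 ∧ (c : ℝ) * form c n q η = 0 ∧ ∀ v, form c n (A v) η = 0 := by
  let L : tangentSub q →ₗ[ℝ] (EuclideanSpace ℝ (Fin n) →ₗ[ℝ] ℝ) :=
    (LinearMap.mk₂ ℝ (fun W v => form c n (A v) W)
      (fun u v z => form_add_right _ _ _) (fun r u v => form_smul_right _ _ _)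
      (fun u v z => by rw [map_add, form_add_left])
      (fun r u v => by rw [map_smul, form_smul_left, smul_eq_mul])).domRestrict (tangentSub q)
  -- Orthogonality to the image of A imposes n linear conditions on a space of dimension n + 1.
  have hker : LinearMap.ker L ≠ ⊥ := by
    refine LinearMap.ker_ne_bot_of_finrank_lt ?_
    rw [finrank_tangentSub hq, Module.finrank_linearMap_self, finrank_euclideanSpace_fin]
    exact Nat.lt_succ_self n
  obtain ⟨η, hη, hne⟩ := (Submodule.ne_bot_iff _).1 hker
  exact ⟨η, fun h => hne (Subtype.ext h), mem_tangentSub.1 η.2,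
    fun v => LinearMap.congr_fun hη v⟩

/-- Locally, a continuous field of hyperplanes of the tangent spaces of the space form has a
continuous unit normal field. -/
lemma exists_unit_normal (ha : ∀ᶠ y in 𝓝 x, ContinuousAt a y)
    (hp : ∀ᶠ y in 𝓝 x, ContinuousAt p y) (hmem : ∀ᶠ y in 𝓝 x, p y ∈ spaceForm c n)
    (htan : ∀ᶠ y in 𝓝 x, ∀ v, (c : ℝ) * form c n (p y) (a y v) = 0)
    (hinj : ∀ᶠ y in 𝓝 x, ∀ v, a y v = 0 → v = 0) :
    ∃ η : X → Amb c n, ∀ᶠ y in 𝓝 x, ContinuousAt η y ∧ (c : ℝ) * form c n (p y) (η y) = 0 ∧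
      (∀ v, form c n (a y v) (η y) = 0) ∧ form c n (η y) (η y) = 1 := by
  obtain ⟨η₀, hne, hη₀, hη₀a⟩ := exists_normal_ne_zero (A := a x) hmem.self_of_nhds
  -- The vector η₀, normal at x, is projected at nearby y by subtracting its component in the image
  -- of a(y) and, if c ≠ 0, its component along p(y). As W(x) = η₀, continuity keeps W spacelike
  -- near x.
  let W : X → Amb c n := fun y =>
    η₀ - a y ((inducedForm (a y)).inverse (((formL c n).flip η₀).comp (a y))) -
      ((c : ℝ) * form c n (p y) η₀) • p y
  have hWc : ∀ᶠ y in 𝓝 x, ContinuousAt W y := by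
    filter_upwards [ha, hp, hmem, htan, hinj] with y h1 h2 h3 h4 h5
    have h6 : ContinuousAt (fun y => (c : ℝ) * form c n (p y) η₀) y := continuousAt_const.mul
      (((formL c n).continuous.continuousAt.comp h2).clm_apply continuousAt_const)
    exact (continuousAt_const.sub (h1.clm_apply (continuousAt_inverse_apply
      (continuousAt_inducedForm h1) (continuousAt_const.clm_comp h1)
      (inducedForm_pos h3 h4 h5)))).sub (h6.smul h2)
  have hWx : W x = η₀ := by
    have h1 : ((formL c n).flip η₀).comp (a x) = 0 := by
      ext v
      exact hη₀a v
    simp only [W, h1, hη₀, map_zero, sub_zero, zero_smul]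
  have hWpos : ∀ᶠ y in 𝓝 x, 0 < form c n (W y) (W y) := by
    have h1 : ContinuousAt (fun y => formL c n (W y) (W y)) x :=
      ((formL c n).continuous.continuousAt.comp hWc.self_of_nhds).clm_apply hWc.self_of_nhds
    refine h1.eventually (lt_mem_nhds ?_)
    change 0 < form c n (W x) (W x)
    rw [hWx]
    exact form_self_pos hmem.self_of_nhds hη₀ hne
  refine ⟨fun y => (√(form c n (W y) (W y)))⁻¹ • W y, ?_⟩
  filter_upwards [hWc, hWpos, hmem, htan, hinj] with y h1 h2 h3 h4 h5
  have hsq : 0 < √(form c n (W y) (W y)) := Real.sqrt_pos.2 h2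
  have hWtan : (c : ℝ) * form c n (p y) (W y) = 0 := by
    simp only [W, form_sub_right, form_smul_right]
    have h6 := sign_mul_form_self h3
    have h7 := sign_cube c
    linear_combination -(h4 _) - c * form c n (p y) η₀ * h6 - form c n (p y) η₀ * h7
  have hWa : ∀ v, form c n (a y v) (W y) = 0 := by
    intro v
    have h6 := DFunLike.congr_fun (apply_inverse_of_pos (inducedForm_pos h3 h4 h5)
      (((formL c n).flip η₀).comp (a y))) v
    rw [inducedForm_apply, form_comm] at h6
    have h7 : (((formL c n).flip η₀).comp (a y)) v = form c n (a y v) η₀ := rfl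
    simp only [W, form_sub_right, form_smul_right]
    rw [h6, h7, form_comm c n (a y v) (p y)]
    linear_combination -(form c n (p y) η₀) * h4 v
  refine ⟨?_, ?_, fun v => ?_, ?_⟩
  · have h6 : ContinuousAt (fun y => √(form c n (W y) (W y))) y :=
      Real.continuous_sqrt.continuousAt.comp
        (((formL c n).continuous.continuousAt.comp h1).clm_apply h1)
    exact (h6.inv₀ hsq.ne').smul h1
  · rw [form_smul_right]
    linear_combination (√(form c n (W y) (W y)))⁻¹ * hWtan
  · rw [form_smul_right, hWa, mul_zero]
  · rw [form_smul_left, form_smul_right]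
    have h6 := Real.mul_self_sqrt h2.le
    field_simp
    rw [sq, h6]

/-- Locally, there are two distinct continuous fields of unit vectors `ζ` with
`⟨a v, ζ⟩ = b v / σ`. -/
lemma exists_pair_unit_fields (ha : ∀ᶠ y in 𝓝 x, ContinuousAt a y)
    (hb : ∀ᶠ y in 𝓝 x, ContinuousAt b y) (hσ : ∀ᶠ y in 𝓝 x, ContinuousAt σ y)
    (hσ0 : ∀ᶠ y in 𝓝 x, 0 < σ y)
    (hp : ∀ᶠ y in 𝓝 x, ContinuousAt p y) (hmem : ∀ᶠ y in 𝓝 x, p y ∈ spaceForm c n)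
    (htan : ∀ᶠ y in 𝓝 x, ∀ v, (c : ℝ) * form c n (p y) (a y v) = 0)
    (hpos : ∀ᶠ y in 𝓝 x, ∀ v, v ≠ 0 → b y v * b y v < σ y ^ 2 * form c n (a y v) (a y v)) :
    ∃ ζ₁ ζ₂ : X → Amb c n, ∀ᶠ y in 𝓝 x, ζ₁ y ≠ ζ₂ y ∧ ∀ ζ, ζ = ζ₁ ∨ ζ = ζ₂ →
      ContinuousAt ζ y ∧ (c : ℝ) * form c n (p y) (ζ y) = 0 ∧
      (∀ v, σ y * form c n (a y v) (ζ y) = b y v) ∧ form c n (ζ y) (ζ y) = 1 := by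
  have hinj : ∀ᶠ y in 𝓝 x, ∀ v, a y v = 0 → v = 0 := by
    filter_upwards [hpos] with y h v hv
    by_contra hne
    have := h v hne
    rw [hv, form_zero_left, mul_zero] at this
    exact absurd this (not_lt.2 (mul_self_nonneg _))
  obtain ⟨η, hη⟩ := exists_unit_normal ha hp hmem htan hinj
  -- The component of ζ in the image of a is forced to be a(u), with u representing b/σ. Unit length
  -- then leaves the two choices ±r η for the rest.
  let u : X → EuclideanSpace ℝ (Fin n) := fun y =>
    (inducedForm (a y)).inverse ((σ y)⁻¹ • b y)
  let r : X → ℝ := fun y => √(1 - form c n (a y (u y)) (a y (u y)))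
  refine ⟨fun y => a y (u y) + r y • η y, fun y => a y (u y) + (-r y) • η y, ?_⟩
  filter_upwards [ha, hb, hσ, hσ0, hmem, htan, hpos, hinj, hη] with y h1 h2 h3 h4 h5 h6 h7 h8
    ⟨g1, g2, g3, g4⟩
  have huc : ContinuousAt u y := continuousAt_inverse_apply (continuousAt_inducedForm h1)
    ((h3.inv₀ h4.ne').smul h2) (inducedForm_pos h5 h6 h8)
  have hau : ContinuousAt (fun y => a y (u y)) y := h1.clm_apply huc
  have hrc : ContinuousAt r y := Real.continuous_sqrt.continuousAt.comp
    (continuousAt_const.sub (((formL c n).continuous.continuousAt.comp hau).clm_apply hau))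
  have hu : ∀ v, form c n (a y v) (a y (u y)) = (σ y)⁻¹ * b y v := by
    intro v
    have := DFunLike.congr_fun (apply_inverse_of_pos (inducedForm_pos h5 h6 h8)
      ((σ y)⁻¹ • b y)) v
    rw [inducedForm_apply, form_comm] at this
    exact this
  -- The spacelike inequality at v = u, where b(u) = σ|a u|², reads σ²|a u|⁴ < σ²|a u|². This gives
  -- r > 0, so the two fields are distinct.
  have hlt : form c n (a y (u y)) (a y (u y)) < 1 := by
    rcases eq_or_ne (u y) 0 with h0 | h0
    · rw [h0, map_zero, form_zero_left]; exact one_pos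
    · have e1 := h7 _ h0
      have e2 := hu (u y)
      have e3 : b y (u y) = σ y * form c n (a y (u y)) (a y (u y)) := by
        rw [e2, mul_inv_cancel_left₀ h4.ne']
      have e4 := inducedForm_pos h5 h6 h8 _ h0
      rw [inducedForm_apply] at e4
      rw [e3] at e1
      by_contra hcon
      have e5 : 1 ≤ form c n (a y (u y)) (a y (u y)) := not_lt.1 hcon
      nlinarith [mul_pos (pow_pos h4 2) e4]
  have hr : 0 < r y := Real.sqrt_pos.2 (by linarith)
  have hrr : r y * r y = 1 - form c n (a y (u y)) (a y (u y)) := Real.mul_self_sqrt (by linarith)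
  have key : ∀ s : X → ℝ, ContinuousAt s y → s y * s y = r y * r y →
      ContinuousAt (fun y => a y (u y) + s y • η y) y ∧
      (c : ℝ) * form c n (p y) (a y (u y) + s y • η y) = 0 ∧
      (∀ v, σ y * form c n (a y v) (a y (u y) + s y • η y) = b y v) ∧
      form c n (a y (u y) + s y • η y) (a y (u y) + s y • η y) = 1 := by
    intro s hs hsr
    refine ⟨hau.add (hs.smul g1), ?_, fun v => ?_, ?_⟩
    · rw [form_add_right, form_smul_right]
      linear_combination h6 (u y) + s y * g2
    · rw [form_add_right, form_smul_right, g3, hu, mul_zero, add_zero, mul_inv_cancel_left₀ h4.ne']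
    · simp only [form_add_left, form_add_right, form_smul_left, form_smul_right, g4, g3,
        form_comm c n (η y) (a y (u y))]
      linear_combination hsr + hrr
  refine ⟨fun heq => ?_, ?_⟩
  · have h9 : (2 * r y) • η y = 0 := by
      have := sub_eq_zero.2 heq
      rw [← this]
      module
    have h10 := congrArg (fun W => form c n W (η y)) h9
    simp only [form_smul_left, g4, form_zero_left] at h10
    linarith
  · rintro ζ (rfl | rfl)
    · exact key r hrc rfl
    · exact key (fun y => -r y) hrc.neg (by ring)

end Fields

/-! ### Pairs of null fields, continuity of the trace, and density -/

section Manifold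

variable {n : ℕ} {M : Type*} [TopologicalSpace M] [ChartedSpace (EuclideanSpace ℝ (Fin n)) M]
  [IsManifold (𝓡 n) ∞ M]
  {c : SignType} {I : Set ℝ} {w : ℝ → ℝ} {f : M → Amb c n × ℝ} {V : Set M} {ζ : M → Amb c n}

/-- Locally, a spacelike immersion of codimension two has two distinct null normal fields. -/
lemma exists_pair_nullFields (hI : IsOpen I) (hw : ContDiffOn ℝ ∞ w I) (hw' : ∀ t ∈ I, 0 < w t)
    (hf : IsSpacelike c I w 5 univ f) (x : M) :
    ∃ (V : Set M) (ζ₁ ζ₂ : M → Amb c n), IsOpen V ∧ x ∈ V ∧ IsNullField w V f ζ₁ ∧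
      IsNullField w V f ζ₂ ∧ ∀ y ∈ V, ζ₁ y ≠ ζ₂ y := by
  set χ := extChartAt (𝓡 n) x with hχ
  have hfy : ∀ y, ContMDiffAt (𝓡 n) 𝓘(ℝ, Amb c n × ℝ) 5 f y := fun y =>
    hf.contMDiffOn.contMDiffAt Filter.univ_mem
  have hfd : ∀ y, MDifferentiableAt (𝓡 n) 𝓘(ℝ, Amb c n × ℝ) f y := fun y =>
    (hfy y).mdifferentiableAt (by norm_num)
  have hC : ContDiffAt ℝ 5 (f ∘ χ.symm) (χ x) := contDiffAt_chart (hfy x)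
  have hCev : ∀ᶠ z in 𝓝 (χ x), ContDiffAt ℝ 5 (f ∘ χ.symm) z := hC.eventually (by norm_num)
  have hdc : ∀ᶠ z in 𝓝 (χ x), ContinuousAt (fderiv ℝ (f ∘ χ.symm)) z :=
    hCev.mono fun z hz => (hz.fderiv_right (m := 4) (by norm_num)).continuousAt
  have hT := eventually_fderiv_chart_eq (n := n) x
  rw [← hχ] at hT
  have hmem : ∀ y, (f y).1 ∈ spaceForm c n := fun y => (hf.mem y (mem_univ y)).1
  have hτI : ∀ y, (f y).2 ∈ I := fun y => (hf.mem y (mem_univ y)).2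
  -- The fields are built in the fixed chart at x: `dmap f y` is expressed in the preferred chart at
  -- y, which need not vary continuously with y.
  obtain ⟨ζ₁, ζ₂, hζ⟩ := exists_pair_unit_fields (x := χ x)
    (a := fun z => (ContinuousLinearMap.fst ℝ (Amb c n) ℝ).comp (fderiv ℝ (f ∘ χ.symm) z))
    (b := fun z => (ContinuousLinearMap.snd ℝ (Amb c n) ℝ).comp (fderiv ℝ (f ∘ χ.symm) z))
    (p := fun z => ((f ∘ χ.symm) z).1) (σ := fun z => w ((f ∘ χ.symm) z).2)
    (hdc.mono fun z hz => continuousAt_const.clm_comp hz)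
    (hdc.mono fun z hz => continuousAt_const.clm_comp hz)
    (hCev.mono fun z hz => ContinuousAt.comp (g := w) (f := fun z => ((f ∘ χ.symm) z).2)
      (hw.contDiffAt (hI.mem_nhds (hτI _))).continuousAt hz.continuousAt.snd)
    (Filter.Eventually.of_forall fun z => hw' _ (hτI _))
    (hCev.mono fun z hz => hz.continuousAt.fst)
    (Filter.Eventually.of_forall fun z => hmem _)
    (by
      filter_upwards [hT] with z ⟨T, hT⟩ v
      rw [hT _ f (hfd _)]
      exact hf.tangent_fst (by norm_num) _ (T v))
    (by
      filter_upwards [hT] with z ⟨T, hT⟩ v hv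
      rw [hT _ f (hfd _)]
      have := hf.pos (χ.symm z) (mem_univ _) (T v) (by simpa using hv)
      exact sub_pos.1 this)
  have hev : ∀ᶠ y in 𝓝 x, y ∈ χ.source ∧ ζ₁ (χ y) ≠ ζ₂ (χ y) ∧ ∀ ζ, ζ = ζ₁ ∨ ζ = ζ₂ →
      ContinuousAt (fun y => ζ (χ y)) y ∧
      AdaptedFrame (f y).1 (screenMap w f y (ζ (χ y))) (ζ (χ y)) := by
    filter_upwards [(tendsto_chart x).eventually (hζ.and hT),
      extChartAt_source_mem_nhds (I := 𝓡 n) x] with y ⟨⟨h1, h2⟩, T, hT⟩ hs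
    refine ⟨hs, h1, fun ζ hζ' => ?_⟩
    obtain ⟨g1, g2, g3, g4⟩ := h2 ζ hζ'
    have hyy : χ.symm (χ y) = y := χ.left_inv hs
    refine ⟨ContinuousAt.comp (g := ζ) g1 (continuousAt_extChartAt' hs), ?_⟩
    have hwy := hw' _ (hτI y)
    simp only [Function.comp_apply, ← hχ, hyy] at g2 g3
    refine adaptedFrame_screenMap (hmem y) (hf.tangent_fst (by norm_num) y) hwy
      (hf.pos y (mem_univ y)) ⟨g2, fun v => ?_⟩ g4
    have hTy := hT _ f (hfd _)
    rw [← hχ] at hTy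
    rw [hTy, hyy] at g3
    have h3 := g3 (T.symm v)
    simp only [ContinuousLinearMap.comp_apply, ContinuousLinearEquiv.coe_coe,
      ContinuousLinearEquiv.apply_symm_apply, ContinuousLinearMap.coe_fst',
      ContinuousLinearMap.coe_snd'] at h3
    rw [warpedMetric]
    linear_combination w (f y).2 * h3
  obtain ⟨V, hVs, hVo, hxV⟩ := mem_nhds_iff.1 hev
  refine ⟨V, fun y => ζ₁ (χ y), fun y => ζ₂ (χ y), hVo, hxV,
    ⟨fun y hy => ((hVs hy).2.2 ζ₁ (Or.inl rfl)).1.continuousWithinAt,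
      fun y hy => ((hVs hy).2.2 ζ₁ (Or.inl rfl)).2⟩,
    ⟨fun y hy => ((hVs hy).2.2 ζ₂ (Or.inr rfl)).1.continuousWithinAt,
      fun y hy => ((hVs hy).2.2 ζ₂ (Or.inr rfl)).2⟩, fun y hy => (hVs hy).2.1⟩

namespace IsNullField

lemma mul_warpedMetric_mean (hn : 1 ≤ n) (hI : IsOpen I) (hw : ContDiffOn ℝ ∞ w I)
    (hw' : ∀ t ∈ I, 0 < w t) (hf : IsSpacelike c I w 5 univ f) (hV : IsOpen V)
    (hN : IsNullField w V f ζ) {x : M} (hx : x ∈ V)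
    {D : Module.End ℝ (EuclideanSpace ℝ (Fin n))} (hD : ∀ v : EuclideanSpace ℝ (Fin n),
      dmap ζ x v + ((c : ℝ) * ((w (f x).2)⁻¹ * (dmap f x v).2)) • (f x).1 =
        screenMap w f x (ζ x) (D v)) :
    n * warpedMetric c n w (f x) (meanCurvatureVector w f x) (ζ x, w (f x).2) =
      -(LinearMap.trace ℝ _ D + n * deriv w (f x).2) := by
  have hfy : ∀ y, ContMDiffAt (𝓡 n) 𝓘(ℝ, Amb c n × ℝ) 5 f y := fun y =>
    hf.contMDiffOn.contMDiffAt Filter.univ_mem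
  have hτx := (hf.mem x (mem_univ x)).2
  exact mul_warpedMetric_meanCurvatureVector hn ((hfy x).of_le (by norm_num))
    (Filter.Eventually.of_forall fun y => (hfy y).mdifferentiableAt (by norm_num))
    ((hN.contMDiffAt hI hw hw' hf hV hx).mdifferentiableAt (by norm_num)) (hw' _ hτx)
    ((hw.contDiffAt (hI.mem_nhds hτx)).differentiableAt (by simp)) (hN.frame x hx)
    (Filter.eventually_of_mem (hV.mem_nhds hx) fun y hy =>
      hN.form_dmap hy (hw' _ (hf.mem y (mem_univ y)).2)) hD

/-- The trace of the Weingarten operator of a null normal field is given, near a point, by a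
continuous function. -/
lemma exists_continuous_trace (hI : IsOpen I) (hw : ContDiffOn ℝ ∞ w I)
    (hw' : ∀ t ∈ I, 0 < w t) (hf : IsSpacelike c I w 5 univ f) (hV : IsOpen V)
    (hN : IsNullField w V f ζ) {x : M} (hx : x ∈ V) :
    ∃ t : M → ℝ, ContinuousAt t x ∧ ∀ᶠ y in 𝓝 x,
      ∀ D : Module.End ℝ (EuclideanSpace ℝ (Fin n)), (∀ v : EuclideanSpace ℝ (Fin n),
        dmap ζ y v + ((c : ℝ) * ((w (f y).2)⁻¹ * (dmap f y v).2)) • (f y).1 =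
          screenMap w f y (ζ y) (D v)) → LinearMap.trace ℝ _ D = t y := by
  set χ := extChartAt (𝓡 n) x with hχ
  have hfy : ∀ y, ContMDiffAt (𝓡 n) 𝓘(ℝ, Amb c n × ℝ) 5 f y := fun y =>
    hf.contMDiffOn.contMDiffAt Filter.univ_mem
  have hfd : ∀ y, MDifferentiableAt (𝓡 n) 𝓘(ℝ, Amb c n × ℝ) f y := fun y =>
    (hfy y).mdifferentiableAt (by norm_num)
  have hζd : ∀ y ∈ V, MDifferentiableAt (𝓡 n) 𝓘(ℝ, Amb c n) ζ y := fun y hy =>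
    (hN.contMDiffAt hI hw hw' hf hV hy).mdifferentiableAt (by norm_num)
  have hxx : χ.symm (χ x) = x := extChartAt_to_inv x
  have hfc : ContDiffAt ℝ 5 (f ∘ χ.symm) (χ x) := contDiffAt_chart (hfy x)
  have hζc : ContDiffAt ℝ 4 (ζ ∘ χ.symm) (χ x) :=
    contDiffAt_chart (hN.contMDiffAt hI hw hw' hf hV hx)
  have hdf : ContinuousAt (fderiv ℝ (f ∘ χ.symm)) (χ x) :=
    (hfc.fderiv_right (m := 4) (by norm_num)).continuousAt
  have hdζ : ContinuousAt (fderiv ℝ (ζ ∘ χ.symm)) (χ x) :=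
    (hζc.fderiv_right (m := 3) (by norm_num)).continuousAt
  have hτI : ∀ y, (f y).2 ∈ I := fun y => (hf.mem y (mem_univ y)).2
  have hwc : ContinuousAt (fun z => (w ((f ∘ χ.symm) z).2)⁻¹) (χ x) :=
    (ContinuousAt.comp (g := w) (f := fun z => ((f ∘ χ.symm) z).2)
      (hw.contDiffAt (hI.mem_nhds (hτI _))).continuousAt hfc.continuousAt.snd).inv₀
      (hw' _ (hτI _)).ne'
  have hdτ : ContinuousAt (fun z => (ContinuousLinearMap.snd ℝ (Amb c n) ℝ).comp
      (fderiv ℝ (f ∘ χ.symm) z)) (χ x) := continuousAt_const.clm_comp hdf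
  have hsr : ∀ g : EuclideanSpace ℝ (Fin n) → Amb c n, ContinuousAt g (χ x) →
      ContinuousAt (fun z => ((ContinuousLinearMap.snd ℝ (Amb c n) ℝ).comp
        (fderiv ℝ (f ∘ χ.symm) z)).smulRight (g z)) (χ x) := fun g hg =>
    ((ContinuousLinearMap.smulRightL ℝ (EuclideanSpace ℝ (Fin n)) (Amb c n)).continuous.continuousAt.comp
      hdτ).clm_apply hg
  -- Y and R are the two sides of the Weingarten equation read in the fixed chart. Both are
  -- continuous, and R = Y ∘ D up to conjugation of D by the change of chart.
  let Y : EuclideanSpace ℝ (Fin n) → EuclideanSpace ℝ (Fin n) →L[ℝ] Amb c n := fun z =>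
    (ContinuousLinearMap.fst ℝ (Amb c n) ℝ).comp (fderiv ℝ (f ∘ χ.symm) z) -
      (w ((f ∘ χ.symm) z).2)⁻¹ • ((ContinuousLinearMap.snd ℝ (Amb c n) ℝ).comp
        (fderiv ℝ (f ∘ χ.symm) z)).smulRight ((ζ ∘ χ.symm) z)
  let R : EuclideanSpace ℝ (Fin n) → EuclideanSpace ℝ (Fin n) →L[ℝ] Amb c n := fun z =>
    fderiv ℝ (ζ ∘ χ.symm) z + ((c : ℝ) * (w ((f ∘ χ.symm) z).2)⁻¹) •
      ((ContinuousLinearMap.snd ℝ (Amb c n) ℝ).comp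
        (fderiv ℝ (f ∘ χ.symm) z)).smulRight ((f ∘ χ.symm) z).1
  have hY : ContinuousAt Y (χ x) :=
    (continuousAt_const.clm_comp hdf).sub (hwc.smul (hsr _ hζc.continuousAt))
  have hR : ContinuousAt R (χ x) :=
    hdζ.add ((continuousAt_const.mul hwc).smul (hsr _ hfc.continuousAt.fst))
  have hYx : Y (χ x) = screenMap w f x (ζ x) := by
    simp only [Y, Function.comp_apply, hxx, screenMap, dmap_eq_fderiv (hfd x), ← hχ]
  -- A left inverse of Y at the single point x suffices: Γ ∘ Y stays invertible nearby, so (Γ ∘ Y)⁻¹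
  -- ∘ Γ ∘ R recovers the conjugate of D continuously.
  obtain ⟨Γ₀, hΓ₀⟩ := (Y (χ x) : EuclideanSpace ℝ (Fin n) →ₗ[ℝ] Amb c n).exists_leftInverse_of_injective
    (LinearMap.ker_eq_bot.2 (by rw [hYx]; exact (hN.frame x hx).injective))
  let Γ : Amb c n →L[ℝ] EuclideanSpace ℝ (Fin n) := LinearMap.toContinuousLinearMap Γ₀
  have hΓ : Γ.comp (Y (χ x)) = ((ContinuousLinearEquiv.refl ℝ (EuclideanSpace ℝ (Fin n))) :
      EuclideanSpace ℝ (Fin n) →L[ℝ] EuclideanSpace ℝ (Fin n)) := by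
    ext1 v
    exact LinearMap.congr_fun hΓ₀ v
  have hΓY : ContinuousAt (fun z => Γ.comp (Y z)) (χ x) := continuousAt_const.clm_comp hY
  have hinv : ContinuousAt (fun z => (Γ.comp (Y z)).inverse) (χ x) := by
    refine ContinuousAt.comp (g := ContinuousLinearMap.inverse) (f := fun z => Γ.comp (Y z)) ?_ hΓY
    rw [hΓ]
    exact (contDiffAt_map_inverse (n := 0) _).continuousAt
  have hunit : ∀ᶠ z in 𝓝 (χ x), (Γ.comp (Y z)).IsInvertible := by
    have h1 := ContinuousLinearEquiv.nhds (ContinuousLinearEquiv.refl ℝ (EuclideanSpace ℝ (Fin n)))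
    rw [← hΓ] at h1
    exact hΓY.eventually h1
  let tr : (EuclideanSpace ℝ (Fin n) →L[ℝ] EuclideanSpace ℝ (Fin n)) →ₗ[ℝ] ℝ :=
    (LinearMap.trace ℝ (EuclideanSpace ℝ (Fin n))) ∘ₗ ContinuousLinearMap.coeLM ℝ
  let t : EuclideanSpace ℝ (Fin n) → ℝ := fun z =>
    tr ((Γ.comp (Y z)).inverse.comp (Γ.comp (R z)))
  have ht : ContinuousAt t (χ x) :=
    (LinearMap.continuous_of_finiteDimensional tr).continuousAt.comp
      (hinv.clm_comp (continuousAt_const.clm_comp hR))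
  refine ⟨fun y => t (χ y), ContinuousAt.comp (g := t) ht (continuousAt_extChartAt x), ?_⟩
  filter_upwards [(tendsto_chart x).eventually ((eventually_fderiv_chart_eq x).and hunit),
    hV.mem_nhds hx, extChartAt_source_mem_nhds (I := 𝓡 n) x] with y ⟨⟨T, hT⟩, hun⟩ hyV hs D hD
  have hyy : χ.symm (χ y) = y := χ.left_inv hs
  rw [← hχ, hyy] at hT
  have hTf := hT _ f (hfd y)
  have hTζ := hT _ ζ (hζd y hyV)
  have hYy : ∀ v, Y (χ y) v = screenMap w f y (ζ y) (T v) := by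
    intro v
    simp only [Y, hTf, screenMap, Function.comp_apply, hyy]
    rfl
  have hRy : ∀ v, R (χ y) v = screenMap w f y (ζ y) (D (T v)) := by
    intro v
    rw [← hD]
    simp only [R, hTf, hTζ, Function.comp_apply, hyy]
    simp [smul_smul, mul_assoc]
  have hfac : R (χ y) = (Y (χ y)).comp (LinearMap.toContinuousLinearMap
      (T.symm.toLinearEquiv.toLinearMap ∘ₗ D ∘ₗ T.toLinearEquiv.toLinearMap)) := by
    ext1 v
    rw [hRy, ContinuousLinearMap.comp_apply, hYy]
    simp
  obtain ⟨e, he⟩ := hun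
  have he' : ∀ u, Γ (Y (χ y) u) = e u := fun u => (DFunLike.congr_fun he u).symm
  have hcomp : (Γ.comp (Y (χ y))).inverse.comp (Γ.comp (R (χ y))) =
      LinearMap.toContinuousLinearMap
        (T.symm.toLinearEquiv.toLinearMap ∘ₗ D ∘ₗ T.toLinearEquiv.toLinearMap) := by
    rw [hfac, ← ContinuousLinearMap.comp_assoc, ← he, ContinuousLinearMap.inverse_equiv]
    ext1 v
    simp [he']
  simp only [t]
  rw [hcomp]
  -- The trace does not see the change of chart T.
  exact (LinearMap.trace_conj' D T.symm.toLinearEquiv).symm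

/-- If the mean curvature vector is not collinear to a null normal field at a point, then it is not
collinear to it near that point. -/
lemma eventually_mean_ne_zero (hn : 1 ≤ n) (hI : IsOpen I) (hw : ContDiffOn ℝ ∞ w I)
    (hw' : ∀ t ∈ I, 0 < w t) (hf : IsSpacelike c I w 5 univ f) (hV : IsOpen V)
    (hN : IsNullField w V f ζ) {x : M} (hx : x ∈ V)
    (hne : warpedMetric c n w (f x) (meanCurvatureVector w f x) (ζ x, w (f x).2) ≠ 0) :
    ∀ᶠ y in 𝓝 x,
      warpedMetric c n w (f y) (meanCurvatureVector w f y) (ζ y, w (f y).2) ≠ 0 := by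
  obtain ⟨t, ht, hev⟩ := hN.exists_continuous_trace hI hw hw' hf hV hx
  have key : ∀ᶠ y in 𝓝 x,
      n * warpedMetric c n w (f y) (meanCurvatureVector w f y) (ζ y, w (f y).2) =
        -(t y + n * deriv w (f y).2) := by
    filter_upwards [hev, hV.mem_nhds hx] with y hy hyV
    obtain ⟨D, hD⟩ := hN.exists_weingarten hI hw hw' hf hV hyV
    rw [← hy D hD]
    exact hN.mul_warpedMetric_mean hn hI hw hw' hf hV hyV hD
  have hn0 : (n : ℝ) ≠ 0 := by exact_mod_cast (by omega : n ≠ 0)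
  have hτx := (hf.mem x (mem_univ x)).2
  have hdw : ContinuousAt (fun y => deriv w (f y).2) x := by
    refine ContinuousAt.comp (g := deriv w) (f := fun y => (f y).2) ?_
      (hf.contMDiffOn.contMDiffAt Filter.univ_mem).continuousAt.snd
    exact (((contDiffOn_infty_iff_deriv_of_isOpen hI).1 hw).2.continuousOn).continuousAt
      (hI.mem_nhds hτx)
  have hcont : ContinuousAt (fun y => -(t y + n * deriv w (f y).2)) x :=
    (ht.add (continuousAt_const.mul hdw)).neg
  have hx0 : -(t x + n * deriv w (f x).2) ≠ 0 := by
    rw [← key.self_of_nhds]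
    exact mul_ne_zero hn0 hne
  filter_upwards [hcont.eventually_ne hx0, key] with y h1 h2 h3
  rw [h3, mul_zero] at h2
  exact h1 h2.symm

end IsNullField

lemma IsSpacelike.isNormalAt_mean (hI : IsOpen I) (hw : ContDiffOn ℝ ∞ w I)
    (hw' : ∀ t ∈ I, 0 < w t) (hf : IsSpacelike c I w 5 univ f) (y : M) :
    IsNormalAt w f y (meanCurvatureVector w f y) :=
  have hy := hf.mem y (mem_univ y)
  (meanCurvatureVector_spec hy.1 (hw' _ hy.2)
    ((hw.contDiffAt (hI.mem_nhds hy.2)).differentiableAt (by simp))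
    (hf.tangent_fst (by norm_num) y) (hf.pos y (mem_univ y))).1

/-- A null normal vector that is not a multiple of one of two distinct null normal vectors is a
multiple of the other one. -/
lemma exists_smul_of_null {x : M} {z₁ z₂ : Amb c n} (hw : 0 < w (f x).2)
    (h₁ : AdaptedFrame (f x).1 (screenMap w f x z₁) z₁)
    (h₂ : AdaptedFrame (f x).1 (screenMap w f x z₂) z₂) (hne : z₁ ≠ z₂) {H : Amb c n × ℝ}
    (hH : IsNormalAt w f x H) (h0 : warpedMetric c n w (f x) H H = 0)
    (hH2 : warpedMetric c n w (f x) H (z₂, w (f x).2) ≠ 0) :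
    ∃ a : ℝ, H = a • (z₁, w (f x).2) := by
  have hN1 := isNormalAt_of_frame h₁
  have hG : warpedMetric c n w (f x) (z₁, w (f x).2) (z₂, w (f x).2) ≠ 0 := by
    intro hG
    have h := eq_smul_null hw h₂ hN1 hG
    rw [mul_inv_cancel₀ hw.ne', one_smul] at h
    exact hne (congrArg Prod.fst h)
  -- Chosen so that H - a N₁ is orthogonal to N₂ and hence a multiple b N₂. Then ⟨H, H⟩ = 2ab⟨N₁,
  -- N₂⟩, and a ≠ 0 forces b = 0.
  set a := warpedMetric c n w (f x) H (z₂, w (f x).2) /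
    warpedMetric c n w (f x) (z₁, w (f x).2) (z₂, w (f x).2) with ha
  have hX : IsNormalAt w f x (H - a • (z₁, w (f x).2)) := by
    refine ⟨?_, fun v => ?_⟩
    · rw [Prod.fst_sub, Prod.smul_fst, form_sub_right, form_smul_right]
      linear_combination hH.1 - a * hN1.1
    · rw [warpedMetric_sub_right, warpedMetric_smul_right, hH.2, hN1.2]; ring
  have hX2 : warpedMetric c n w (f x) (H - a • (z₁, w (f x).2)) (z₂, w (f x).2) = 0 := by
    rw [warpedMetric_sub_left, warpedMetric_smul_left, ha]
    field_simp
    ring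
  have hXe := eq_smul_null hw h₂ hX hX2
  set b := (H - a • (z₁, w (f x).2)).2 * (w (f x).2)⁻¹
  have hHe : H = a • (z₁, w (f x).2) + b • (z₂, w (f x).2) := by rw [← hXe]; abel
  have hn1 := warpedMetric_null (w (f x).2) (f x) h₁.unit rfl
  have hn2 := warpedMetric_null (w (f x).2) (f x) h₂.unit rfl
  have ha0 : a ≠ 0 := div_ne_zero hH2 hG
  have hb : b = 0 := by
    rw [hHe] at h0
    simp only [warpedMetric_add_left, warpedMetric_add_right, warpedMetric_smul_left,
      warpedMetric_smul_right, hn1, hn2,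
      warpedMetric_comm (f x) (z₂, w (f x).2) (z₁, w (f x).2)] at h0
    have : b * (2 * a * warpedMetric c n w (f x) (z₁, w (f x).2) (z₂, w (f x).2)) = 0 := by
      linear_combination h0
    exact (mul_eq_zero.1 this).resolve_right (mul_ne_zero (mul_ne_zero two_ne_zero ha0) hG)
  exact ⟨a, by rw [hHe, hb, zero_smul, add_zero]⟩

/-- A marginally trapped submanifold of codimension two is locally represented at the points of a
dense set. -/
theorem dense_isLocallyRepresentedAt (hn : 1 ≤ n) (hI : IsOpen I) (hI' : I.OrdConnected)
    (hw : ContDiffOn ℝ ∞ w I) (hw' : ∀ t ∈ I, 0 < w t) (hf : IsSpacelike c I w 5 univ f)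
    (hT : IsMarginallyTrapped w univ f) : Dense {x | IsLocallyRepresentedAt I w f x} := by
  rw [dense_iff_inter_open]
  rintro O hO ⟨x, hx⟩
  obtain ⟨V, ζ₁, ζ₂, hVo, hxV, hN₁, hN₂, hne⟩ := exists_pair_nullFields hI hw hw' hf x
  have hwpos : ∀ y, 0 < w (f y).2 := fun y => hw' _ (hf.mem y (mem_univ y)).2
  -- Either ⟨H, N₂⟩ is nonzero at some y of V ∩ O, hence near y, and H is collinear to N₁ there; or
  -- it vanishes on all of V ∩ O and H is collinear to N₂ around x.
  by_cases hcase : ∃ y ∈ V ∩ O,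
      warpedMetric c n w (f y) (meanCurvatureVector w f y) (ζ₂ y, w (f y).2) ≠ 0
  · obtain ⟨y, hy, hy2⟩ := hcase
    obtain ⟨V', hV's, hV'o, hyV'⟩ := mem_nhds_iff.1
      ((hN₂.eventually_mean_ne_zero hn hI hw hw' hf hVo hy.1 hy2).and (hVo.mem_nhds hy.1))
    refine ⟨y, hy.2, (hN₁.mono fun z hz => (hV's hz).2).isLocallyRepresentedAt hn hI hI' hw hw' hf
      hV'o (fun z hz => ?_) hyV'⟩
    obtain ⟨h1, h2⟩ := hV's hz
    exact exists_smul_of_null (hwpos z) (hN₁.frame z h2) (hN₂.frame z h2) (hne z h2)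
      (hf.isNormalAt_mean hI hw hw' z) (hT z (mem_univ z)) h1
  · push Not at hcase
    refine ⟨x, hx, (hN₂.mono inter_subset_left).isLocallyRepresentedAt hn hI hI' hw hw' hf
      (hVo.inter hO) (fun z hz => ?_) ⟨hxV, hx⟩⟩
    exact ⟨_, eq_smul_null (hwpos z) (hN₂.frame z hz.1) (hf.isNormalAt_mean hI hw hw' z)
      (hcase z hz)⟩

end Manifold

end

end RobertsonWalker

/-! ### The theorem -/

theorem theorem2 (c : SignType) (n : ℕ) (hn : 1 ≤ n)
    (I : Set ℝ) (hI : IsOpen I) (hI' : I.OrdConnected)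
    (w : ℝ → ℝ) (hw : ContDiffOn ℝ ∞ w I) (hw' : ∀ t ∈ I, 0 < w t)
    (M : Type*) [TopologicalSpace M] [ChartedSpace (EuclideanSpace ℝ (Fin n)) M]
    [IsManifold (𝓡 n) ∞ M] :
    -- the map built from `φ`, `ν`, `τ` is marginally trapped if and only if the equation holds
    (∀ t₀ ∈ I, ∀ (φ ν : M → Amb c n) (τ : M → ℝ), IsHypersurface c univ φ ν →
      ContMDiff (𝓡 n) 𝓘(ℝ, ℝ) 2 τ → (∀ x, τ x ∈ I) →
      ((IsSpacelike c I w 2 univ (phiBar w t₀ φ ν τ) ∧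
          IsMarginallyTrappedAlong w univ (phiBar w t₀ φ ν τ) (nuBar w t₀ φ ν τ)) ↔
        ∀ x, MainEquation w t₀ φ ν τ x) ∧
      ((∀ x, MainEquation w t₀ φ ν τ x) → IsMarginallyTrapped w univ (phiBar w t₀ φ ν τ))) ∧
    -- conversely, marginally trapped submanifolds of codimension two are locally of this form
    (∀ f : M → Amb c n × ℝ, IsSpacelike c I w 5 univ f →
      ((∀ (x : M) (V : Set M) (N : M → Amb c n × ℝ), IsOpen V → x ∈ V →
          IsMarginallyTrappedAlong w V f N → IsLocallyRepresentedAt I w f x) ∧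
        (IsMarginallyTrapped w univ f → Dense {x | IsLocallyRepresentedAt I w f x}))) := by
  refine ⟨fun t₀ h₀ φ ν τ h hτ hτI => ?_, fun f hf => ⟨fun x V N hV hx hN => ?_, fun hT => ?_⟩⟩
  · have hiff := isMarginallyTrappedAlong_phiBar_iff hn hI hI' hw hw' h₀ h hτ hτI
    exact ⟨hiff, fun hM => (hiff.2 hM).2.isMarginallyTrapped⟩
  · obtain ⟨ζ, hζ, hH⟩ := hN.exists_isNullField hI hw hw' (by norm_num) hf
    exact hζ.isLocallyRepresentedAt hn hI hI' hw hw' hf hV hH hx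
  · exact dense_isLocallyRepresentedAt hn hI hI' hw hw' hf hT
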